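/- **Theorem (Kharlamova case).** Let $n\ge 2$ and let $\langle X,Y\rangle=-\frac12\operatorname{tr}(XY)$ on $so(n)$. Let $E_1,\dots,E_n$ be the standard basis of $\mathbb R^n$, $X\wedge Y=XY^t-YX^t$, and $\mathcal D=\mathrm{span}\{E_1\wedge E_n,\dots,E_{n-1}\wedge E_n\}\subset so(n)$. Let $\mathcal I:so(n)\to so(n)$ be a symmetric positive definite inertia operator preserving the decomposition $so(n)=so(n-1)\oplus\mathcal D$, $so(n-1)=\mathcal D^\perp$ (for instance $\mathcal I\omega=I\omega+\omega I$ with $I$ diagonal and $I_i+I_j>0$ for $i\neq j$), let $J_{ij}=\langle\mathcal I(E_j\wedge E_n),E_i\wedge E_n\rangle$ and $A=J^{-1}$. Let $v(\mathbf q)=C_1q_1+\dots+C_{n-1}q_{n-1}$, $C=(C_1,\dots,C_{n-1})\in\mathbb R^{n-1}$ arbitrary. The *Suslov problem* on $D=\{(g,g\omega): g\in SO(n),\ \omega\in\mathcal D\}$ is the system $$\dot g=g\omega,\quad \omega\in\mathcal D,\qquad \Big\langle \tfrac{d}{dt}(\mathcal I\omega)-[\mathcal I\omega,\omega]-\tfrac{\partial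 v}{\partial e_n}\wedge e_n,\ \eta\Big\rangle=0\quad\text{for all }\eta\in\mathcal D,$$ where $e_n$ is the last row of $g$. With $\mathbf q=(q,q_n)=e_n$ and $-\omega_{in}=(Ap)_i$ it reduces by $SO(n-1)$ to the *reduced Suslov problem* $$\dot q=q_nAp,\qquad \dot q_n=-(Ap,q),\qquad \dot p=-q_n\frac{\partial v}{\partial q}+\frac{\partial v}{\partial q_n}q$$ on $\mathcal M=S^{n-1}\{\mathbf q\}\times\mathbb R^{n-1}\{p\}$. Let $\pi:\mathcal M\to T^*\bar B$, $\pi(\mathbf q,p)=(q,p)$, where $T^*\bar B=\{(q,p): |q|\le1\}$, with boundary $\Lambda=\{|q|=1\}$. 1. The phase space $\mathcal M$ is foliated almost everywhere by invariant $(n-1)$-dimensional spheres. That is, there are smooth first integrals $f_1,\dots,f_{n-1}:\mathcal M\to\mathbb R$ of the reduced problem, which Poisson commute in the variables $(q,p)$, $|q|<1$, after each of the substitutions $q_n=\pm\sqrt{1-(q,q)}$, and an open set $U\subset\mathcal M$ whose complement has measure zero, such that $(f_1,\dots,f_{n-1})$ is a submersion on $U$ and, for every $x\in U$, the connected component $L$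 through $x$ of the joint level set $\{f_i=f_i(x),\ i=1,\dots,n-1\}$ is contained in $U$, is invariant, and is a smoothly embedded sphere $S^{n-1}$. Moreover $L$ is a double branched cover of a ball, i.e. two copies of a ball glued along its boundary in $\Lambda$: $\pi(L)$ is homeomorphic to the closed unit ball of $\mathbb R^{n-1}$, its boundary sphere corresponds to $\pi(L)\cap\Lambda$, $L=\pi^{-1}(\pi(L))$, and the parametrisations of $L$ by $S^{n-1}$ and of $\pi(L)$ by the ball can be chosen so that $\pi|_L$ becomes the projection $S^{n-1}\to\bar B^{n-1}$ that forgets the last coordinate. 2. For almost every $x\in\mathcal M$ the trajectory of the reduced problem through $x$ is closed (periodic and not an equilibrium). 3. The distribution $D$ is filled with conditionally periodic trajectories of maximal dimension $[n/(n-1)]+1$: for almost every point of $D$ (Haar measure on $SO(n)$ times Lebesgue measure on $\mathcal D$), the trajectory of the Suslov problem through this point projects to a closed trajectory of the reduced problem and is conditionally periodic of some dimension $m\le[n/(n-1)]+1$; and if $n\ge3$ and $C\ne0$, some trajectory in $D$ is conditionally periodic of dimension exactly $[n/(n-1)]+1$. Here a curve is conditionally periodic of dimension $m$ if it has the form $\Phi(\Omega_1t,\dots,\Omega_mt)$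 with $\Phi:(\mathbb R/\mathbb Z)^m\to D$ continuous and injective and $\Omega_1,\dots,\Omega_m$ linearly independent over $\mathbb Q$. -/

import Mathlib

open MeasureTheory Metric Set
open scoped ContDiff Manifold Matrix

noncomputable section

namespace Suslov

/-! The dimension of the rigid body is `n = d + 1`. The index `Fin.last d` stands for the last
index `n`, and `i.castSucc` with `i : Fin d` for the indices `1, …, n - 1`. -/

/-- The Euclidean space `ℝⁿ` with `n = d + 1`. -/
abbrev Full (d : ℕ) := EuclideanSpace ℝ (Fin (d + 1))

/-- The Euclidean space `ℝⁿ⁻¹`. -/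
abbrev Flat (d : ℕ) := EuclideanSpace ℝ (Fin d)

/-- The sphere `Sⁿ⁻¹ ⊂ ℝⁿ`. -/
abbrev Sph (d : ℕ) := sphere (0 : Full d) 1

/-- The first `n - 1` coordinates of a vector of `ℝⁿ`. -/
def trunc {d : ℕ} (x : Full d) : Flat d := WithLp.toLp 2 fun i => x i.castSucc

/-- Real `n × n` matrices. -/
abbrev Mat (d : ℕ) := Matrix (Fin (d + 1)) (Fin (d + 1)) ℝ

/-! ### The Lie algebra `so(n)`, the subspace `𝔇` and the inertia operator -/

/-- The Lie algebra `so(n)` of skew-symmetric matrices. -/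
abbrev SkewAlg (d : ℕ) := LieAlgebra.Orthogonal.so (Fin (d + 1)) ℝ

/-- The wedge product `X ∧ Y = X Yᵗ - Y Xᵗ`. -/
def wedge {d : ℕ} (X Y : Fin (d + 1) → ℝ) : SkewAlg d :=
  ⟨Matrix.vecMulVec X Y - Matrix.vecMulVec Y X, by
    rw [LieAlgebra.Orthogonal.mem_so, Matrix.transpose_sub, Matrix.transpose_vecMulVec,
      Matrix.transpose_vecMulVec, neg_sub]⟩

/-- The (normalised) Killing metric `⟨X, Y⟩ = -½ tr (X Y)`; the `Eᵢ ∧ Eⱼ`, `i < j`, are orthonormal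
for it. -/
def killing {d : ℕ} (X Y : SkewAlg d) : ℝ :=
  -(1 / 2) * Matrix.trace ((X : Mat d) * (Y : Mat d))

/-- The vector `Eᵢ ∧ Eₙ` of `so(n)`, for `i < n`. -/
def basicWedge {d : ℕ} (i : Fin d) : SkewAlg d :=
  wedge (Pi.single i.castSucc 1) (Pi.single (Fin.last d) 1)

/-- The subspace `𝔇 = span {E₁ ∧ Eₙ, …, Eₙ₋₁ ∧ Eₙ}` of `so(n)` that defines the left-invariant
constraint distribution `D_g = g · 𝔇`. -/
def constraintSpace (d : ℕ) : Submodule ℝ (SkewAlg d) :=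
  Submodule.span ℝ (range basicWedge)

/-- An inertia operator of a rigid body: a symmetric positive definite operator on `so(n)` (the
kinetic energy is `½ ⟨𝓘 ω, ω⟩`) that preserves the decomposition `so(n) = so(n-1) ⊕ 𝔇`, where
`so(n-1)` is the orthogonal complement of `𝔇`. -/
structure InertiaOperator (d : ℕ) where
  toLin : SkewAlg d →ₗ[ℝ] SkewAlg d
  symm : ∀ X Y, killing (toLin X) Y = killing X (toLin Y)
  pos : ∀ X, X ≠ 0 → 0 < killing (toLin X) X
  map_constraint : ∀ X ∈ constraintSpace d, toLin X ∈ constraintSpace d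
  map_orthogonal : ∀ X, (∀ Y ∈ constraintSpace d, killing X Y = 0) →
    ∀ Y ∈ constraintSpace d, killing (toLin X) Y = 0

/-- The matrix `J` of the inertia operator on `𝔇`: `J_ij = 𝓘_{in,jn} = ⟨𝓘 (Eⱼ ∧ Eₙ), Eᵢ ∧ Eₙ⟩`. -/
def InertiaOperator.J {d : ℕ} (I : InertiaOperator d) : Matrix (Fin d) (Fin d) ℝ :=
  Matrix.of fun i j => killing (I.toLin (basicWedge j)) (basicWedge i)

/-- The matrix `A = J⁻¹`. -/
def InertiaOperator.A {d : ℕ} (I : InertiaOperator d) : Matrix (Fin d) (Fin d) ℝ := I.J⁻¹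

/-! ### The potential -/

/-- The gradient `∂v/∂𝐪` of a potential `v` on `ℝⁿ`. -/
def grad {d : ℕ} (v : Full d → ℝ) (q : Full d) : Fin (d + 1) → ℝ :=
  fun i => fderiv ℝ v q (EuclideanSpace.single i 1)

/-- The linear potential `v(𝐪) = C₁ q₁ + ⋯ + Cₙ₋₁ qₙ₋₁` of the Kharlamova case. -/
def kharlamovaPotential {d : ℕ} (C : Fin d → ℝ) : Full d → ℝ :=
  fun q => ∑ i, C i * q i.castSucc

/-! ### The reduced Suslov problem -/

/-- The phase space `𝓜 = Sⁿ⁻¹{𝐪} × ℝⁿ⁻¹{p}` of the reduced problem. -/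
abbrev ReducedPhase (d : ℕ) := Sph d × Flat d

/-- The standard measure on `𝓜`. -/
def reducedMeasure (d : ℕ) : Measure (ReducedPhase d) :=
  ((volume : Measure (Full d)).toSphere).prod volume

/-- `γ` solves the reduced Suslov equations
`q̇ = qₙ A p`, `q̇ₙ = -(A p, q)`, `ṗ = -qₙ ∂v/∂q + (∂v/∂qₙ) q`, where `𝐪 = (q, qₙ)`. -/
def IsReducedSolution {d : ℕ} (I : InertiaOperator d) (v : Full d → ℝ)
    (γ : ℝ → ReducedPhase d) : Prop :=
  ∀ t : ℝ,
    let q : Full d := (γ t).1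
    let p : Flat d := (γ t).2
    (∀ i : Fin d, HasDerivAt (fun s => ((γ s).1 : Full d) i.castSucc)
      (q (Fin.last d) * (I.A *ᵥ p) i) t) ∧
    HasDerivAt (fun s => ((γ s).1 : Full d) (Fin.last d))
      (-∑ i : Fin d, (I.A *ᵥ p) i * q i.castSucc) t ∧
    (∀ i : Fin d, HasDerivAt (fun s => (γ s).2 i)
      (-(q (Fin.last d) * grad v q i.castSucc) + grad v q (Fin.last d) * q i.castSucc) t)

/-- A closed trajectory: periodic and not an equilibrium. -/
def IsClosedTrajectory {X : Type*} (γ : ℝ → X) : Prop :=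
  (∃ T : ℝ, 0 < T ∧ Function.Periodic γ T) ∧ ∃ s t : ℝ, γ s ≠ γ t

/-- `f` is a first integral of the reduced problem. -/
def IsFirstIntegral {d : ℕ} (I : InertiaOperator d) (v : Full d → ℝ)
    (f : ReducedPhase d → ℝ) : Prop :=
  ∀ γ, IsReducedSolution I v γ → ∀ s t : ℝ, f (γ s) = f (γ t)

/-- `L ⊆ 𝓜` is invariant under the reduced dynamics. -/
def IsInvariant {d : ℕ} (I : InertiaOperator d) (v : Full d → ℝ)
    (L : Set (ReducedPhase d)) : Prop :=
  ∀ γ, IsReducedSolution I v γ → ∀ s t : ℝ, γ s ∈ L → γ t ∈ L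

/-! ### The decomposition of `𝓜` into two copies of `T*B̄`, and the Poisson bracket -/

/-- The projection `𝓜 → T*B̄ ⊂ ℝⁿ⁻¹ × ℝⁿ⁻¹`, `(𝐪, p) ↦ (q, p)` where `𝐪 = (q, qₙ)`; it is two-to-one
over `|q| < 1` and one-to-one over the boundary `Λ = {|q| = 1}` of `T*B`. -/
def toBall {d : ℕ} (x : ReducedPhase d) : Flat d × Flat d := (trunc (x.1 : Full d), x.2)

open Classical in
/-- The point `(q, ε √(1 - (q,q)))` of the sphere, for `|q| ≤ 1` and `ε = ±1` (otherwise junk). -/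
def hemisphere {d : ℕ} (ε : ℝ) (q : Flat d) : Sph d :=
  let y : Full d := WithLp.toLp 2 (Fin.snoc (α := fun _ => ℝ) q (ε * √(1 - ‖q‖ ^ 2)))
  if h : y ∈ sphere (0 : Full d) 1 then ⟨y, h⟩
  else ⟨EuclideanSpace.single (Fin.last d) 1, by simp⟩

/-- The function obtained from `f : 𝓜 → ℝ` by the substitution `qₙ = ε √(1 - (q,q))`. -/
def onBall {d : ℕ} (f : ReducedPhase d → ℝ) (ε : ℝ) : Flat d × Flat d → ℝ :=
  fun z => f (hemisphere ε z.1, z.2)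

/-- The canonical Poisson bracket of functions of `(q, p) ∈ ℝⁿ⁻¹ × ℝⁿ⁻¹`. -/
def poisson {d : ℕ} (f g : Flat d × Flat d → ℝ) (z : Flat d × Flat d) : ℝ :=
  ∑ k : Fin d,
    (fderiv ℝ f z (EuclideanSpace.single k 1, 0) * fderiv ℝ g z (0, EuclideanSpace.single k 1) -
      fderiv ℝ f z (0, EuclideanSpace.single k 1) * fderiv ℝ g z (EuclideanSpace.single k 1, 0))

/-- After either of the substitutions `qₙ = ±√(1 - (q,q))` the functions `fᵢ` Poisson commute on
`T*B`. -/
def InInvolution {d : ℕ} {ι : Type*} (f : ι → ReducedPhase d → ℝ) : Prop :=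
  ∀ i j, ∀ ε : ℝ, ε = 1 ∨ ε = -1 → ∀ z : Flat d × Flat d, ‖z.1‖ < 1 →
    poisson (onBall (f i) ε) (onBall (f j) ε) z = 0

/-! ### Invariant spheres -/

/-- `L ⊂ 𝓜` is a smoothly embedded `(n-1)`-sphere which is a double cover of a closed
`(n-1)`-ball in `T*B̄`, branched along the boundary sphere of the ball, which is the part of the
ball in `Λ = {|q| = 1}`. That is: there are a smooth embedding `φ` of `Sⁿ⁻¹` with image `L` (an
injective immersion; the domain is compact) and an injective continuous map `ψ` of the closed unit
ball of `ℝⁿ⁻¹` to `T*B̄` such that `L` is the full preimage of the image of `ψ` under `𝓜 → T*B̄`, the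
projection `L → T*B̄` corresponds to the vertical projection of `Sⁿ⁻¹` to the ball, and `ψ y ∈ Λ`
exactly for `y` in the boundary sphere. -/
def IsBranchedDoubleSphere {d : ℕ} (L : Set (ReducedPhase d)) : Prop :=
  ∃ (φ : Sph d → ReducedPhase d) (ψ : Flat d → Flat d × Flat d),
    ContMDiff (𝓡 d) ((𝓡 d).prod 𝓘(ℝ, Flat d)) ∞ φ ∧
    Function.Injective φ ∧
    (∀ x, Function.Injective (mfderiv (𝓡 d) ((𝓡 d).prod 𝓘(ℝ, Flat d)) φ x)) ∧
    range φ = L ∧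
    ContinuousOn ψ (closedBall 0 1) ∧
    InjOn ψ (closedBall 0 1) ∧
    toBall ⁻¹' (ψ '' closedBall 0 1) = L ∧
    (∀ x : Sph d, toBall (φ x) = ψ (trunc (x : Full d))) ∧
    (∀ y ∈ closedBall (0 : Flat d) 1, ‖(ψ y).1‖ = 1 ↔ ‖y‖ = 1)

/-- The connected component through `x` of the joint level set of the functions `fᵢ`. -/
def levelComponent {d : ℕ} {ι : Type*} (f : ι → ReducedPhase d → ℝ) (x : ReducedPhase d) :
    Set (ReducedPhase d) :=
  connectedComponentIn {y | ∀ i, f i y = f i x} x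

/-! ### The Suslov problem on the constraint distribution -/

/-- The group `SO(n)`. -/
abbrev SOn (d : ℕ) := Matrix.specialOrthogonalGroup (Fin (d + 1)) ℝ

instance (d : ℕ) : MeasurableSpace (SOn d) := borel _

instance (d : ℕ) : BorelSpace (SOn d) := ⟨rfl⟩

instance (d : ℕ) : IsTopologicalGroup (SOn d) where
  continuous_inv := by
    refine Continuous.subtype_mk (f := fun g : SOn d => star (g : Mat d)) ?_ _
    exact continuous_subtype_val.star

instance (d : ℕ) : CompactSpace (SOn d) := by
  have hK : IsCompact (Set.pi univ fun _ : Fin (d + 1) =>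
      Set.pi univ fun _ : Fin (d + 1) => Icc (-1 : ℝ) 1) :=
    isCompact_univ_pi fun _ => isCompact_univ_pi fun _ => isCompact_Icc
  have hS : (SOn d : Set (Mat d)) = {g : Mat d | g * gᵀ = 1} ∩ {g : Mat d | g.det = 1} := by
    ext g
    exact Matrix.mem_specialOrthogonalGroup_iff.trans
      (and_congr_left fun _ => Matrix.mem_orthogonalGroup_iff _ _)
  have hclosed : IsClosed (SOn d : Set (Mat d)) := by
    rw [hS]
    exact (isClosed_eq (by fun_prop) continuous_const).inter
      (isClosed_eq (by fun_prop) continuous_const)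
  have hsub : (SOn d : Set (Mat d)) ⊆ (Set.pi univ fun _ : Fin (d + 1) =>
      Set.pi univ fun _ : Fin (d + 1) => Icc (-1 : ℝ) 1) := by
    intro g hg i _ j _
    have h := entry_norm_bound_of_unitary (𝕜 := ℝ)
      (Matrix.mem_specialOrthogonalGroup_iff.mp hg).1 i j
    rw [Real.norm_eq_abs] at h
    exact abs_le.mp h
  exact isCompact_iff_compactSpace.mp (IsCompact.of_isClosed_subset (X := Mat d) hK hclosed hsub)

/-- The constraint distribution `D = {(g, g ω) | g ∈ SO(n), ω ∈ 𝔇}`, in the left trivialisation and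
with the coordinates `ω₁ₙ, …, ωₙ₋₁,ₙ` on `𝔇`. -/
abbrev DPhase (d : ℕ) := SOn d × Flat d

/-- The angular velocity `ω = ∑ᵢ ωᵢₙ Eᵢ ∧ Eₙ ∈ 𝔇` of a point of `D`. -/
def DPhase.angularVelocity {d : ℕ} (z : DPhase d) : SkewAlg d := ∑ i, z.2 i • basicWedge i

/-- The vector `eₙ` (fixed in the space, written in the body frame): the last row of `g`. -/
def DPhase.e {d : ℕ} (z : DPhase d) : Full d :=
  WithLp.toLp 2 fun j => (z.1 : Mat d) (Fin.last d) j

/-- The natural measure on `D`: Haar measure on `SO(n)` times Lebesgue measure on `𝔇`. -/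
def DMeasure (d : ℕ) : Measure (DPhase d) := (Measure.haar : Measure (SOn d)).prod volume

/-- `γ` is a trajectory of the Suslov problem on `D`: the kinematic equation `ġ = g ω` holds with
`ω ∈ 𝔇`, and so does the Euler–Poincaré–Suslov equation
`⟨d/dt (𝓘 ω) - [𝓘 ω, ω] - ∂v/∂eₙ ∧ eₙ, η⟩ = 0` for all `η ∈ 𝔇`. -/
def IsSuslovSolution {d : ℕ} (I : InertiaOperator d) (v : Full d → ℝ) (γ : ℝ → DPhase d) : Prop :=
  ∃ M' : ℝ → SkewAlg d, ∀ t : ℝ,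
    (∀ i j, HasDerivAt (fun s => ((γ s).1 : Mat d) i j)
      ((((γ t).1 : Mat d) * ((γ t).angularVelocity : Mat d)) i j) t) ∧
    (∀ i j, HasDerivAt (fun s => (I.toLin (γ s).angularVelocity : Mat d) i j)
      ((M' t : Mat d) i j) t) ∧
    ∀ η ∈ constraintSpace d,
      killing (M' t - ⁅I.toLin (γ t).angularVelocity, (γ t).angularVelocity⁆ -
        wedge (grad v (γ t).e) (γ t).e) η = 0

theorem DPhase.e_mem {d : ℕ} (z : DPhase d) : z.e ∈ sphere (0 : Full d) 1 := by
  have h := (Matrix.mem_orthogonalGroup_iff _ _).mp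
    (Matrix.mem_specialOrthogonalGroup_iff.mp z.1.2).1
  have h2 := congrFun (congrFun h (Fin.last d)) (Fin.last d)
  have h3 : ∑ j, (z.1 : Mat d) (Fin.last d) j ^ 2 = 1 := by
    simpa [Matrix.mul_apply, Matrix.star_apply, sq] using h2
  rw [mem_sphere_zero_iff_norm, EuclideanSpace.norm_eq]
  simp [DPhase.e, h3]

/-- The reduction `D → D/SO(n-1) ≈ 𝓜`, `(g, ω) ↦ (eₙ, p)` with `-ωᵢₙ = (A p)ᵢ`, i.e. `p = -J ω`. -/
def DPhase.reduce {d : ℕ} (I : InertiaOperator d) (z : DPhase d) : ReducedPhase d :=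
  (⟨z.e, z.e_mem⟩, WithLp.toLp 2 (-(I.J *ᵥ z.2)))

/-- The curve `γ` is conditionally periodic of dimension `m`: it is a linear winding
`t ↦ Φ(Ω₁ t, …, Ω_m t)` with rationally independent frequencies of an `m`-dimensional torus
`Φ : (ℝ/ℤ)ᵐ → X` embedded in the phase space. (Dimension `1`: closed trajectory, dimension `0`:
equilibrium.) -/
def IsConditionallyPeriodic {X : Type*} [TopologicalSpace X] (m : ℕ) (γ : ℝ → X) : Prop :=
  ∃ (Φ : (Fin m → UnitAddCircle) → X) (Ω : Fin m → ℝ),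
    Continuous Φ ∧ Function.Injective Φ ∧ LinearIndependent ℚ Ω ∧
    ∀ t : ℝ, γ t = Φ fun i => ((Ω i * t : ℝ) : UnitAddCircle)

end Suslov

end

/-!
Write `A` for the inverse inertia operator on `ℝⁿ⁻¹`, `c = ½ A C` and `P = A p`. For the linear
potential the reduced equations read `q̇ = qₙ A p`, `ṗ = -qₙ C`, so in the new time `τ = ∫ qₙ dt`
the momentum moves along a line and `q` along the parabola `q + τ P - τ² c`. Since
`qₙ² = 1 - |q|²`, the true time enters through a one-dimensional Newton equation
`τ̇² = 1 - |q + τ P - τ² c|²`: if the parabola meets the unit sphere transversally, `τ` oscillates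
between two simple zeros of the right hand side (`exists_periodic_motion`). Transversality fails
only on a null set: for fixed `q`, the vectors `P` of the tangent parabolas form, up to a
hyperplane, the image of a map that is constant on rays, so they have measure zero by Sard's
theorem (`volume_not_isTransverse`). Hence almost all reduced trajectories are closed.

A trajectory in `D` over a closed one solves a linear equation `ġ = g ω(t)` with periodic
coefficients, so after a period `g` is multiplied from the left by a fixed rotation `M`
(`exists_lift`). In the body, the angular velocity only involves the three-dimensional space
spanned by `P`, `c` and `Eₙ`; moreover `M` fixes the last basis vector, because the reduced
trajectory is closed. So `M` is a rotation in a plane (`exists_fixed_codim_two`,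
`SOn.eq_one_or_planeRot`). If its angle is a rational multiple of `2π`, the trajectory is closed,
and otherwise it winds densely around a two-dimensional torus
(`isOfFinOrder_or_conditionallyPeriodic_two`). For `n ≥ 3` and `C ≠ 0` the second case occurs:
along a family of symmetric parabolas the rotation angle is an explicit integral
(`exists_symmetric_motion`), which depends continuously on the parameter and is not constant
(`exists_irrational_rotRate`).

For the foliation let `C ≠ 0`, `e = C / |C|`, `ℓ(p) = (A p, e)` and `k = ℓ(C) > 0`. The components
of `p` orthogonal to `e` and `μ = (q, e) + ℓ(p)² / (2k)` are commuting first integrals that depend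
only on `(q, p)`. On a level set the only free variables are `r = ℓ(p)` and the part of `q`
orthogonal to `e`, and the level set is the set where `|q_⊥|² + qₙ² = 1 - (μ - r² / (2k))²`. For
`μ ≠ ±1` the right hand side has simple zeros, so each component of the region where it is
nonnegative is an interval `[α, β]`, with `1 - (μ - r² / (2k))² = (r - α) (β - r) K(r)` and
`K > 0` there (`exists_energy_well`). Dividing `q_⊥` and `qₙ` by `√K(r)` turns the component of
the level set into a round sphere (`isBranchedDoubleSphere_levelComponent`). For `C = 0` the
leaves are `Sⁿ⁻¹ × {p}`.
-/

noncomputable section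

namespace Suslov

/-! ### The inertia operator on `𝔇` -/

/-- The element `∑ xᵢ Eᵢ ∧ Eₙ` of `𝔇`. -/
def angVel {d : ℕ} (x : Fin d → ℝ) : SkewAlg d := ∑ i, x i • basicWedge i

theorem coe_basicWedge {d : ℕ} (i : Fin d) (a b : Fin (d + 1)) :
    (basicWedge i : Mat d) a b =
      (if a = i.castSucc ∧ b = Fin.last d then 1 else 0) -
        (if a = Fin.last d ∧ b = i.castSucc then 1 else 0) := by
  simp only [basicWedge, wedge, Matrix.sub_apply, Matrix.vecMulVec_apply, Pi.single_apply]
  split_ifs <;> simp_all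

theorem coe_angVel {d : ℕ} (x : Fin d → ℝ) (a b : Fin (d + 1)) :
    (angVel x : Mat d) a b = ∑ i, x i * (basicWedge i : Mat d) a b := by
  simp [angVel, Matrix.sum_apply]

@[simp] theorem angVel_castSucc_last {d : ℕ} (x : Fin d → ℝ) (i : Fin d) :
    (angVel x : Mat d) i.castSucc (Fin.last d) = x i := by
  simp [coe_angVel, coe_basicWedge, i.castSucc_ne_last]

@[simp] theorem angVel_last_castSucc {d : ℕ} (x : Fin d → ℝ) (i : Fin d) :
    (angVel x : Mat d) (Fin.last d) i.castSucc = -x i := by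
  simp [coe_angVel, coe_basicWedge, i.castSucc_ne_last]

@[simp] theorem angVel_castSucc_castSucc {d : ℕ} (x : Fin d → ℝ) (i j : Fin d) :
    (angVel x : Mat d) i.castSucc j.castSucc = 0 := by
  simp [coe_angVel, coe_basicWedge]

@[simp] theorem angVel_last_last {d : ℕ} (x : Fin d → ℝ) :
    (angVel x : Mat d) (Fin.last d) (Fin.last d) = 0 := by
  simp [coe_angVel, coe_basicWedge]

theorem angVel_mem {d : ℕ} (x : Fin d → ℝ) : angVel x ∈ constraintSpace d :=
  Submodule.sum_mem _ fun i _ => Submodule.smul_mem _ _ (Submodule.subset_span ⟨i, rfl⟩)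

theorem exists_eq_angVel {d : ℕ} {X : SkewAlg d} (hX : X ∈ constraintSpace d) :
    ∃ x, X = angVel x := by
  obtain ⟨x, hx⟩ := (Submodule.mem_span_range_iff_exists_fun ℝ).mp hX
  exact ⟨x, hx.symm⟩

theorem SkewAlg.apply_swap {d : ℕ} (X : SkewAlg d) (a b : Fin (d + 1)) :
    (X : Mat d) a b = -(X : Mat d) b a := by
  have h := (LieAlgebra.Orthogonal.mem_so _ _ _).mp X.2
  have := congrFun (congrFun h b) a
  simpa using this

theorem killing_basicWedge {d : ℕ} (X : SkewAlg d) (i : Fin d) :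
    killing X (basicWedge i) = (X : Mat d) i.castSucc (Fin.last d) := by
  have h := SkewAlg.apply_swap X (Fin.last d) i.castSucc
  simp only [killing, basicWedge, wedge, Matrix.mul_sub, Matrix.trace_sub,
    Matrix.mul_vecMulVec, Matrix.trace_vecMulVec]
  simp [h]
  ring

theorem killing_angVel {d : ℕ} (X : SkewAlg d) (y : Fin d → ℝ) :
    killing X (angVel y) = ∑ i, y i * (X : Mat d) i.castSucc (Fin.last d) := by
  simp_rw [← killing_basicWedge]
  simp [killing, angVel, Finset.mul_sum, Matrix.trace_sum]
  refine Finset.sum_congr rfl fun i _ => by ring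

theorem killing_comm {d : ℕ} (X Y : SkewAlg d) : killing X Y = killing Y X := by
  rw [killing, killing, Matrix.trace_mul_comm]

namespace InertiaOperator

variable {d : ℕ} (I : InertiaOperator d)

theorem toLin_angVel (x : Fin d → ℝ) (i : Fin d) :
    (I.toLin (angVel x) : Mat d) i.castSucc (Fin.last d) = (I.J *ᵥ x) i := by
  rw [angVel, map_sum]
  simp [Matrix.mulVec, dotProduct, J, killing_basicWedge, mul_comm, Matrix.sum_apply]

theorem posDef_J : I.J.PosDef := by
  refine Matrix.PosDef.of_dotProduct_mulVec_pos ?_ ?_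
  · ext i j
    simp only [Matrix.conjTranspose_apply, star_trivial, J, Matrix.of_apply]
    rw [I.symm, killing_comm]
  · intro x hx
    have h0 : angVel x ≠ 0 := by
      intro h
      apply hx
      ext i
      rw [← angVel_castSucc_last x i, h]
      simp
    have := I.pos _ h0
    rw [killing_angVel] at this
    simpa [dotProduct, toLin_angVel] using this

theorem isUnit_det_J : IsUnit I.J.det := isUnit_iff_ne_zero.mpr I.posDef_J.det_pos.ne'

theorem posDef_A : I.A.PosDef := I.posDef_J.inv

theorem A_mulVec_J_mulVec (x : Fin d → ℝ) : I.A *ᵥ (I.J *ᵥ x) = x := by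
  rw [A, Matrix.mulVec_mulVec, Matrix.nonsing_inv_mul _ I.isUnit_det_J, Matrix.one_mulVec]

theorem J_mulVec_A_mulVec (x : Fin d → ℝ) : I.J *ᵥ (I.A *ᵥ x) = x := by
  rw [A, Matrix.mulVec_mulVec, Matrix.mul_nonsing_inv _ I.isUnit_det_J, Matrix.one_mulVec]

/-- The matrix `A = J⁻¹` as an operator on the Euclidean space of momenta; its inverse is `J`. -/
def opA : Flat d ≃ₗ[ℝ] Flat d where
  toFun p := WithLp.toLp 2 (I.A *ᵥ p)
  invFun w := WithLp.toLp 2 (I.J *ᵥ w)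
  map_add' x y := by ext i; simp [Matrix.mulVec_add]
  map_smul' r x := by ext i; simp [Matrix.mulVec_smul]
  left_inv x := by ext i; exact congrFun (I.J_mulVec_A_mulVec x) i
  right_inv x := by ext i; exact congrFun (I.A_mulVec_J_mulVec x) i

@[simp] theorem opA_apply (p : Flat d) (i : Fin d) : I.opA p i = (I.A *ᵥ p) i := rfl

theorem opA_symm_apply (p : Flat d) : I.opA.symm p = WithLp.toLp 2 (I.J *ᵥ p) := rfl

theorem inner_opA_pos {x : Flat d} (hx : x ≠ 0) : 0 < inner ℝ (I.opA x) x := by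
  have h := I.posDef_A.dotProduct_mulVec_pos (x := (x : Fin d → ℝ)) (by
    intro h; apply hx; ext i; exact congrFun h i)
  simpa [PiLp.inner_apply, dotProduct, mul_comm] using h

theorem opA_continuous : Continuous I.opA := I.opA.toLinearMap.continuous_of_finiteDimensional

end InertiaOperator

/-! ### The potential and the Euler–Poincaré–Suslov equation -/

theorem hasFDerivAt_kharlamova {d : ℕ} (C : Fin d → ℝ) (q : Full d) :
    HasFDerivAt (kharlamovaPotential C)
      (∑ i, C i • (EuclideanSpace.proj i.castSucc : Full d →L[ℝ] ℝ)) q := by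
  have := (∑ i, C i • (EuclideanSpace.proj i.castSucc : Full d →L[ℝ] ℝ)).hasFDerivAt (x := q)
  convert this using 1
  ext q
  simp [kharlamovaPotential]

@[simp] theorem grad_kharlamova_castSucc {d : ℕ} (C : Fin d → ℝ) (q : Full d) (i : Fin d) :
    grad (kharlamovaPotential C) q i.castSucc = C i := by
  simp [grad, (hasFDerivAt_kharlamova C q).fderiv]

@[simp] theorem grad_kharlamova_last {d : ℕ} (C : Fin d → ℝ) (q : Full d) :
    grad (kharlamovaPotential C) q (Fin.last d) = 0 := by
  simp [grad, (hasFDerivAt_kharlamova C q).fderiv, Fin.castSucc_ne_last]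

/-- Since `[𝔇, 𝔇] ⊂ so(n-1)` and `𝓘 𝔇 = 𝔇`, the gyroscopic term `[𝓘 ω, ω]` does no work on `𝔇`. -/
theorem killing_lie_eq_zero {d : ℕ} (I : InertiaOperator d) (x : Fin d → ℝ) {η : SkewAlg d}
    (hη : η ∈ constraintSpace d) : killing ⁅I.toLin (angVel x), angVel x⁆ η = 0 := by
  obtain ⟨y, rfl⟩ := exists_eq_angVel hη
  obtain ⟨w, hw⟩ := exists_eq_angVel (I.map_constraint _ (angVel_mem x))
  rw [hw, killing_angVel]
  refine Finset.sum_eq_zero fun i _ => ?_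
  simp [Ring.lie_def, Matrix.mul_apply, Fin.sum_univ_castSucc]

theorem killing_sub_left {d : ℕ} (X Y Z : SkewAlg d) :
    killing (X - Y) Z = killing X Z - killing Y Z := by
  simp [killing, sub_mul]
  ring

theorem angularVelocity_eq {d : ℕ} (z : DPhase d) : z.angularVelocity = angVel z.2 := rfl

/-- Curves with `ġ = g ω` and `J ω̇ = qₙ C` solve the Suslov problem. -/
theorem isSuslovSolution_of {d : ℕ} (I : InertiaOperator d) (C : Fin d → ℝ) (γ : ℝ → DPhase d)
    (ω' : ℝ → Fin d → ℝ)
    (hg : ∀ t i j, HasDerivAt (fun s => ((γ s).1 : Mat d) i j)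
      ((((γ t).1 : Mat d) * (angVel (γ t).2 : Mat d)) i j) t)
    (hω : ∀ t i, HasDerivAt (fun s => (γ s).2 i) (ω' t i) t)
    (hJ : ∀ t i, (I.J *ᵥ ω' t) i = C i * (γ t).e (Fin.last d)) :
    IsSuslovSolution I (kharlamovaPotential C) γ := by
  refine ⟨fun t => I.toLin (angVel (ω' t)), fun t => ⟨hg t, fun i j => ?_, fun η hη => ?_⟩⟩
  · have h1 : ∀ x : Fin d → ℝ, (I.toLin (angVel x) : Mat d) i j =
        ∑ k, x k * (I.toLin (basicWedge k) : Mat d) i j := by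
      intro x
      simp [angVel, Matrix.sum_apply]
    simp only [angularVelocity_eq, h1]
    exact HasDerivAt.fun_sum fun k _ => (hω t k).mul_const _
  · rw [killing_sub_left, killing_sub_left, angularVelocity_eq, killing_lie_eq_zero I _ hη]
    obtain ⟨y, rfl⟩ := exists_eq_angVel hη
    simp only [killing_angVel, sub_zero, ← Finset.sum_sub_distrib]
    refine Finset.sum_eq_zero fun i _ => ?_
    rw [I.toLin_angVel, hJ]
    simp [wedge, Matrix.vecMulVec_apply]

/-! ### Oscillations of one-dimensional systems -/

/-- A positive `2π`-periodic velocity field on the line has a global solution, which is the inverse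
of the time function `θ ↦ ∫ dθ / V(θ)` and advances by `2π` in a fixed time. -/
theorem exists_clock (V : ℝ → ℝ) (hV : Continuous V) (hpos : ∀ x, 0 < V x)
    (hper : Function.Periodic V (2 * Real.pi)) (θ₀ : ℝ) :
    ∃ (θ : ℝ → ℝ) (T : ℝ), 0 < T ∧ θ 0 = θ₀ ∧ (∀ t, HasDerivAt θ (V (θ t)) t) ∧
      (∀ t, θ (t + T) = θ t + 2 * Real.pi) ∧ StrictMono θ := by
  have hVi : Continuous fun x => (V x)⁻¹ := hV.inv₀ fun x => (hpos x).ne'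
  have hperi : Function.Periodic (fun x => (V x)⁻¹) (2 * Real.pi) := fun x => by simp [hper x]
  set S : ℝ → ℝ := fun x => ∫ y in θ₀..x, (V y)⁻¹ with hS
  have hSd : ∀ x, HasDerivAt S (V x)⁻¹ x := fun x => hVi.integral_hasStrictDerivAt θ₀ x |>.hasDerivAt
  have hSc : Continuous S := continuous_iff_continuousAt.mpr fun x => (hSd x).continuousAt
  have hSm : StrictMono S := strictMono_of_hasDerivAt_pos hSd fun x => inv_pos.mpr (hpos x)
  set T : ℝ := S (θ₀ + 2 * Real.pi) with hT
  have hS0 : S θ₀ = 0 := by simp [hS]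
  have hTpos : 0 < T := by
    rw [← hS0]
    exact hSm (by linarith [Real.pi_pos])
  have hadd : ∀ x, S (x + 2 * Real.pi) = S x + T := by
    intro x
    have h1 := hperi.intervalIntegral_add_eq x θ₀
    have h2 := intervalIntegral.integral_add_adjacent_intervals (μ := volume)
      (hVi.intervalIntegrable θ₀ x) (hVi.intervalIntegrable x (x + 2 * Real.pi))
    simp only [hS, hT]
    linarith
  have haddn : ∀ n : ℕ, S (θ₀ + n * (2 * Real.pi)) = n * T := by
    intro n
    induction n with
    | zero => simp [hS0]
    | succ n ih =>
      push_cast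
      rw [show θ₀ + (n + 1 : ℝ) * (2 * Real.pi) = θ₀ + n * (2 * Real.pi) + 2 * Real.pi by ring,
        hadd, ih]
      ring
  have hsubn : ∀ n : ℕ, S (θ₀ - n * (2 * Real.pi)) = -(n * T) := by
    intro n
    induction n with
    | zero => simp [hS0]
    | succ n ih =>
      have := hadd (θ₀ - (n + 1 : ℝ) * (2 * Real.pi))
      rw [show θ₀ - (n + 1 : ℝ) * (2 * Real.pi) + 2 * Real.pi = θ₀ - n * (2 * Real.pi) by ring,
        ih] at this
      push_cast
      linarith
  have hsurj : Function.Surjective S := by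
    intro y
    obtain ⟨n, hn⟩ := exists_nat_ge (|y| / T)
    have hn' : |y| ≤ n * T := (div_le_iff₀ hTpos).mp hn
    have hy := abs_le.mp hn'
    have := intermediate_value_univ (θ₀ - n * (2 * Real.pi)) (θ₀ + n * (2 * Real.pi)) hSc
    exact this ⟨by rw [hsubn]; exact hy.1, by rw [haddn]; exact hy.2⟩
  set e := hSm.orderIsoOfSurjective S hsurj with he
  have heS : ∀ x, e x = S x := fun x => rfl
  have hSe : ∀ t, S (e.symm t) = t := fun t => e.apply_symm_apply t
  refine ⟨e.symm, T, hTpos, ?_, fun t => ?_, fun t => ?_, e.symm.strictMono⟩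
  · rw [OrderIso.symm_apply_eq, heS, hS0]
  · have := HasDerivAt.of_local_left_inverse (f := S) (g := e.symm) (a := t)
      e.symm.continuous.continuousAt (hSd (e.symm t)) (inv_pos.mpr (hpos _)).ne'
      (Filter.Eventually.of_forall hSe)
    simpa using this
  · rw [OrderIso.symm_apply_eq, heS, hadd, hSe]

theorem clock_add_int_mul {θ : ℝ → ℝ} {T : ℝ} (h : ∀ t, θ (t + T) = θ t + 2 * Real.pi) (k : ℤ)
    (t : ℝ) : θ (t + k * T) = θ t + k * (2 * Real.pi) := by
  induction k using Int.induction_on generalizing t with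
  | zero => simp
  | succ n ih =>
    rw [show t + ((n + 1 : ℤ) : ℝ) * T = (t + (n : ℤ) * T) + T by push_cast; ring, h, ih]
    push_cast
    ring
  | pred n ih =>
    have := h (t + ((-n - 1 : ℤ) : ℝ) * T)
    rw [show t + ((-n - 1 : ℤ) : ℝ) * T + T = t + (-n : ℤ) * T by push_cast; ring, ih] at this
    push_cast at this ⊢
    linarith

theorem exists_cos_sin {x y : ℝ} (h : x ^ 2 + y ^ 2 = 1) :
    ∃ θ, Real.cos θ = x ∧ Real.sin θ = y := by
  have hn : ‖(⟨x, y⟩ : ℂ)‖ = 1 := by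
    rw [Complex.norm_def, Complex.normSq_mk, Real.sqrt_eq_one]
    linarith
  have h0 : (⟨x, y⟩ : ℂ) ≠ 0 := by
    rw [← norm_ne_zero_iff, hn]
    exact one_ne_zero
  exact ⟨_, by rw [Complex.cos_arg h0, hn, div_one], by rw [Complex.sin_arg, hn, div_one]⟩

/-- The substitution `τ = m - h cos θ`, `θ̇ = √K(τ)`, solves `τ̈ = F'(τ) / 2`, `τ̇² = F(τ)` for
`F(τ) = (h² - (τ - m)²) K(τ)`. -/
theorem hasDerivAt_oscillation {K K' : ℝ → ℝ} (hK : ∀ x, HasDerivAt K (K' x) x) {m h : ℝ}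
    (hpos : ∀ x ∈ Icc (m - h) (m + h), 0 < K x) (hh : 0 < h) {θ : ℝ → ℝ}
    (hθ : ∀ t, HasDerivAt θ √(K (m - h * Real.cos (θ t))) t) (t : ℝ) :
    HasDerivAt (fun t => m - h * Real.cos (θ t))
      (h * Real.sin (θ t) * √(K (m - h * Real.cos (θ t)))) t ∧
    HasDerivAt (fun t => h * Real.sin (θ t) * √(K (m - h * Real.cos (θ t))))
      ((2 * h * Real.cos (θ t) * K (m - h * Real.cos (θ t)) +
        (h * Real.sin (θ t)) ^ 2 * K' (m - h * Real.cos (θ t))) / 2) t := by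
  have hc := (hθ t).cos
  have hs := (hθ t).sin
  have hτ : HasDerivAt (fun t => m - h * Real.cos (θ t))
      (h * Real.sin (θ t) * √(K (m - h * Real.cos (θ t)))) t := by
    exact ((hc.const_mul h).const_sub m).congr_deriv (by ring)
  refine ⟨hτ, ?_⟩
  have hmem : m - h * Real.cos (θ t) ∈ Icc (m - h) (m + h) := by
    constructor <;> nlinarith [Real.neg_one_le_cos (θ t), Real.cos_le_one (θ t)]
  have hKp := hpos _ hmem
  have hsq := ((hK _).comp t hτ).sqrt (x := t) hKp.ne'
  refine ((hs.const_mul h).mul hsq).congr_deriv ?_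
  have h1 : √(K (m - h * Real.cos (θ t))) ^ 2 = K (m - h * Real.cos (θ t)) := Real.sq_sqrt hKp.le
  have h2 : √(K (m - h * Real.cos (θ t))) ≠ 0 := (Real.sqrt_pos.mpr hKp).ne'
  simp only [Function.comp_apply]
  set r := √(K (m - h * Real.cos (θ t)))
  rw [← h1]
  field_simp

/-- To the right of a point where `f` is positive lies a first zero, if `f` becomes negative. -/
theorem exists_first_zero_right {f : ℝ → ℝ} (hf : Continuous f) {x y : ℝ} (hxy : x < y)
    (hx : 0 < f x) (hy : f y < 0) : ∃ b, x < b ∧ f b = 0 ∧ ∀ z ∈ Ico x b, 0 < f z := by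
  set S := {z | z ∈ Icc x y ∧ f z ≤ 0} with hS
  have hSc : IsClosed S := isClosed_Icc.inter (isClosed_le hf continuous_const)
  have hne : S.Nonempty := ⟨y, ⟨hxy.le, le_rfl⟩, hy.le⟩
  have hbd : BddBelow S := ⟨x, fun z hz => hz.1.1⟩
  have hb := hSc.csInf_mem hne hbd
  set b := sInf S
  have hpos : ∀ z ∈ Ico x b, 0 < f z := by
    intro z hz
    by_contra! hcon
    exact absurd (csInf_le hbd ⟨⟨hz.1, hz.2.le.trans hb.1.2⟩, hcon⟩) (not_le.mpr hz.2)
  have hxb : x < b := lt_of_le_of_ne hb.1.1 fun h => by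
    have := hb.2
    rw [← h] at this
    linarith
  refine ⟨b, hxb, le_antisymm hb.2 ?_, hpos⟩
  have : b ∈ closure (Ico x b) := by
    rw [closure_Ico hxb.ne]
    exact ⟨hxb.le, le_rfl⟩
  exact closure_minimal (fun z hz => (hpos z hz).le) (isClosed_le continuous_const hf) this

theorem exists_last_zero_left {f : ℝ → ℝ} (hf : Continuous f) {x y : ℝ} (hxy : y < x)
    (hx : 0 < f x) (hy : f y < 0) : ∃ a, a < x ∧ f a = 0 ∧ ∀ z ∈ Ioc a x, 0 < f z := by
  obtain ⟨b, hb, hfb, h⟩ := exists_first_zero_right (f := fun z => f (-z)) (by fun_prop)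
    (neg_lt_neg hxy) (by simpa using hx) (by simpa using hy)
  refine ⟨-b, by linarith, hfb, fun z hz => ?_⟩
  simpa using h (-z) ⟨by linarith [hz.2], by linarith [hz.1]⟩

theorem eventually_pos_right {f : ℝ → ℝ} {f' x : ℝ} (hf : HasDerivAt f f' x) (h0 : f x = 0)
    (hf' : 0 < f') : ∃ y, x < y ∧ ∀ z ∈ Ioc x y, 0 < f z := by
  have h1 : ∀ᶠ z in nhdsWithin x (Ioi x), 0 < slope f x z := by
    have := (hasDerivAt_iff_tendsto_slope.mp hf).mono_left
      (nhdsWithin_mono x (fun z (hz : x < z) => hz.ne'))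
    exact this.eventually (lt_mem_nhds hf')
  obtain ⟨y, hy, h⟩ := (mem_nhdsGT_iff_exists_Ioc_subset).mp h1
  refine ⟨y, hy, fun z hz => ?_⟩
  have h2 : 0 < slope f x z := h hz
  rw [slope_def_field, h0, sub_zero] at h2
  exact (div_pos_iff_of_pos_right (sub_pos.mpr hz.1)).mp h2

/-- A region `f > 0` bounded by simple zeros, at whose closure a point with `f ≥ 0` lies. -/
theorem exists_well {f f' : ℝ → ℝ} (hf : ∀ x, HasDerivAt f (f' x) x)
    (hsimple : ∀ x, f x = 0 → f' x ≠ 0) {x₀ : ℝ} (h0 : 0 ≤ f x₀) (hl : ∃ x < x₀, f x < 0)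
    (hr : ∃ x > x₀, f x < 0) :
    ∃ a b, a < b ∧ a ≤ x₀ ∧ x₀ ≤ b ∧ f a = 0 ∧ f b = 0 ∧ ∀ x ∈ Ioo a b, 0 < f x := by
  have hc : Continuous f := continuous_iff_continuousAt.mpr fun x => (hf x).continuousAt
  obtain ⟨xl, hxl, hfl⟩ := hl
  obtain ⟨xr, hxr, hfr⟩ := hr
  rcases h0.lt_or_eq with h0 | h0
  · obtain ⟨b, hb, hfb, hB⟩ := exists_first_zero_right hc hxr h0 hfr
    obtain ⟨a, ha, hfa, hA⟩ := exists_last_zero_left hc hxl h0 hfl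
    refine ⟨a, b, ha.trans hb, ha.le, hb.le, hfa, hfb, fun x hx => ?_⟩
    rcases le_total x x₀ with h | h
    · exact hA x ⟨hx.1, h⟩
    · exact hB x ⟨h, hx.2⟩
  · rcases (hsimple x₀ h0.symm).lt_or_gt with hneg | hpos
    · obtain ⟨y, hy, hY⟩ := eventually_pos_right (f := fun z => f (-z)) (x := -x₀)
        (f' := -f' x₀) (by
          have := (hf (- -x₀)).scomp (-x₀) (hasDerivAt_neg (-x₀))
          simpa [Function.comp_def] using this) (by simp [← h0]) (by linarith)
      have hxl' : xl < -y := by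
        by_contra! hcon
        have := hY (-xl) ⟨by linarith, by linarith⟩
        simp only [neg_neg] at this
        linarith
      obtain ⟨a, ha, hfa, hA⟩ := exists_last_zero_left hc hxl'
        (by simpa using hY y ⟨hy, le_rfl⟩) hfl
      refine ⟨a, x₀, by linarith, by linarith, le_rfl, hfa, h0.symm, fun x hx => ?_⟩
      rcases le_total x (-y) with h | h
      · exact hA x ⟨hx.1, h⟩
      · simpa using hY (-x) ⟨by linarith [hx.2], by linarith⟩
    · obtain ⟨y, hy, hY⟩ := eventually_pos_right (hf x₀) h0.symm hpos
      have hxr' : y < xr := by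
        by_contra! hcon
        have := hY xr ⟨hxr, hcon⟩
        linarith
      obtain ⟨b, hb, hfb, hB⟩ := exists_first_zero_right hc hxr' (hY y ⟨hy, le_rfl⟩) hfr
      refine ⟨x₀, b, hy.trans hb, le_rfl, (hy.trans hb).le, h0.symm, hfb, fun x hx => ?_⟩
      rcases le_total x y with h | h
      · exact hY x ⟨hx.1, h⟩
      · exact hB x ⟨h, hx.2⟩

open Polynomial in
/-- Between two neighbouring simple zeros, `F` is `(x - a) (b - x)` times a positive factor. -/
theorem exists_factor {F : ℝ[X]} (hsimple : ∀ x, F.eval x = 0 → F.derivative.eval x ≠ 0) {a b : ℝ}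
    (hab : a < b) (ha : F.eval a = 0) (hb : F.eval b = 0) (hpos : ∀ x ∈ Ioo a b, 0 < F.eval x) :
    ∃ K : ℝ[X], F = (X - C a) * (C b - X) * K ∧ ∀ x ∈ Icc a b, 0 < K.eval x := by
  obtain ⟨G, hG⟩ := dvd_iff_isRoot.mpr ha
  have hGb : G.eval b = 0 := by
    rw [hG] at hb
    simpa [sub_ne_zero.mpr hab.ne'] using hb
  obtain ⟨K, hK⟩ := dvd_iff_isRoot.mpr hGb
  have hF : F = (X - C a) * (C b - X) * (-K) := by
    rw [hG, hK]
    ring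
  refine ⟨-K, hF, ?_⟩
  have h1 : ∀ x ∈ Ioo a b, 0 < (-K).eval x := by
    intro x hx
    have := hpos x hx
    rw [hF] at this
    simp only [eval_mul, eval_sub, eval_X, eval_C] at this
    exact (pos_iff_pos_of_mul_pos this).mp (mul_pos (sub_pos.mpr hx.1) (sub_pos.mpr hx.2))
  intro x hx
  have h2 : 0 ≤ (-K).eval x := by
    rw [← closure_Ioo hab.ne] at hx
    exact closure_minimal (fun z hz => (h1 z hz).le)
      (isClosed_le continuous_const (-K).continuous) hx
  refine lt_of_le_of_ne h2 fun h3 => ?_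
  by_cases hx' : x ∈ Ioo a b
  · exact (h1 x hx').ne h3
  · have hx2 : (x - a) * (b - x) = 0 := by
      have : x = a ∨ x = b := by
        by_contra! hcon
        exact hx' ⟨lt_of_le_of_ne hx.1 hcon.1.symm, lt_of_le_of_ne hx.2 hcon.2⟩
      rcases this with rfl | rfl <;> simp
    refine hsimple x ?_ ?_
    · rw [hF, eval_mul, ← h3, mul_zero]
    · rw [hF]
      simp only [derivative_mul, eval_add, eval_mul, ← h3]
      simp only [eval_sub, eval_X, eval_C, mul_zero, zero_add, hx2, zero_mul]

open Polynomial in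
/-- A particle with `τ̈ = F'(τ) / 2` and `τ̇² = F(τ)` is periodic if `F` has no multiple zeros and is
negative on both sides of the initial position. -/
theorem exists_periodic_motion {F : ℝ[X]}
    (hsimple : ∀ x, F.eval x = 0 → F.derivative.eval x ≠ 0) {x₀ u₀ : ℝ}
    (hu : u₀ ^ 2 = F.eval x₀) (hl : ∃ x < x₀, F.eval x < 0) (hr : ∃ x > x₀, F.eval x < 0) :
    ∃ (τ u : ℝ → ℝ) (T : ℝ), 0 < T ∧ τ 0 = x₀ ∧ u 0 = u₀ ∧ (∀ t, HasDerivAt τ (u t) t) ∧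
      (∀ t, HasDerivAt u (F.derivative.eval (τ t) / 2) t) ∧ (∀ t, u t ^ 2 = F.eval (τ t)) ∧
      Function.Periodic τ T ∧ Function.Periodic u T ∧
      ∀ s t, τ s = τ t → u s = u t → ∃ k : ℤ, s = t + k * T := by
  obtain ⟨a, b, hab, hax, hxb, ha, hb, hpos⟩ :=
    exists_well (fun x => F.hasDerivAt x) hsimple (hu ▸ sq_nonneg u₀) hl hr
  obtain ⟨K, hF, hK⟩ := exists_factor hsimple hab ha hb hpos
  set m := (a + b) / 2 with hm
  set h := (b - a) / 2 with hh
  have hh0 : 0 < h := by rw [hh]; linarith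
  have hIcc : Icc (m - h) (m + h) = Icc a b := by
    rw [hm, hh]; congr 1 <;> ring
  have hFe : ∀ x, F.eval x = (h ^ 2 - (x - m) ^ 2) * K.eval x := by
    intro x
    rw [hF, hm, hh]
    simp only [eval_mul, eval_sub, eval_X, eval_C]
    ring
  have hF' : ∀ x, F.derivative.eval x =
      2 * (m - x) * K.eval x + (h ^ 2 - (x - m) ^ 2) * K.derivative.eval x := by
    intro x
    rw [hF, hm, hh]
    simp [derivative_mul]
    ring
  have hmem : ∀ φ, m - h * Real.cos φ ∈ Icc a b := by
    intro φ
    rw [← hIcc]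
    constructor <;> nlinarith [Real.neg_one_le_cos φ, Real.cos_le_one φ]
  have hKx := hK x₀ ⟨hax, hxb⟩
  clear_value m h
  set r := √(K.eval x₀) with hr
  have hr0 : 0 < r := Real.sqrt_pos.mpr hKx
  have hr2 : r ^ 2 = K.eval x₀ := Real.sq_sqrt hKx.le
  obtain ⟨θ₀, hcos, hsin⟩ := exists_cos_sin (x := (m - x₀) / h) (y := u₀ / (h * r)) (by
    rw [div_pow, div_pow, mul_pow, hu, hFe, hr2]
    field_simp
    ring)
  obtain ⟨θ, T, hT, hθ0, hθ, hθT, hmono⟩ := exists_clock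
    (fun φ => √(K.eval (m - h * Real.cos φ))) (by
      have := K.continuous
      fun_prop) (fun φ => Real.sqrt_pos.mpr (hK _ (hmem φ)))
    (fun φ => by simp [Real.cos_add_two_pi]) θ₀
  have hder := hasDerivAt_oscillation (fun x => K.hasDerivAt x) (m := m) (h := h)
    (by rw [hIcc]; exact hK) hh0 hθ
  refine ⟨fun t => m - h * Real.cos (θ t),
    fun t => h * Real.sin (θ t) * √(K.eval (m - h * Real.cos (θ t))), T, hT, ?_, ?_,
    fun t => (hder t).1, fun t => ?_, fun t => ?_, fun t => ?_, fun t => ?_, ?_⟩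
  · simp only [hθ0, hcos]
    field_simp
    ring
  · have : m - h * Real.cos θ₀ = x₀ := by
      rw [hcos]
      field_simp
      ring
    simp only [hθ0, this, hsin]
    rw [← hr]
    field_simp
  · convert (hder t).2 using 2
    rw [hF']
    have := Real.sin_sq (θ t)
    linear_combination (-h ^ 2 * K.derivative.eval (m - h * Real.cos (θ t))) * this
  · rw [mul_pow, Real.sq_sqrt (hK _ (hmem _)).le, hFe]
    have := Real.sin_sq (θ t)
    linear_combination (h ^ 2 * K.eval (m - h * Real.cos (θ t))) * this
  · simp only [hθT, Real.cos_add_two_pi]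
  · simp only [hθT, Real.cos_add_two_pi, Real.sin_add_two_pi]
  · intro s t h1 h2
    have hc : Real.cos (θ s) = Real.cos (θ t) := by
      have := h1
      simp only [sub_right_inj] at this
      exact mul_left_cancel₀ hh0.ne' this
    have hs : Real.sin (θ s) = Real.sin (θ t) := by
      simp only [hc] at h2
      have h3 := mul_right_cancel₀ (Real.sqrt_pos.mpr (hK _ (hmem (θ t)))).ne' h2
      exact mul_left_cancel₀ hh0.ne' h3
    obtain ⟨k, hk⟩ := Real.Angle.angle_eq_iff_two_pi_dvd_sub.mp
      (Real.Angle.cos_sin_inj hc hs)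
    refine ⟨k, hmono.injective ?_⟩
    rw [clock_add_int_mul hθT]
    linarith

/-! ### The parabolas of the reduced problem and their generic position -/

/-- The parabola `τ ↦ q + τ P - τ² c` along which the vector `q` moves, where `dτ = qₙ dt`. -/
def parabola {d : ℕ} (q P c : Flat d) (τ : ℝ) : Flat d := q + τ • P - τ ^ 2 • c

/-- The parabola is not a point and crosses the unit sphere transversally. -/
def IsTransverse {d : ℕ} (q P c : Flat d) : Prop :=
  P ≠ 0 ∧ ∀ τ : ℝ, ‖parabola q P c τ‖ = 1 → inner ℝ (parabola q P c τ) (P - (2 * τ) • c) ≠ 0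

theorem hasDerivAt_parabola {d : ℕ} (q P c : Flat d) {τ : ℝ → ℝ} {τ' t : ℝ}
    (h : HasDerivAt τ τ' t) :
    HasDerivAt (fun s => parabola q P c (τ s)) (τ' • (P - (2 * τ t) • c)) t := by
  refine (((h.smul_const P).const_add q).sub ((h.pow 2).smul_const c)).congr_deriv ?_
  simp only [smul_sub, smul_smul]
  congr 2
  norm_num
  ring

open Polynomial in
/-- The polynomial `1 - |q + τ P - τ² c|²` of `τ`. -/
def defect {d : ℕ} (q P c : Flat d) : ℝ[X] :=
  Polynomial.C (1 - inner ℝ q q) - Polynomial.C (2 * inner ℝ q P) * X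
    - Polynomial.C (inner ℝ P P - 2 * inner ℝ q c) * X ^ 2
    + Polynomial.C (2 * inner ℝ P c) * X ^ 3 - Polynomial.C (inner ℝ c c) * X ^ 4

theorem eval_defect {d : ℕ} (q P c : Flat d) (τ : ℝ) :
    (defect q P c).eval τ = 1 - ‖parabola q P c τ‖ ^ 2 := by
  rw [← real_inner_self_eq_norm_sq]
  simp only [defect, parabola, inner_add_left, inner_sub_left, inner_add_right, inner_sub_right,
    real_inner_smul_left, real_inner_smul_right, real_inner_comm P q, real_inner_comm c q,
    real_inner_comm c P]
  simp
  ring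

theorem eval_derivative_defect {d : ℕ} (q P c : Flat d) (τ : ℝ) :
    (defect q P c).derivative.eval τ =
      -2 * inner ℝ (parabola q P c τ) (P - (2 * τ) • c) := by
  simp only [defect, parabola, inner_add_left, inner_sub_left, inner_sub_right,
    real_inner_smul_left, real_inner_smul_right, real_inner_comm P q, real_inner_comm c q,
    real_inner_comm c P]
  generalize inner ℝ q q = a, inner ℝ P P = b, inner ℝ c c = e
  simp
  ring

theorem exists_one_lt_norm_parabola {d : ℕ} (q c : Flat d) {P : Flat d} (hP : P ≠ 0) :
    ∃ N : ℝ, 0 < N ∧ ∀ τ, |τ| = N → 1 < ‖parabola q P c τ‖ := by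
  by_cases hc : c = 0
  · have hP' := norm_pos_iff.mpr hP
    refine ⟨(2 + ‖q‖) / ‖P‖, by positivity, fun τ hτ => ?_⟩
    have h1 : ‖τ • P‖ = 2 + ‖q‖ := by
      rw [norm_smul, Real.norm_eq_abs, hτ]
      field_simp
    have h2 := norm_sub_norm_le (τ • P) (-q)
    rw [norm_neg, h1, sub_neg_eq_add, add_comm (τ • P)] at h2
    simp only [parabola, hc, smul_zero, sub_zero]
    linarith
  · have hc' := norm_pos_iff.mpr hc
    refine ⟨(‖P‖ + ‖q‖ + 2) / ‖c‖ + 1, by positivity, fun τ hτ => ?_⟩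
    set N := (‖P‖ + ‖q‖ + 2) / ‖c‖ + 1 with hN
    have hN1 : 1 ≤ N := by
      have : 0 ≤ (‖P‖ + ‖q‖ + 2) / ‖c‖ := by positivity
      linarith
    have hNc : ‖P‖ + ‖q‖ + 2 ≤ N * ‖c‖ := by
      rw [hN, add_mul, div_mul_cancel₀ _ hc'.ne']
      linarith
    have h1 : ‖τ ^ 2 • c‖ = N * (N * ‖c‖) := by
      rw [norm_smul, norm_pow, Real.norm_eq_abs, hτ]
      ring
    have h2 : ‖q + τ • P‖ ≤ ‖q‖ + N * ‖P‖ := by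
      refine (norm_add_le _ _).trans ?_
      rw [norm_smul, Real.norm_eq_abs, hτ]
    have h3 := norm_sub_norm_le (τ ^ 2 • c) (q + τ • P)
    rw [norm_sub_rev] at h3
    have h4 : N * (‖P‖ + ‖q‖ + 2) ≤ N * (N * ‖c‖) := by gcongr
    have h5 : ‖q‖ ≤ N * ‖q‖ := le_mul_of_one_le_left (norm_nonneg q) hN1
    simp only [parabola]
    nlinarith

/-- A periodic solution `τ`, `u = τ̇` of `τ̈ = F'(τ) / 2`, `τ̇² = F(τ)`, where
`F(τ) = 1 - |q + τ P - τ² c|²`; then `(q + τ P - τ² c, u)` moves on the unit sphere of `ℝⁿ`. -/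
structure PeriodicMotion {d : ℕ} (q P c : Flat d) where
  τ : ℝ → ℝ
  u : ℝ → ℝ
  T : ℝ
  T_pos : 0 < T
  τ_zero : τ 0 = 0
  hasDerivAt_τ : ∀ t, HasDerivAt τ (u t) t
  hasDerivAt_u : ∀ t, HasDerivAt u
    (-inner ℝ (parabola q P c (τ t)) (P - (2 * τ t) • c)) t
  energy : ∀ t, ‖parabola q P c (τ t)‖ ^ 2 + u t ^ 2 = 1
  periodic_τ : Function.Periodic τ T
  periodic_u : Function.Periodic u T
  injective_mod : ∀ s t, τ s = τ t → u s = u t → ∃ k : ℤ, s = t + k * T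

theorem IsTransverse.exists_motion {d : ℕ} {q P c : Flat d} (h : IsTransverse q P c) {u₀ : ℝ}
    (hu : ‖q‖ ^ 2 + u₀ ^ 2 = 1) : ∃ m : PeriodicMotion q P c, m.u 0 = u₀ := by
  obtain ⟨N, hN, hN'⟩ := exists_one_lt_norm_parabola q c h.1
  have hneg : ∀ τ, |τ| = N → (defect q P c).eval τ < 0 := by
    intro τ hτ
    rw [eval_defect]
    nlinarith [hN' τ hτ]
  obtain ⟨τ, u, T, hT, hτ0, hu0, hτ, hu', hen, hpτ, hpu, hinj⟩ :=
    exists_periodic_motion (F := defect q P c) (x₀ := 0) (u₀ := u₀) (by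
      intro x hx
      rw [eval_defect] at hx
      rw [eval_derivative_defect]
      refine mul_ne_zero (by norm_num) (h.2 x ?_)
      have : ‖parabola q P c x‖ ^ 2 = 1 := by linarith
      exact (pow_eq_one_iff_of_nonneg (norm_nonneg _) two_ne_zero).mp this) (by
      rw [eval_defect]
      simp only [parabola, zero_smul, add_zero, ne_eq, OfNat.ofNat_ne_zero, not_false_eq_true,
        zero_pow, sub_zero]
      linarith) ⟨-N, by linarith, hneg _ (by rw [abs_neg, abs_of_pos hN])⟩
      ⟨N, hN, hneg _ (abs_of_pos hN)⟩
  exact ⟨⟨τ, u, T, hT, hτ0, hτ, fun t => by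
    have := hu' t
    rw [eval_derivative_defect] at this
    exact this.congr_deriv (by ring), fun t => by
    have := hen t
    rw [eval_defect] at this
    linarith, hpτ, hpu, hinj⟩, hu0⟩

/-! ### Almost all initial momenta are transverse -/

/-- The map `y ↦ τ⁻¹ (y / |y| - q) + τ c` with `τ = ε √((|y| - (y, q)) / (y, c))`. It is constant on
rays, and takes as values the velocities `P` for which the parabola touches the unit sphere. -/
def tangencyMap {d : ℕ} (q c : Flat d) (ε : ℝ) (y : Flat d) : Flat d :=
  (ε * √((‖y‖ - inner ℝ y q) / inner ℝ y c))⁻¹ • (‖y‖⁻¹ • y - q) +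
    (ε * √((‖y‖ - inner ℝ y q) / inner ℝ y c)) • c

theorem tangencyMap_smul {d : ℕ} (q c : Flat d) (ε : ℝ) (y : Flat d) {r : ℝ} (hr : 0 < r) :
    tangencyMap q c ε (r • y) = tangencyMap q c ε y := by
  have h1 : (‖r • y‖ - inner ℝ (r • y) q) / inner ℝ (r • y) c =
      (‖y‖ - inner ℝ y q) / inner ℝ y c := by
    rw [norm_smul, Real.norm_eq_abs, abs_of_pos hr, real_inner_smul_left, real_inner_smul_left,
      ← mul_sub, mul_div_mul_left _ _ hr.ne']
  have h2 : ‖r • y‖⁻¹ • r • y = ‖y‖⁻¹ • y := by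
    rw [norm_smul, Real.norm_eq_abs, abs_of_pos hr, smul_smul]
    congr 1
    field_simp
  simp only [tangencyMap, h1, h2]

theorem differentiableAt_tangencyMap {d : ℕ} (q c : Flat d) {ε : ℝ} (hε : ε ≠ 0) {y : Flat d}
    (hc : 0 < inner ℝ y c) (hq : 0 < ‖y‖ - inner ℝ y q) :
    DifferentiableAt ℝ (tangencyMap q c ε) y := by
  have hy : y ≠ 0 := by
    rintro rfl
    simp at hc
  have hn : DifferentiableAt ℝ (fun y : Flat d => ‖y‖) y := differentiableAt_id.norm ℝ hy
  have h1 : DifferentiableAt ℝ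
      (fun y : Flat d => ε * √((‖y‖ - inner ℝ y q) / inner ℝ y c)) y := by
    have hi : ∀ w : Flat d, DifferentiableAt ℝ (fun y : Flat d => inner ℝ y w) y := fun w =>
      differentiableAt_id.inner ℝ (differentiableAt_const w)
    have h2 : DifferentiableAt ℝ
        (fun y : Flat d => (‖y‖ - inner ℝ y q) / (inner ℝ y c : ℝ)) y := by
      simp only [div_eq_mul_inv]
      exact (hn.sub (hi q)).mul ((hi c).inv hc.ne')
    exact (h2.sqrt (div_pos hq hc).ne').const_mul ε
  refine ((h1.inv ?_).smul (((hn.inv (norm_ne_zero_iff.mpr hy)).smul differentiableAt_id).sub_const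
    q)).add (h1.smul_const c)
  exact mul_ne_zero hε (Real.sqrt_pos.mpr (div_pos hq hc)).ne'

/-- A map which is constant on rays has null image on the set where it is differentiable. -/
theorem volume_image_eq_zero_of_ray {d : ℕ} {f : Flat d → Flat d} {S : Set (Flat d)}
    (hf : ∀ y ∈ S, DifferentiableAt ℝ f y) (hray : ∀ y, ∀ r : ℝ, 0 < r → f (r • y) = f y)
    (h0 : ∀ y ∈ S, y ≠ 0) : volume (f '' S) = 0 := by
  refine addHaar_image_eq_zero_of_det_fderivWithin_eq_zero volume
    (f' := fderiv ℝ f) (fun y hy => (hf y hy).hasFDerivAt.hasFDerivWithinAt) fun y hy => ?_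
  have h1 : HasDerivAt (fun r : ℝ => f (r • y)) (fderiv ℝ f y y) 1 := by
    have h2 : HasDerivAt (fun r : ℝ => r • y) y 1 := by
      simpa using (hasDerivAt_id (1 : ℝ)).smul_const y
    have h3 : HasFDerivAt f (fderiv ℝ f y) ((1 : ℝ) • y) := by
      rw [one_smul]
      exact (hf y hy).hasFDerivAt
    exact h3.comp_hasDerivAt 1 h2
  have h4 : HasDerivAt (fun r : ℝ => f (r • y)) 0 1 := by
    refine (hasDerivAt_const (1 : ℝ) (f y)).congr_of_eventuallyEq ?_
    filter_upwards [lt_mem_nhds (zero_lt_one (α := ℝ))] with r hr using hray y r hr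
  have h5 := h1.unique h4
  by_contra hdet
  have hinj := (LinearMap.equivOfDetNeZero (fderiv ℝ f y : Flat d →ₗ[ℝ] Flat d) hdet).injective
  exact h0 y hy (hinj (by simpa using h5))

theorem volume_not_isTransverse {d : ℕ} (hd : 1 ≤ d) {q : Flat d} (hq : ‖q‖ ≤ 1) (c : Flat d) :
    volume {P | ¬ IsTransverse q P c} = 0 := by
  have : Nonempty (Fin d) := ⟨⟨0, hd⟩⟩
  set S : Set (Flat d) := {y | 0 < inner ℝ y c ∧ 0 < ‖y‖ - inner ℝ y q} with hS
  have hnull : ∀ ε : ℝ, ε ≠ 0 → volume (tangencyMap q c ε '' S) = 0 := fun ε hε =>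
    volume_image_eq_zero_of_ray
      (fun y hy => differentiableAt_tangencyMap q c hε hy.1 hy.2)
      (fun y r hr => tangencyMap_smul q c ε y hr) (fun y hy h => by
        have := hy.1
        rw [h] at this
        simp at this)
  have hplane : volume {P : Flat d | ‖q‖ = 1 ∧ inner ℝ q P = 0} = 0 := by
    by_cases h1 : ‖q‖ = 1
    · have h2 : {P : Flat d | ‖q‖ = 1 ∧ inner ℝ q P = 0} = ((ℝ ∙ q)ᗮ : Submodule ℝ (Flat d)) := by
        ext P
        simp [h1, Submodule.mem_orthogonal_singleton_iff_inner_right]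
      rw [h2]
      refine Measure.addHaar_submodule _ _ fun h3 => ?_
      have h4 : q ∈ (ℝ ∙ q)ᗮ := by rw [h3]; trivial
      rw [Submodule.mem_orthogonal_singleton_iff_inner_right, real_inner_self_eq_norm_sq, h1] at h4
      norm_num at h4
    · simp [h1]
  have hzero : volume ({0} : Set (Flat d)) = 0 := measure_singleton 0
  refine measure_mono_null (t := (({0} ∪ {P : Flat d | ‖q‖ = 1 ∧ inner ℝ q P = 0}) ∪
    tangencyMap q c 1 '' S) ∪ tangencyMap q c (-1) '' S) ?_
    (measure_union_null (measure_union_null (measure_union_null hzero hplane)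
      (hnull 1 one_ne_zero)) (hnull (-1) (by norm_num)))
  intro P hP
  simp only [IsTransverse, mem_ofPred_eq, not_and_or, not_forall, not_not] at hP
  rcases hP with hP | ⟨τ, hτ, htan⟩
  · exact Or.inl (Or.inl (Or.inl hP))
  set y := parabola q P c τ with hy
  have hyy : inner ℝ y y = (1 : ℝ) := by rw [real_inner_self_eq_norm_sq, hτ]; norm_num
  by_cases hτ0 : τ = 0
  · have : y = q := by rw [hy, hτ0]; simp [parabola]
    rw [this] at hτ htan
    refine Or.inl (Or.inl (Or.inr ⟨hτ, ?_⟩))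
    simpa [hτ0] using htan
  have hPe : P = τ⁻¹ • (y - q) + τ • c := by
    rw [hy]
    simp only [parabola, smul_sub, smul_add, smul_smul, inv_mul_cancel₀ hτ0, one_smul]
    rw [show τ⁻¹ * τ ^ 2 = τ by field_simp]
    abel
  have hkey : 1 - inner ℝ y q = τ ^ 2 * inner ℝ y c := by
    rw [hPe] at htan
    simp only [inner_sub_right, inner_add_right, real_inner_smul_right, hyy] at htan
    field_simp at htan
    linarith
  have hcs : inner ℝ y q ≤ (1 : ℝ) :=
    (real_inner_le_norm y q).trans (by rw [hτ, one_mul]; exact hq)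
  rcases hcs.lt_or_eq with hlt | heq
  · have hyc : 0 < inner ℝ y c := by
      have h0 : 0 < τ ^ 2 := by positivity
      exact (pos_iff_pos_of_mul_pos (by linarith)).mp h0
    have hyS : y ∈ S := ⟨hyc, by rw [hτ]; linarith⟩
    have hsq : √((‖y‖ - inner ℝ y q) / inner ℝ y c) = |τ| := by
      rw [hτ, hkey, mul_div_cancel_right₀ _ hyc.ne', Real.sqrt_sq_eq_abs]
    have hval : ∀ ε : ℝ, ε * |τ| = τ → tangencyMap q c ε y = P := by
      intro ε hε
      rw [tangencyMap, hsq, hε, hτ, inv_one, one_smul, ← hPe]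
    rcases le_total 0 τ with h | h
    · exact Or.inl (Or.inr ⟨y, hyS, hval 1 (by rw [abs_of_nonneg h, one_mul])⟩)
    · exact Or.inr ⟨y, hyS, hval (-1) (by rw [abs_of_nonpos h]; ring)⟩
  · have hyq : y = q := by
      rw [← sub_eq_zero, ← norm_eq_zero, ← sq_eq_zero_iff, ← real_inner_self_eq_norm_sq]
      refine le_antisymm ?_ real_inner_self_nonneg
      rw [inner_sub_left, inner_sub_right, inner_sub_right, hyy, heq, real_inner_comm, heq,
        real_inner_self_eq_norm_sq]
      nlinarith [norm_nonneg q]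
    have hyc : inner ℝ y c = (0 : ℝ) := by
      rw [heq, sub_self] at hkey
      simpa [hτ0] using hkey.symm
    refine Or.inl (Or.inl (Or.inr ⟨hyq ▸ hτ, ?_⟩))
    rw [← hyq, hPe, ← hyq, sub_self, smul_zero, zero_add, real_inner_smul_right, hyc, mul_zero]

/-- The set of transverse pairs is measurable: its complement is a countable union of projections of
closed sets along compact intervals. -/
theorem measurableSet_isTransverse {d : ℕ} (c : Flat d) :
    MeasurableSet {z : Flat d × Flat d | IsTransverse z.1 z.2 c} := by
  have h1 : {z : Flat d × Flat d | IsTransverse z.1 z.2 c} = {z | z.2 = 0}ᶜ ∩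
      (⋃ N : ℕ, Prod.fst '' {w : (Flat d × Flat d) × Icc (-N : ℝ) N |
        ‖parabola w.1.1 w.1.2 c w.2‖ = 1 ∧
          inner ℝ (parabola w.1.1 w.1.2 c w.2) (w.1.2 - (2 * (w.2 : ℝ)) • c) = 0})ᶜ := by
    ext z
    simp only [IsTransverse, mem_ofPred_eq, mem_inter_iff, mem_compl_iff, mem_iUnion, mem_image,
      not_exists, ne_eq, not_and, and_congr_right_iff]
    intro _
    constructor
    · rintro h N w ⟨hw1, hw2⟩ rfl
      exact h _ hw1 hw2
    · intro h τ h1 h2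
      obtain ⟨N, hN⟩ := exists_nat_ge |τ|
      exact h N (z, ⟨τ, abs_le.mp hN⟩) ⟨h1, h2⟩ rfl
  rw [h1]
  refine ((isClosed_eq continuous_snd continuous_const).measurableSet.compl).inter
    (MeasurableSet.iUnion fun N => IsClosed.measurableSet ?_).compl
  refine isClosedMap_fst_of_compactSpace _ ?_
  refine (isClosed_eq ?_ continuous_const).inter (isClosed_eq ?_ continuous_const)
  · unfold parabola
    fun_prop
  · unfold parabola
    fun_prop

/-! ### Closed trajectories of the reduced problem -/

/-- The vector `(q, u)` of `ℝⁿ`. -/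
def mkFull {d : ℕ} (q : Flat d) (u : ℝ) : Full d :=
  WithLp.toLp 2 (Fin.snoc (α := fun _ => ℝ) q u)

@[simp] theorem mkFull_castSucc {d : ℕ} (q : Flat d) (u : ℝ) (i : Fin d) :
    mkFull q u i.castSucc = q i := by
  simp [mkFull]

@[simp] theorem mkFull_last {d : ℕ} (q : Flat d) (u : ℝ) : mkFull q u (Fin.last d) = u := by
  simp [mkFull]

@[simp] theorem trunc_apply {d : ℕ} (x : Full d) (i : Fin d) : trunc x i = x i.castSucc := rfl

@[simp] theorem trunc_mkFull {d : ℕ} (q : Flat d) (u : ℝ) : trunc (mkFull q u) = q := by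
  ext i
  simp

theorem mkFull_trunc {d : ℕ} (x : Full d) : mkFull (trunc x) (x (Fin.last d)) = x := by
  ext i
  refine Fin.lastCases ?_ (fun i => ?_) i <;> simp

theorem full_ext {d : ℕ} {x y : Full d} (h1 : trunc x = trunc y)
    (h2 : x (Fin.last d) = y (Fin.last d)) : x = y := by
  rw [← mkFull_trunc x, ← mkFull_trunc y, h1, h2]

theorem inner_full {d : ℕ} (x y : Full d) :
    inner ℝ x y = inner ℝ (trunc x) (trunc y) + x (Fin.last d) * y (Fin.last d) := by
  simp [PiLp.inner_apply, Fin.sum_univ_castSucc, mul_comm]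

theorem norm_sq_full {d : ℕ} (x : Full d) :
    ‖x‖ ^ 2 = ‖trunc x‖ ^ 2 + x (Fin.last d) ^ 2 := by
  rw [← real_inner_self_eq_norm_sq, ← real_inner_self_eq_norm_sq, inner_full]
  ring

theorem norm_sq_trunc_add {d : ℕ} (x : Sph d) :
    ‖trunc (x : Full d)‖ ^ 2 + (x : Full d) (Fin.last d) ^ 2 = 1 := by
  rw [← norm_sq_full, mem_sphere_zero_iff_norm.mp x.2, one_pow]

theorem norm_trunc_le_one {d : ℕ} (x : Sph d) : ‖trunc (x : Full d)‖ ≤ 1 := by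
  have := norm_sq_trunc_add x
  nlinarith [norm_nonneg (trunc (x : Full d)), sq_nonneg ((x : Full d) (Fin.last d))]

theorem mkFull_mem_sphere {d : ℕ} {q : Flat d} {u : ℝ} (h : ‖q‖ ^ 2 + u ^ 2 = 1) :
    mkFull q u ∈ sphere (0 : Full d) 1 := by
  rw [mem_sphere_zero_iff_norm,
    ← pow_eq_one_iff_of_nonneg (norm_nonneg _) two_ne_zero, norm_sq_full]
  simpa using h

theorem continuous_trunc {d : ℕ} : Continuous (trunc : Full d → Flat d) := by
  unfold trunc
  fun_prop

variable {d : ℕ}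

/-- The trajectory of the reduced problem that belongs to a motion along a parabola. -/
def PeriodicMotion.reducedCurve {q P c : Flat d} (m : PeriodicMotion q P c) (p : Flat d)
    (C : Fin d → ℝ) (t : ℝ) : ReducedPhase d :=
  (⟨mkFull (parabola q P c (m.τ t)) (m.u t), mkFull_mem_sphere (m.energy t)⟩,
    p - m.τ t • WithLp.toLp 2 C)

/-- Half of the vector `A C`. -/
def InertiaOperator.halfDrift (I : InertiaOperator d) (C : Fin d → ℝ) : Flat d :=
  (1 / 2 : ℝ) • I.opA (WithLp.toLp 2 C)

theorem InertiaOperator.opA_sub_smul (I : InertiaOperator d) (C : Fin d → ℝ) (p : Flat d) (τ : ℝ) :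
    I.opA (p - τ • WithLp.toLp 2 C) = I.opA p - (2 * τ) • I.halfDrift C := by
  rw [map_sub, map_smul, InertiaOperator.halfDrift, smul_smul]
  congr 2
  ring

theorem InertiaOperator.halfDrift_ne_zero (I : InertiaOperator d) {C : Fin d → ℝ} (hC : C ≠ 0) :
    I.halfDrift C ≠ 0 := by
  intro h
  simp only [halfDrift, smul_eq_zero, one_div, inv_eq_zero, OfNat.ofNat_ne_zero, false_or,
    LinearEquiv.map_eq_zero_iff] at h
  exact hC (by simpa using h)

namespace PeriodicMotion

theorem hasDerivAt_coord {q P c : Flat d} (m : PeriodicMotion q P c) (t : ℝ) (i : Fin d) :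
    HasDerivAt (fun s => parabola q P c (m.τ s) i) (m.u t * (P - (2 * m.τ t) • c) i) t := by
  have h := hasDerivAt_parabola q P c (m.hasDerivAt_τ t)
  simpa using (hasDerivAt_pi.mp ((PiLp.continuousLinearEquiv 2 ℝ
    (fun _ : Fin d => ℝ)).hasFDerivAt.comp_hasDerivAt t h)) i

theorem isReducedSolution (I : InertiaOperator d) (C : Fin d → ℝ) {q p : Flat d}
    (m : PeriodicMotion q (I.opA p) (I.halfDrift C)) :
    IsReducedSolution I (kharlamovaPotential C) (m.reducedCurve p C) := by
  intro t
  have hA : ∀ i, (I.A *ᵥ (m.reducedCurve p C t).2) i =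
      (I.opA p - (2 * m.τ t) • I.halfDrift C) i := by
    intro i
    rw [← I.opA_sub_smul]
    rfl
  refine ⟨fun i => ?_, ?_, fun i => ?_⟩
  · have := m.hasDerivAt_coord t i
    rw [hA]
    simpa [reducedCurve] using this
  · have := m.hasDerivAt_u t
    simp only [hA]
    simp only [reducedCurve, mkFull_last, mkFull_castSucc]
    refine this.congr_deriv ?_
    simp [PiLp.inner_apply]
  · have := ((m.hasDerivAt_τ t).mul_const (C i)).const_sub (p i)
    simpa [reducedCurve] using this

theorem periodic_reducedCurve {q P c : Flat d} (m : PeriodicMotion q P c) (p : Flat d)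
    (C : Fin d → ℝ) : Function.Periodic (m.reducedCurve p C) m.T := by
  intro t
  simp only [reducedCurve, m.periodic_τ t, m.periodic_u t]

theorem reducedCurve_injective_mod (I : InertiaOperator d) (C : Fin d → ℝ) {q p : Flat d}
    (m : PeriodicMotion q (I.opA p) (I.halfDrift C)) (hP : I.opA p ≠ 0) {s t : ℝ}
    (h : m.reducedCurve p C s = m.reducedCurve p C t) : ∃ k : ℤ, s = t + k * m.T := by
  have h1 : mkFull (parabola q (I.opA p) (I.halfDrift C) (m.τ s)) (m.u s) =
      mkFull (parabola q (I.opA p) (I.halfDrift C) (m.τ t)) (m.u t) :=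
    congrArg Subtype.val (congrArg Prod.fst h)
  have hu : m.u s = m.u t := by simpa using congrArg (fun x : Full d => x (Fin.last d)) h1
  have hq := congrArg trunc h1
  simp only [trunc_mkFull] at hq
  have hp : m.τ s • (WithLp.toLp 2 C : Flat d) = m.τ t • WithLp.toLp 2 C := by
    have := congrArg Prod.snd h
    simpa [reducedCurve] using this
  refine m.injective_mod s t ?_ hu
  by_cases hC : (WithLp.toLp 2 C : Flat d) = 0
  · simp only [parabola, InertiaOperator.halfDrift, hC, map_zero, smul_zero, sub_zero,
      add_right_inj] at hq
    exact smul_left_injective ℝ hP hq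
  · exact smul_left_injective ℝ hC hp

theorem isClosedTrajectory (I : InertiaOperator d) (C : Fin d → ℝ) {q p : Flat d}
    (m : PeriodicMotion q (I.opA p) (I.halfDrift C)) (hP : I.opA p ≠ 0) :
    IsClosedTrajectory (m.reducedCurve p C) := by
  refine ⟨⟨m.T, m.T_pos, m.periodic_reducedCurve p C⟩, m.T / 2, 0, fun h => ?_⟩
  obtain ⟨k, hk⟩ := m.reducedCurve_injective_mod I C hP h
  have hT := m.T_pos
  have h2 : (1 : ℝ) = 2 * k := by
    have h4 : m.T * (1 - 2 * k) = 0 := by linarith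
    have h5 := (mul_eq_zero.mp h4).resolve_left hT.ne'
    linarith
  have h3 : (1 : ℤ) = 2 * k := by exact_mod_cast h2
  omega

theorem reducedCurve_zero {p : Flat d} {x : Sph d} {P c : Flat d}
    (m : PeriodicMotion (trunc (x : Full d)) P c) (C : Fin d → ℝ)
    (hu : m.u 0 = (x : Full d) (Fin.last d)) : m.reducedCurve p C 0 = (x, p) := by
  refine Prod.ext (Subtype.ext ?_) ?_
  · simp [reducedCurve, m.τ_zero, parabola, hu, mkFull_trunc]
  · simp [reducedCurve, m.τ_zero]

end PeriodicMotion

theorem ae_isTransverse_reduced (hd : 1 ≤ d) (I : InertiaOperator d) (C : Fin d → ℝ) :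
    ∀ᵐ x ∂(reducedMeasure d),
      IsTransverse (trunc (x.1 : Full d)) (I.opA x.2) (I.halfDrift C) := by
  have hmeas : MeasurableSet {x : ReducedPhase d |
      ¬ IsTransverse (trunc (x.1 : Full d)) (I.opA x.2) (I.halfDrift C)} := by
    refine MeasurableSet.compl ?_
    have hf : Measurable fun x : ReducedPhase d => (trunc (x.1 : Full d), I.opA x.2) :=
      ((continuous_trunc.comp continuous_subtype_val).measurable.comp measurable_fst).prodMk
        (I.opA_continuous.measurable.comp measurable_snd)
    exact hf (measurableSet_isTransverse (I.halfDrift C))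
  rw [ae_iff, reducedMeasure, Measure.measure_prod_null hmeas]
  refine Filter.Eventually.of_forall fun x => ?_
  have h := volume_not_isTransverse hd (norm_trunc_le_one x) (I.halfDrift C)
  have h2 := Measure.addHaar_preimage_linearMap (volume : Measure (Flat d))
    (f := (I.opA : Flat d →ₗ[ℝ] Flat d)) (LinearEquiv.isUnit_det' I.opA).ne_zero
    {P | ¬ IsTransverse (trunc (x : Full d)) P (I.halfDrift C)}
  rw [h, mul_zero] at h2
  exact h2

theorem ae_exists_closedTrajectory (hd : 1 ≤ d) (I : InertiaOperator d) (C : Fin d → ℝ) :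
    ∀ᵐ x ∂(reducedMeasure d), ∃ γ : ℝ → ReducedPhase d,
      IsReducedSolution I (kharlamovaPotential C) γ ∧ γ 0 = x ∧ IsClosedTrajectory γ := by
  filter_upwards [ae_isTransverse_reduced hd I C] with x hx
  obtain ⟨m, hm⟩ := hx.exists_motion (norm_sq_trunc_add x.1)
  exact ⟨m.reducedCurve x.2 C, m.isReducedSolution I C, m.reducedCurve_zero C hm,
    m.isClosedTrajectory I C hx.1⟩

/-! ### Linear equations with skew-symmetric coefficients -/

theorem eq_of_hasDerivAt_zero_Ioo {f : ℝ → ℝ} {a : ℝ} (h : ∀ t ∈ Ioo (-a) a, HasDerivAt f 0 t)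
    {s t : ℝ} (hs : s ∈ Ioo (-a) a) (ht : t ∈ Ioo (-a) a) : f s = f t :=
  isOpen_Ioo.is_const_of_deriv_eq_zero isPreconnected_Ioo
    (fun x hx => (h x hx).differentiableAt.differentiableWithinAt)
    (fun x hx => (h x hx).deriv) hs ht

section Skew

variable {E : Type*} [NormedAddCommGroup E] [InnerProductSpace ℝ E]

/-- A function that equals `x` on the unit sphere, but has values in the unit ball. -/
def damp (x : E) : E := (2 / (1 + ‖x‖ ^ 2)) • x

theorem norm_damp_le (x : E) : ‖damp x‖ ≤ 1 := by
  rw [damp, norm_smul, Real.norm_eq_abs, abs_of_nonneg (by positivity), div_mul_eq_mul_div,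
    div_le_one (by positivity)]
  nlinarith [sq_nonneg (‖x‖ - 1)]

theorem damp_of_norm_eq_one {x : E} (hx : ‖x‖ = 1) : damp x = x := by
  rw [damp, hx]
  norm_num

theorem contDiff_damp : ContDiff ℝ 1 (damp : E → E) := by
  refine ContDiff.smul (ContDiff.div contDiff_const
    (contDiff_const.add (contDiff_norm_sq ℝ)) fun x => ?_) contDiff_id
  positivity

theorem hasDerivAt_inner_zero_of_skew {Ω : ℝ → E →ₗ[ℝ] E}
    (hskew : ∀ t x y, inner ℝ (Ω t x) y = -inner ℝ x (Ω t y)) {X Y : ℝ → E} {t : ℝ}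
    (hX : HasDerivAt X (Ω t (X t)) t) (hY : HasDerivAt Y (Ω t (Y t)) t) :
    HasDerivAt (fun s => inner ℝ (X s) (Y s)) 0 t := by
  refine (hX.inner ℝ hY).congr_deriv ?_
  rw [hskew, add_neg_cancel]

/-- Solutions of unit length exist for all times. Since the length is conserved, the equation
may be replaced by one with a bounded right-hand side. -/
theorem exists_solution_of_skew [FiniteDimensional ℝ E] {Ω : ℝ → E →ₗ[ℝ] E}
    (hcont : ∀ x, Continuous fun t => Ω t x)
    (hbound : ∀ a, ∃ B, ∀ t ∈ Icc (-a) a, ∀ x, ‖Ω t x‖ ≤ B * ‖x‖)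
    (hskew : ∀ t x y, inner ℝ (Ω t x) y = -inner ℝ x (Ω t y)) {x₀ : E} (hx₀ : ‖x₀‖ = 1) :
    ∃ X : ℝ → E, X 0 = x₀ ∧ ∀ t, HasDerivAt X (Ω t (X t)) t := by
  have hself : ∀ t x, inner ℝ (Ω t x) x = (0 : ℝ) := by
    intro t x
    have := hskew t x x
    rw [real_inner_comm (Ω t x) x] at this
    linarith
  have hlocal : ∀ a : ℝ, 0 < a → ∃ X : ℝ → E, X 0 = x₀ ∧
      ∀ t ∈ Ioo (-a) a, HasDerivAt X (Ω t (X t)) t := by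
    intro a ha
    obtain ⟨B', hB'⟩ := hbound a
    set B : NNReal := ⟨max B' 0, le_max_right _ _⟩ with hBdef
    have hB : ∀ t ∈ Icc (-a) a, ∀ x, ‖Ω t x‖ ≤ B * ‖x‖ := fun t ht x =>
      (hB' t ht x).trans (mul_le_mul_of_nonneg_right (le_max_left _ _) (norm_nonneg _))
    set A : NNReal := ⟨a, ha.le⟩ with hA
    obtain ⟨K, hK⟩ := (contDiff_damp (E := E)).contDiffOn.exists_lipschitzOnWith one_ne_zero
      (convex_closedBall x₀ (B * A : NNReal)) (isCompact_closedBall x₀ _)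
    have hPL : IsPicardLindelof (fun t x => Ω t (damp x)) (tmin := -a) (tmax := a)
        ⟨0, by constructor <;> linarith⟩ x₀ (B * A) 0 B (B * K) := by
      refine ⟨fun t ht => ?_, fun x hx => (hcont _).continuousOn, fun t ht x hx => ?_, ?_⟩
      · refine LipschitzOnWith.of_dist_le_mul fun x hx y hy => ?_
        rw [dist_eq_norm, ← map_sub]
        refine (hB t ht _).trans ?_
        rw [← dist_eq_norm, NNReal.coe_mul, mul_assoc]
        exact mul_le_mul_of_nonneg_left (hK.dist_le_mul x hx y hy) B.2
      · refine (hB t ht _).trans ?_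
        exact mul_le_of_le_one_right B.2 (norm_damp_le x)
      · simp [hA]
        exact le_rfl
    obtain ⟨X, hX0, hX⟩ := hPL.exists_eq_forall_mem_Icc_hasDerivWithinAt₀
    have hX' : ∀ t ∈ Ioo (-a) a, HasDerivAt X (Ω t (damp (X t))) t := fun t ht =>
      (hX t (Ioo_subset_Icc_self ht)).hasDerivAt (Icc_mem_nhds ht.1 ht.2)
    have h0 : (0 : ℝ) ∈ Ioo (-a) a := ⟨by linarith, ha⟩
    have hnorm : ∀ t ∈ Ioo (-a) a, ‖X t‖ = 1 := by
      intro t ht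
      have h1 : ∀ t ∈ Ioo (-a) a, HasDerivAt (fun s => inner ℝ (X s) (X s)) 0 t := by
        intro t ht
        refine ((hX' t ht).inner ℝ (hX' t ht)).congr_deriv ?_
        rw [real_inner_comm (Ω t (damp (X t))) (X t)]
        simp [damp, real_inner_smul_left, hself]
      have h2 := eq_of_hasDerivAt_zero_Ioo h1 ht h0
      have hX0' : X 0 = x₀ := hX0
      rw [hX0', real_inner_self_eq_norm_sq, real_inner_self_eq_norm_sq, hx₀] at h2
      exact (pow_eq_one_iff_of_nonneg (norm_nonneg _) two_ne_zero).mp (by rw [h2, one_pow])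
    refine ⟨X, hX0, fun t ht => ?_⟩
    have := hX' t ht
    rwa [damp_of_norm_eq_one (hnorm t ht)] at this
  have hlocal' : ∀ a : ℝ, ∃ X : ℝ → E, X 0 = x₀ ∧
      ∀ t ∈ Ioo (-(|a| + 1)) (|a| + 1), HasDerivAt X (Ω t (X t)) t := fun a =>
    hlocal (|a| + 1) (by positivity)
  choose X hX0 hX using hlocal'
  have huniq : ∀ a b t, t ∈ Ioo (-(|a| + 1)) (|a| + 1) → t ∈ Ioo (-(|b| + 1)) (|b| + 1) →
      X a t = X b t := by
    intro a b t hta htb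
    have hsub : ∀ s ∈ Ioo (-(min (|a| + 1) (|b| + 1))) (min (|a| + 1) (|b| + 1)),
        HasDerivAt (fun r => inner ℝ (X a r - X b r) (X a r - X b r)) 0 s := by
      intro s hs
      have hs' := abs_lt.mpr hs
      have h1 := (hX a s (abs_lt.mp (hs'.trans_le (min_le_left _ _)))).sub
        (hX b s (abs_lt.mp (hs'.trans_le (min_le_right _ _))))
      rw [← map_sub] at h1
      exact hasDerivAt_inner_zero_of_skew hskew h1 h1
    have ht : t ∈ Ioo (-(min (|a| + 1) (|b| + 1))) (min (|a| + 1) (|b| + 1)) :=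
      abs_lt.mp (lt_min (abs_lt.mpr hta) (abs_lt.mpr htb))
    have h0 : (0 : ℝ) ∈ Ioo (-(min (|a| + 1) (|b| + 1))) (min (|a| + 1) (|b| + 1)) := by
      rw [mem_Ioo, ← abs_lt, abs_zero]
      positivity
    have h2 := eq_of_hasDerivAt_zero_Ioo hsub ht h0
    rw [hX0, hX0, sub_self, inner_zero_left, inner_self_eq_zero, sub_eq_zero] at h2
    exact h2
  refine ⟨fun t => X t t, hX0 0, fun t => ?_⟩
  have hmem : t ∈ Ioo (-(|t| + 1)) (|t| + 1) := abs_lt.mp (lt_add_one _)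
  refine (hX t t hmem).congr_of_eventuallyEq ?_
  filter_upwards [Ioo_mem_nhds hmem.1 hmem.2] with s hs
  exact huniq s t s (abs_lt.mp (lt_add_one _)) hs

theorem inner_eq_of_skew {Ω : ℝ → E →ₗ[ℝ] E}
    (hskew : ∀ t x y, inner ℝ (Ω t x) y = -inner ℝ x (Ω t y)) {X Y : ℝ → E}
    (hX : ∀ t, HasDerivAt X (Ω t (X t)) t) (hY : ∀ t, HasDerivAt Y (Ω t (Y t)) t) (s t : ℝ) :
    (inner ℝ (X s) (Y s) : ℝ) = inner ℝ (X t) (Y t) :=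
  is_const_of_deriv_eq_zero
    (fun r => (hasDerivAt_inner_zero_of_skew hskew (hX r) (hY r)).differentiableAt)
    (fun r => (hasDerivAt_inner_zero_of_skew hskew (hX r) (hY r)).deriv) s t

theorem eq_of_skew {Ω : ℝ → E →ₗ[ℝ] E}
    (hskew : ∀ t x y, inner ℝ (Ω t x) y = -inner ℝ x (Ω t y)) {X Y : ℝ → E}
    (hX : ∀ t, HasDerivAt X (Ω t (X t)) t) (hY : ∀ t, HasDerivAt Y (Ω t (Y t)) t) {s : ℝ}
    (h : X s = Y s) (t : ℝ) : X t = Y t := by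
  have h1 : ∀ t, HasDerivAt (X - Y) (Ω t ((X - Y) t)) t := fun t => by
    have := (hX t).sub (hY t)
    rwa [← map_sub] at this
  have h2 := inner_eq_of_skew hskew h1 h1 t s
  rw [Pi.sub_apply, Pi.sub_apply, h, sub_self, inner_zero_left, inner_self_eq_zero,
    sub_eq_zero] at h2
  exact h2

end Skew

/-! ### The kinematic equation -/

/-- The operator `x ↦ x ω` on row vectors, for `ω = -∑ Vᵢ Eᵢ ∧ Eₙ`. -/
def rollOp (V : Flat d) : Full d →ₗ[ℝ] Full d where
  toFun x := mkFull (x (Fin.last d) • V) (-inner ℝ (trunc x) V)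
  map_add' x y := by
    refine full_ext ?_ ?_
    · ext i
      simp [add_mul]
    · have : trunc (x + y) = trunc x + trunc y := rfl
      simp [this, inner_add_left]
      ring
  map_smul' r x := by
    refine full_ext ?_ ?_
    · ext i
      simp [mul_assoc]
    · have : trunc (r • x) = r • trunc x := rfl
      simp [this, real_inner_smul_left]

theorem rollOp_apply (V : Flat d) (x : Full d) :
    rollOp V x = mkFull (x (Fin.last d) • V) (-inner ℝ (trunc x) V) := rfl

theorem inner_rollOp (V : Flat d) (x y : Full d) :
    inner ℝ (rollOp V x) y = -inner ℝ x (rollOp V y) := by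
  rw [inner_full, inner_full x]
  simp [rollOp_apply, real_inner_smul_left, real_inner_smul_right, real_inner_comm V]
  ring

theorem norm_rollOp_le (V : Flat d) (x : Full d) : ‖rollOp V x‖ ≤ ‖V‖ * ‖x‖ := by
  refine abs_le_of_sq_le_sq' ?_ (by positivity) |>.2
  rw [mul_pow, norm_sq_full, norm_sq_full x, rollOp_apply, trunc_mkFull, mkFull_last, norm_smul,
    mul_pow, Real.norm_eq_abs, sq_abs, neg_sq]
  have := abs_real_inner_le_norm (trunc x) V
  have h2 := pow_le_pow_left₀ (abs_nonneg _) this 2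
  rw [sq_abs, mul_pow] at h2
  nlinarith

theorem continuous_mkFull : Continuous fun z : Flat d × ℝ => mkFull z.1 z.2 := by
  have : ∀ i : Fin (d + 1), Continuous fun z : Flat d × ℝ => mkFull z.1 z.2 i := by
    intro i
    refine Fin.lastCases ?_ (fun i => ?_) i
    · simp only [mkFull_last]
      exact continuous_snd
    · simp only [mkFull_castSucc]
      fun_prop
  exact (PiLp.continuous_toLp 2 _).comp (continuous_pi this)

theorem continuous_rollOp (x : Full d) : Continuous fun V : Flat d => rollOp V x := by
  simp only [rollOp_apply]
  exact continuous_mkFull.comp ((by fun_prop : Continuous fun V : Flat d =>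
    (x (Fin.last d) • V, -inner ℝ (trunc x) V)))

/-- Row `i` of a matrix. -/
def row (g : Mat d) (i : Fin (d + 1)) : Full d := WithLp.toLp 2 (g i)

@[simp] theorem row_apply (g : Mat d) (i j : Fin (d + 1)) : row g i j = g i j := rfl

theorem row_mul_angVel (g : Mat d) (V : Flat d) (i : Fin (d + 1)) :
    row (g * (angVel (-V) : Mat d)) i = rollOp V (row g i) := by
  refine full_ext ?_ ?_
  · ext j
    simp [Matrix.mul_apply, Fin.sum_univ_castSucc, rollOp_apply]
  · simp [Matrix.mul_apply, Fin.sum_univ_castSucc, rollOp_apply, PiLp.inner_apply,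
      mul_comm]

theorem mul_transpose_apply (g h : Mat d) (i j : Fin (d + 1)) :
    (g * hᵀ) i j = inner ℝ (row g i) (row h j) := by
  simp [Matrix.mul_apply, PiLp.inner_apply, mul_comm]

theorem hasDerivAt_row {g : ℝ → Mat d} {g' : Mat d} {t : ℝ} (i : Fin (d + 1))  :
    HasDerivAt (fun s => row (g s) i) (row g' i) t ↔
      ∀ j, HasDerivAt (fun s => g s i j) (g' i j) t := by
  constructor
  · intro h j
    simpa using (hasDerivAt_pi.mp ((PiLp.continuousLinearEquiv 2 ℝ
      (fun _ : Fin (d + 1) => ℝ)).hasFDerivAt.comp_hasDerivAt t h)) j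
  · intro h
    have h1 : HasDerivAt (fun s => g s i) (g' i) t := hasDerivAt_pi.mpr h
    exact (PiLp.continuousLinearEquiv 2 ℝ
      (fun _ : Fin (d + 1) => ℝ)).symm.hasFDerivAt.comp_hasDerivAt t h1

/-- The kinematic equation `ġ = g ω(t)`, `ω = -∑ Vᵢ Eᵢ ∧ Eₙ`, is solvable in `SO(n)`. -/
theorem exists_kinematic_solution {V : ℝ → Flat d} (hV : Continuous V) (g₀ : SOn d) :
    ∃ g : ℝ → SOn d, g 0 = g₀ ∧ Continuous g ∧
      ∀ t i, HasDerivAt (fun s => row (g s : Mat d) i) (rollOp (V t) (row (g t : Mat d) i)) t := by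
  have horth : (g₀ : Mat d) * (g₀ : Mat d)ᵀ = 1 := (Matrix.mem_orthogonalGroup_iff _ _).mp
    (Matrix.mem_specialOrthogonalGroup_iff.mp g₀.2).1
  have hbound : ∀ a, ∃ B, ∀ t ∈ Icc (-a) a, ∀ x : Full d, ‖rollOp (V t) x‖ ≤ B * ‖x‖ := by
    intro a
    obtain ⟨B, hB⟩ := isCompact_Icc.exists_bound_of_continuousOn (hV.continuousOn (s := Icc (-a) a))
    exact ⟨B, fun t ht x => (norm_rollOp_le _ _).trans
      (mul_le_mul_of_nonneg_right (hB t ht) (norm_nonneg _))⟩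
  have hrow : ∀ i, ‖row (g₀ : Mat d) i‖ = 1 := by
    intro i
    have := mul_transpose_apply (g₀ : Mat d) g₀ i i
    rw [horth, Matrix.one_apply_eq, real_inner_self_eq_norm_sq] at this
    exact (pow_eq_one_iff_of_nonneg (norm_nonneg _) two_ne_zero).mp this.symm
  choose X hX0 hX using fun i => exists_solution_of_skew
    (fun x => (continuous_rollOp x).comp hV) hbound (fun t => inner_rollOp (V t)) (hrow i)
  set G : ℝ → Mat d := fun t => Matrix.of fun i j => X i t j with hG
  have hGrow : ∀ t i, row (G t) i = X i t := fun t i => rfl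
  have hG0 : G 0 = g₀ := by
    ext i j
    have := congrArg (fun x : Full d => x j) (hX0 i)
    exact this
  have hGo : ∀ t, G t * (G t)ᵀ = 1 := by
    intro t
    rw [← horth, ← hG0]
    ext i j
    rw [mul_transpose_apply, mul_transpose_apply]
    simp only [hGrow]
    exact inner_eq_of_skew (fun t => inner_rollOp (V t)) (hX i) (hX j) t 0
  have hXc : ∀ i, Continuous (X i) := fun i =>
    continuous_iff_continuousAt.mpr fun t => (hX i t).continuousAt
  have hGc : Continuous G := by
    refine continuous_matrix fun i j => ?_
    have := hXc i
    simp only [hG, Matrix.of_apply]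
    fun_prop
  have hdetsq : ∀ t, (G t).det ^ 2 = 1 := by
    intro t
    have := congrArg Matrix.det (hGo t)
    rwa [Matrix.det_mul, Matrix.det_transpose, Matrix.det_one, ← sq] at this
  have hdet : ∀ t, (G t).det = 1 := by
    intro t
    have hc : Continuous fun t => (G t).det := hGc.matrix_det
    rcases mul_self_eq_one_iff.mp ((sq _).symm.trans (hdetsq t)) with h | h
    · exact h
    · exfalso
      have h0 : (G 0).det = 1 := by rw [hG0]; exact (Matrix.mem_specialOrthogonalGroup_iff.mp g₀.2).2
      obtain ⟨s, hs⟩ := mem_range_of_exists_le_of_exists_ge hc (c := (0 : ℝ)) ⟨t, by linarith⟩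
        ⟨0, by linarith⟩
      have := hdetsq s
      rw [show (G s).det = 0 from hs] at this
      norm_num at this
  refine ⟨fun t => ⟨G t, Matrix.mem_specialOrthogonalGroup_iff.mpr
    ⟨(Matrix.mem_orthogonalGroup_iff _ _).mpr (hGo t), hdet t⟩⟩, Subtype.ext hG0,
    hGc.subtype_mk _, fun t i => hX i t⟩

/-! ### Lifting closed trajectories to the constraint distribution -/

theorem SOn.mul_transpose (g : SOn d) : (g : Mat d) * (g : Mat d)ᵀ = 1 :=
  (Matrix.mem_orthogonalGroup_iff _ _).mp (Matrix.mem_specialOrthogonalGroup_iff.mp g.2).1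

theorem SOn.transpose_mul (g : SOn d) : (g : Mat d)ᵀ * (g : Mat d) = 1 :=
  (Matrix.mem_orthogonalGroup_iff' _ _).mp (Matrix.mem_specialOrthogonalGroup_iff.mp g.2).1

theorem SOn.coe_inv (g : SOn d) : ((g⁻¹ : SOn d) : Mat d) = (g : Mat d)ᵀ := rfl

theorem inner_row (g : Mat d) (w : Full d) (i : Fin (d + 1)) :
    inner ℝ (row g i) w = (g *ᵥ w) i := by
  simp [PiLp.inner_apply, Matrix.mulVec, dotProduct, mul_comm]

/-- A periodic motion along a parabola lifts to a trajectory of the Suslov problem, which is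
multiplied from the left by a fixed rotation after each period. The rotation fixes the vectors that
correspond to the orthogonal complement of the span of `P`, `c` and `Eₙ`. -/
theorem exists_lift (I : InertiaOperator d) (C : Fin d → ℝ) {z : DPhase d} {q p P c : Flat d}
    (m : PeriodicMotion q P c) (hP : I.opA p = P) (hc : I.halfDrift C = c) (hq : trunc z.e = q)
    (hPz : P = -z.2) (hm : m.u 0 = z.e (Fin.last d)) :
    ∃ (γ : ℝ → DPhase d) (M : SOn d), γ 0 = z ∧ Continuous γ ∧
      IsSuslovSolution I (kharlamovaPotential C) γ ∧
      (∀ t, (γ t).reduce I = m.reducedCurve p C t) ∧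
      (∀ t, γ (t + m.T) = (M * (γ t).1, (γ t).2)) ∧
      (∀ t i, HasDerivAt (fun s => row ((γ s).1 : Mat d) i)
        (rollOp (P - (2 * m.τ t) • c) (row ((γ t).1 : Mat d) i)) t) ∧
      ∀ w : Full d, inner ℝ (trunc w) P = (0 : ℝ) → inner ℝ (trunc w) c = (0 : ℝ) →
        w (Fin.last d) = 0 → (M : Mat d) *ᵥ ((z.1 : Mat d) *ᵥ w) = (z.1 : Mat d) *ᵥ w := by
  have hτc : Continuous m.τ := continuous_iff_continuousAt.mpr fun t =>
    (m.hasDerivAt_τ t).continuousAt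
  have hVc : Continuous fun t => P - (2 * m.τ t) • c := by fun_prop
  obtain ⟨g, hg0, hgc, hg⟩ := exists_kinematic_solution hVc z.1
  set γ : ℝ → DPhase d := fun t => (g t, -(P - (2 * m.τ t) • c)) with hγ
  have hskew : ∀ t : ℝ, ∀ x y : Full d, inner ℝ (rollOp (P - (2 * m.τ t) • c) x) y =
      -inner ℝ x (rollOp (P - (2 * m.τ t) • c) y) := fun t => inner_rollOp _
  have he : ∀ t, (γ t).e = mkFull (parabola q P c (m.τ t)) (m.u t) := by
    have hrow : ∀ t, (γ t).e = row (g t : Mat d) (Fin.last d) := fun t => rfl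
    intro t
    rw [hrow]
    refine eq_of_skew hskew (fun t => hg t (Fin.last d)) (Y := fun t =>
      mkFull (parabola q P c (m.τ t)) (m.u t)) (fun t => ?_) (s := 0) ?_ t
    · have h1 : ∀ i, HasDerivAt (fun s => mkFull (parabola q P c (m.τ s)) (m.u s) i)
          (rollOp (P - (2 * m.τ t) • c) (mkFull (parabola q P c (m.τ t)) (m.u t)) i)
          t := by
        intro i
        refine Fin.lastCases ?_ (fun i => ?_) i
        · simpa [rollOp_apply] using m.hasDerivAt_u t
        · simpa [rollOp_apply] using m.hasDerivAt_coord t i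
      exact (PiLp.continuousLinearEquiv 2 ℝ
        (fun _ : Fin (d + 1) => ℝ)).symm.hasFDerivAt.comp_hasDerivAt t (hasDerivAt_pi.mpr h1)
    · rw [hg0, m.τ_zero, hm]
      have : parabola q P c 0 = trunc z.e := by simp [parabola, hq]
      rw [this, mkFull_trunc]
      rfl
  have hper : ∀ t, (γ (t + m.T)).2 = (γ t).2 := by
    intro t
    simp only [hγ, m.periodic_τ t]
  refine ⟨γ, g m.T * (g 0)⁻¹, ?_, ?_, ?_, ?_, ?_, hg, ?_⟩
  · refine Prod.ext hg0 ?_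
    simp [hγ, m.τ_zero, hPz]
  · exact hgc.prodMk hVc.neg
  · refine isSuslovSolution_of I C γ (fun t i => 2 * m.u t * c i) (fun t i j => ?_)
      (fun t i => ?_) fun t i => ?_
    · refine (hasDerivAt_row i).mp ?_ j
      rw [show angVel ((γ t).2 : Fin d → ℝ) = angVel (-(P - (2 * m.τ t) • c)) from rfl,
        row_mul_angVel]
      exact hg t i
    · have := ((((m.hasDerivAt_τ t).const_mul 2).mul_const (c i)).const_sub (P i)).neg
      refine (this.congr_deriv (by ring)).congr_of_eventuallyEq
        (Filter.Eventually.of_forall fun s => ?_)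
      simp [hγ]
    · rw [he, mkFull_last]
      have h1 : (fun i => 2 * m.u t * c i) = m.u t • (I.A *ᵥ C) := by
        ext i
        simp [← hc, InertiaOperator.halfDrift]
        ring
      rw [h1, Matrix.mulVec_smul, I.J_mulVec_A_mulVec]
      simp [mul_comm]
  · intro t
    refine Prod.ext (Subtype.ext (he t)) ?_
    have h1 : I.opA.symm (P - (2 * m.τ t) • c) = p - m.τ t • WithLp.toLp 2 C := by
      rw [LinearEquiv.symm_apply_eq, I.opA_sub_smul, hP, hc]
    change WithLp.toLp 2 (-(I.J *ᵥ (-(P - (2 * m.τ t) • c) : Flat d))) = _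
    rw [PeriodicMotion.reducedCurve, ← h1, I.opA_symm_apply, WithLp.ofLp_neg, Matrix.mulVec_neg,
      neg_neg]
  · intro t
    refine Prod.ext (Subtype.ext ?_) (hper t)
    have h1 : ∀ s, (g (s + m.T) : Mat d) * (g s : Mat d)ᵀ = g m.T * (g 0 : Mat d)ᵀ := by
      intro s
      ext i j
      rw [mul_transpose_apply, mul_transpose_apply]
      have hshift : ∀ t, HasDerivAt (fun s => row (g (s + m.T) : Mat d) i)
          (rollOp (P - (2 * m.τ t) • c) (row (g (t + m.T) : Mat d) i)) t := by
        intro t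
        have := (hg (t + m.T) i).comp_add_const t m.T
        rwa [m.periodic_τ t] at this
      have := inner_eq_of_skew hskew hshift (fun t => hg t j) s 0
      simpa using this
    have h2 := congrArg (· * (g t : Mat d)) (h1 t)
    simp only [Matrix.mul_assoc, SOn.transpose_mul, Matrix.mul_one] at h2
    simpa [hγ, SOn.coe_inv, Matrix.mul_assoc] using h2
  · intro w hwP hwc hwn
    have h1 : ∀ t i, ((g t : Mat d) *ᵥ w) i = ((g 0 : Mat d) *ᵥ w) i := by
      intro t i
      rw [← inner_row, ← inner_row]
      refine inner_eq_of_skew hskew (fun t => hg t i) (Y := fun _ => w) (fun t => ?_) t 0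
      have : rollOp (P - (2 * m.τ t) • c) w = 0 := by
        rw [rollOp_apply, inner_sub_right, real_inner_smul_right, hwP, hwc, hwn]
        refine full_ext ?_ ?_
        · ext i
          simp
        · simp
      rw [this]
      exact hasDerivAt_const t w
    have h2 : (g m.T : Mat d) *ᵥ w = (g 0 : Mat d) *ᵥ w := funext (h1 m.T)
    rw [hg0] at h2 ⊢
    rw [Submonoid.coe_mul, SOn.coe_inv, Matrix.mulVec_mulVec, Matrix.mul_assoc,
      SOn.transpose_mul, Matrix.mul_one, h2]

/-! ### Rotations in a plane -/

/-- The rotation in the plane of the orthonormal vectors `v₁`, `v₂` by the argument of `z`, for a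
complex number `z` of modulus one. -/
def planeRot (v₁ v₂ : Fin (d + 1) → ℝ) (z : ℂ) : Mat d :=
  1 + (z.re - 1) • (Matrix.vecMulVec v₁ v₁ + Matrix.vecMulVec v₂ v₂) +
    z.im • (Matrix.vecMulVec v₂ v₁ - Matrix.vecMulVec v₁ v₂)

theorem planeRot_one (v₁ v₂ : Fin (d + 1) → ℝ) : planeRot v₁ v₂ 1 = 1 := by simp [planeRot]

theorem planeRot_mulVec (v₁ v₂ w : Fin (d + 1) → ℝ) (z : ℂ) :
    planeRot v₁ v₂ z *ᵥ w = w + ((z.re - 1) * (v₁ ⬝ᵥ w) - z.im * (v₂ ⬝ᵥ w)) • v₁ +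
      (z.im * (v₁ ⬝ᵥ w) + (z.re - 1) * (v₂ ⬝ᵥ w)) • v₂ := by
  simp only [planeRot, Matrix.add_mulVec, Matrix.sub_mulVec, Matrix.smul_mulVec,
    Matrix.vecMulVec_mulVec, Matrix.one_mulVec]
  ext i
  simp
  ring

theorem planeRot_mul {v₁ v₂ : Fin (d + 1) → ℝ} (h₁ : v₁ ⬝ᵥ v₁ = 1) (h₂ : v₂ ⬝ᵥ v₂ = 1)
    (h₁₂ : v₁ ⬝ᵥ v₂ = 0) (z w : ℂ) :
    planeRot v₁ v₂ z * planeRot v₁ v₂ w = planeRot v₁ v₂ (z * w) := by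
  have h₂₁ : v₂ ⬝ᵥ v₁ = 0 := by rw [dotProduct_comm, h₁₂]
  refine Matrix.ext_of_mulVec_single fun i => ?_
  rw [← Matrix.mulVec_mulVec, planeRot_mulVec, planeRot_mulVec, planeRot_mulVec]
  simp only [dotProduct_add, dotProduct_smul, h₁, h₂, h₁₂, h₂₁, Complex.mul_re, Complex.mul_im]
  ext j
  simp
  ring

theorem planeRot_transpose (v₁ v₂ : Fin (d + 1) → ℝ) (z : ℂ) :
    (planeRot v₁ v₂ z)ᵀ = planeRot v₁ v₂ (starRingEnd ℂ z) := by
  simp [planeRot, Matrix.transpose_vecMulVec, smul_sub]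
  abel

theorem planeRot_mem {v₁ v₂ : Fin (d + 1) → ℝ} (h₁ : v₁ ⬝ᵥ v₁ = 1) (h₂ : v₂ ⬝ᵥ v₂ = 1)
    (h₁₂ : v₁ ⬝ᵥ v₂ = 0) {z : ℂ} (hz : ‖z‖ = 1) :
    planeRot v₁ v₂ z ∈ Matrix.specialOrthogonalGroup (Fin (d + 1)) ℝ := by
  have horth : ∀ {z : ℂ}, ‖z‖ = 1 → planeRot v₁ v₂ z * (planeRot v₁ v₂ z)ᵀ = 1 := by
    intro z hz
    rw [planeRot_transpose, planeRot_mul h₁ h₂ h₁₂, Complex.mul_conj, Complex.normSq_eq_norm_sq,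
      hz, one_pow, Complex.ofReal_one, planeRot_one]
  refine Matrix.mem_specialOrthogonalGroup_iff.mpr
    ⟨(Matrix.mem_orthogonalGroup_iff _ _).mpr (horth hz), ?_⟩
  -- the determinant is a square, since `z` is one
  obtain ⟨w, hw⟩ := IsAlgClosed.exists_pow_nat_eq z (n := 2) two_pos
  have hw1 : ‖w‖ = 1 := by
    rw [← hw, norm_pow] at hz
    exact (pow_eq_one_iff_of_nonneg (norm_nonneg _) two_ne_zero).mp hz
  have := congrArg Matrix.det (horth hw1)
  rw [Matrix.det_mul, Matrix.det_transpose, Matrix.det_one] at this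
  rw [← hw, sq, ← planeRot_mul h₁ h₂ h₁₂, Matrix.det_mul, this]

theorem continuous_planeRot (v₁ v₂ : Fin (d + 1) → ℝ) : Continuous (planeRot v₁ v₂) := by
  unfold planeRot
  have := Complex.continuous_re
  have := Complex.continuous_im
  fun_prop

theorem planeRot_injective {v₁ v₂ : Fin (d + 1) → ℝ} (h₁ : v₁ ⬝ᵥ v₁ = 1) (h₂ : v₂ ⬝ᵥ v₂ = 1)
    (h₁₂ : v₁ ⬝ᵥ v₂ = 0) : Function.Injective (planeRot v₁ v₂) := by
  have h₂₁ : v₂ ⬝ᵥ v₁ = 0 := by rw [dotProduct_comm, h₁₂]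
  intro z w h
  have h1 := congrArg (fun A : Mat d => A *ᵥ v₁) h
  simp only [planeRot_mulVec, h₁, h₂₁] at h1
  have hre := congrArg (fun x => v₁ ⬝ᵥ x) h1
  have him := congrArg (fun x => v₂ ⬝ᵥ x) h1
  simp only [dotProduct_add, dotProduct_smul, h₁, h₂, h₁₂, h₂₁] at hre him
  refine Complex.ext ?_ ?_
  · simpa using hre
  · simpa using him

theorem inner_eq_dotProduct (x y : Full d) : inner ℝ x y = (x : Fin (d + 1) → ℝ) ⬝ᵥ y := by
  simp [PiLp.inner_apply, dotProduct, mul_comm]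

theorem SOn.mulVec_dotProduct_mulVec (M : SOn d) (x y : Fin (d + 1) → ℝ) :
    ((M : Mat d) *ᵥ x) ⬝ᵥ ((M : Mat d) *ᵥ y) = x ⬝ᵥ y := by
  rw [Matrix.dotProduct_mulVec, ← Matrix.mulVec_transpose, Matrix.mulVec_mulVec,
    SOn.transpose_mul, Matrix.one_mulVec]

/-- Two matrices agree if they agree on a basis of a subspace and on its orthogonal complement. -/
theorem matrix_eq_of_agree {M N : Mat d} {S : Submodule ℝ (Full d)} {k : ℕ}
    (b : OrthonormalBasis (Fin k) ℝ S)
    (h₁ : ∀ i, M *ᵥ (b i : Full d) = N *ᵥ (b i : Full d))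
    (h₂ : ∀ w ∈ Sᗮ, M *ᵥ (w : Full d) = N *ᵥ w) : M = N := by
  have hS : ∀ s ∈ S, M *ᵥ (s : Full d) = N *ᵥ s := by
    intro s hs
    have := congrArg Subtype.val (b.sum_repr' ⟨s, hs⟩)
    simp only [Submodule.coe_sum, Submodule.coe_smul] at this
    rw [← this]
    simp only [WithLp.ofLp_sum, WithLp.ofLp_smul, Matrix.mulVec_sum, Matrix.mulVec_smul, h₁]
  refine Matrix.ext_of_mulVec_single fun i => ?_
  obtain ⟨y, hy, w, hw, h⟩ := S.exists_add_mem_mem_orthogonal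
    (WithLp.toLp 2 (Pi.single i 1) : Full d)
  have h3 : (Pi.single i 1 : Fin (d + 1) → ℝ) =
      (y : Fin (d + 1) → ℝ) + (w : Fin (d + 1) → ℝ) := by
    have := congrArg WithLp.ofLp h
    simpa using this
  rw [h3, Matrix.mulVec_add, Matrix.mulVec_add, hS y hy, h₂ w hw]

/-- A matrix that reflects a vector and fixes its orthogonal complement is not in `SO(n)`. -/
theorem SOn.not_reflection (M : SOn d) {u : Fin (d + 1) → ℝ} (hu : u ⬝ᵥ u = 1)
    (h : (M : Mat d) = 1 - (2 : ℝ) • Matrix.vecMulVec u u) : False := by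
  have h1 : (M : Mat d) = 1 + Matrix.vecMulVec ((-2 : ℝ) • u) u := by
    rw [h, Matrix.smul_vecMulVec, neg_smul, sub_eq_add_neg]
  have h2 := (Matrix.mem_specialOrthogonalGroup_iff.mp M.2).2
  rw [h1, Matrix.vecMulVec_eq Unit, Matrix.det_one_add_replicateCol_mul_replicateRow] at h2
  simp [dotProduct_smul, hu] at h2

/-- An element of `SO(n)` that fixes a subspace of codimension two is a rotation in a plane. -/
theorem SOn.eq_one_or_planeRot (M : SOn d) {S : Submodule ℝ (Full d)}
    (hS : Module.finrank ℝ S ≤ 2) (hfix : ∀ w ∈ Sᗮ, (M : Mat d) *ᵥ (w : Full d) = w) :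
    M = 1 ∨ ∃ v₁ ∈ S, ∃ v₂ ∈ S, ∃ z : ℂ, (v₁ : Fin (d + 1) → ℝ) ⬝ᵥ v₁ = 1 ∧
      (v₂ : Fin (d + 1) → ℝ) ⬝ᵥ v₂ = 1 ∧ (v₁ : Fin (d + 1) → ℝ) ⬝ᵥ v₂ = 0 ∧ ‖z‖ = 1 ∧
      (M : Mat d) = planeRot v₁ v₂ z := by
  have hmaps : ∀ s ∈ S, WithLp.toLp 2 ((M : Mat d) *ᵥ (s : Full d)) ∈ S := by
    intro s hs
    rw [← S.orthogonal_orthogonal]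
    refine (Submodule.mem_orthogonal _ _).mpr fun w hw => ?_
    rw [inner_eq_dotProduct]
    have : (w : Fin (d + 1) → ℝ) ⬝ᵥ ((M : Mat d) *ᵥ (s : Full d)) =
        ((M : Mat d) *ᵥ (w : Full d)) ⬝ᵥ ((M : Mat d) *ᵥ (s : Full d)) := by rw [hfix w hw]
    rw [this, SOn.mulVec_dotProduct_mulVec, ← inner_eq_dotProduct]
    exact Submodule.inner_left_of_mem_orthogonal hs hw
  have hperp : ∀ v ∈ S, ∀ w ∈ Sᗮ, (v : Fin (d + 1) → ℝ) ⬝ᵥ w = 0 := by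
    intro v hv w hw
    rw [← inner_eq_dotProduct]
    exact Submodule.inner_right_of_mem_orthogonal hv hw
  obtain ⟨k, hk⟩ : ∃ k, k = Module.finrank ℝ S := ⟨_, rfl⟩
  have b : OrthonormalBasis (Fin k) ℝ S := (stdOrthonormalBasis ℝ S).reindex (finCongr hk.symm)
  have hb : ∀ i j, ((b i : Full d) : Fin (d + 1) → ℝ) ⬝ᵥ (b j : Full d) =
      if i = j then 1 else 0 := by
    intro i j
    rw [← inner_eq_dotProduct, ← Submodule.coe_inner]
    exact orthonormal_iff_ite.mp b.orthonormal i j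
  have hcoord : ∀ i, (M : Mat d) *ᵥ (b i : Full d) =
      ∑ j, (((b j : Full d) : Fin (d + 1) → ℝ) ⬝ᵥ ((M : Mat d) *ᵥ (b i : Full d))) •
        ((b j : Full d) : Fin (d + 1) → ℝ) := by
    intro i
    have h1 := congrArg Subtype.val (b.sum_repr' ⟨_, hmaps _ (b i).2⟩)
    have h2 := congrArg WithLp.ofLp h1
    simp only [Submodule.coe_sum, Submodule.coe_smul, WithLp.ofLp_sum, WithLp.ofLp_smul,
      Submodule.coe_inner, inner_eq_dotProduct] at h2
    exact h2.symm
  rw [← hk] at hS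
  interval_cases k
  · left
    refine Subtype.ext (matrix_eq_of_agree b (fun i => i.elim0) fun w hw => ?_)
    simpa using hfix w hw
  · left
    set r := ((b 0 : Full d) : Fin (d + 1) → ℝ) ⬝ᵥ ((M : Mat d) *ᵥ (b 0 : Full d)) with hr
    have h1 : (M : Mat d) *ᵥ (b 0 : Full d) = r • ((b 0 : Full d) : Fin (d + 1) → ℝ) := by
      have := hcoord 0
      simpa using this
    have h2 : r * r = 1 := by
      have := SOn.mulVec_dotProduct_mulVec M (b 0 : Full d) (b 0 : Full d)
      rw [h1, hb] at this
      simpa [hb] using this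
    rcases mul_self_eq_one_iff.mp h2 with h | h
    · refine Subtype.ext (matrix_eq_of_agree b (fun i => ?_) fun w hw => ?_)
      · rw [Subsingleton.elim i 0, h1, h]
        simp
      · simpa using hfix w hw
    · refine (SOn.not_reflection M (u := (b 0 : Full d)) (by rw [hb]; simp)
        (matrix_eq_of_agree b (fun i => ?_) fun w hw => ?_)).elim
      · rw [Subsingleton.elim i 0, h1, h, Matrix.sub_mulVec, Matrix.smul_mulVec,
          Matrix.vecMulVec_mulVec, hb]
        ext j
        simp
        try ring
      · rw [hfix w hw, Matrix.sub_mulVec, Matrix.smul_mulVec, Matrix.vecMulVec_mulVec,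
          hperp _ (b 0).2 w hw]
        simp
  · have h11 := hb 0 0
    have h22 := hb 1 1
    have h12 := hb 0 1
    have h21 := hb 1 0
    have hc0 := hcoord 0
    have hc1 := hcoord 1
    have hv1 := (b 0).2
    have hv2 := (b 1).2
    have hm11 := SOn.mulVec_dotProduct_mulVec M (b 0 : Full d) (b 0 : Full d)
    have hm12 := SOn.mulVec_dotProduct_mulVec M (b 0 : Full d) (b 1 : Full d)
    have hm22 := SOn.mulVec_dotProduct_mulVec M (b 1 : Full d) (b 1 : Full d)
    have hext : ∀ N : Mat d, (M : Mat d) *ᵥ (b 0 : Full d) = N *ᵥ (b 0 : Full d) →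
        (M : Mat d) *ᵥ (b 1 : Full d) = N *ᵥ (b 1 : Full d) →
        (∀ w ∈ Sᗮ, (w : Fin (d + 1) → ℝ) = N *ᵥ w) → (M : Mat d) = N := by
      intro N h1 h2 h3
      refine matrix_eq_of_agree b (fun i => ?_) fun w hw => (hfix w hw).trans (h3 w hw)
      fin_cases i
      · exact h1
      · exact h2
    rw [Fin.sum_univ_two] at hc0 hc1
    generalize (b 0 : Full d) = v₁ at *
    generalize (b 1 : Full d) = v₂ at *
    simp only [if_true, if_false, zero_ne_one, one_ne_zero] at h11 h22 h12 h21
    set x := (v₁ : Fin (d + 1) → ℝ) ⬝ᵥ ((M : Mat d) *ᵥ v₁)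
    set y := (v₂ : Fin (d + 1) → ℝ) ⬝ᵥ ((M : Mat d) *ᵥ v₁)
    set x' := (v₁ : Fin (d + 1) → ℝ) ⬝ᵥ ((M : Mat d) *ᵥ v₂)
    set y' := (v₂ : Fin (d + 1) → ℝ) ⬝ᵥ ((M : Mat d) *ᵥ v₂)
    rw [hc0, h11] at hm11
    rw [hc0, hc1, h12] at hm12
    rw [hc1, h22] at hm22
    simp only [dotProduct_add, add_dotProduct, smul_dotProduct, dotProduct_smul, h11, h22, h12,
      h21, smul_eq_mul] at hm11 hm12 hm22
    have hxy : x ^ 2 + y ^ 2 = 1 := by linarith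
    have hxy' : x' ^ 2 + y' ^ 2 = 1 := by linarith
    have horth : x * x' + y * y' = 0 := by linarith
    have hdet : (x * y' - y * x') ^ 2 = 1 := by
      linear_combination (x' ^ 2 + y' ^ 2) * hxy + hxy' - (x * x' + y * y') * horth
    rcases mul_self_eq_one_iff.mp ((sq _).symm.trans hdet) with h | h
    · right
      have hx' : x' = -y := by
        linear_combination x' * (-hxy) + x * horth - y * h
      have hy' : y' = x := by
        linear_combination y' * (-hxy) + y * horth + x * h
      refine ⟨v₁, hv1, v₂, hv2, ⟨x, y⟩, h11, h22, h12, ?_, hext _ ?_ ?_ fun w hw => ?_⟩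
      · rw [Complex.norm_def, Complex.normSq_mk, Real.sqrt_eq_one]
        linarith
      · rw [planeRot_mulVec, hc0, h11, h21]
        ext j
        simp
        ring
      · rw [planeRot_mulVec, hc1, h12, h22, hx', hy']
        ext j
        simp
        ring
      · rw [planeRot_mulVec, hperp _ hv1 w hw, hperp _ hv2 w hw]
        simp
    · exfalso
      have hx' : x' = y := by
        linear_combination x' * (-hxy) + x * horth - y * h
      have hy' : y' = -x := by
        linear_combination y' * (-hxy) + y * horth + x * h
      -- `x = cos ψ`, `y = sin ψ`: the reflected vector is `sin (ψ/2) v₁ - cos (ψ/2) v₂`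
      obtain ⟨ψ, hcos, hsin⟩ := exists_cos_sin hxy
      have hψ : ψ = 2 * (ψ / 2) := by ring
      rw [hψ, Real.cos_two_mul] at hcos
      rw [hψ, Real.sin_two_mul] at hsin
      have hone := Real.sin_sq_add_cos_sq (ψ / 2)
      set s := Real.sin (ψ / 2)
      set c := Real.cos (ψ / 2)
      refine SOn.not_reflection M (u := s • (v₁ : Fin (d + 1) → ℝ) - c • (v₂ : Fin (d + 1) → ℝ)) ?_
        (hext _ ?_ ?_ fun w hw => ?_)
      · simp only [dotProduct_sub, sub_dotProduct, smul_dotProduct, dotProduct_smul, h11, h22, h12,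
          h21, smul_eq_mul]
        linarith
      · rw [hc0, Matrix.sub_mulVec, Matrix.smul_mulVec, Matrix.vecMulVec_mulVec]
        simp only [sub_dotProduct, smul_dotProduct, h11, h21, smul_eq_mul]
        ext j
        simp
        linear_combination (-(v₁ j)) * hcos - (v₂ j) * hsin + (2 * v₁ j) * hone
      · rw [hc1, Matrix.sub_mulVec, Matrix.smul_mulVec, Matrix.vecMulVec_mulVec, hx', hy']
        simp only [sub_dotProduct, smul_dotProduct, h22, h12, smul_eq_mul]
        ext j
        simp
        linear_combination (v₂ j) * hcos - (v₁ j) * hsin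
      · rw [Matrix.sub_mulVec, Matrix.smul_mulVec, Matrix.vecMulVec_mulVec]
        simp only [sub_dotProduct, smul_dotProduct, hperp _ hv1 w hw, hperp _ hv2 w hw]
        simp

/-! ### Conditionally periodic trajectories -/

theorem continuous_periodicLift {X : Type*} [TopologicalSpace X] {f : ℝ → X} (hf : Continuous f)
    (hp : Function.Periodic f 1) : Continuous (hp.lift : UnitAddCircle → X) :=
  continuous_coinduced_dom.mpr hf

theorem unitAddCircle_coe_eq_iff {x y : ℝ} :
    (x : UnitAddCircle) = y ↔ ∃ k : ℤ, x = y + k := by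
  rw [QuotientAddGroup.eq_iff_sub_mem, AddSubgroup.mem_zmultiples_iff]
  constructor
  · rintro ⟨k, hk⟩
    exact ⟨k, by simp at hk; linarith⟩
  · rintro ⟨k, hk⟩
    exact ⟨k, by simp; linarith⟩

/-- Suppose that a curve in `D` is multiplied by `M` after each period of its projection to another
space. -/
structure IsRelativelyPeriodic {X : Type*} (γ : ℝ → DPhase d) (r : DPhase d → X) (T : ℝ)
    (M : SOn d) : Prop where
  continuous : Continuous γ
  pos : 0 < T
  shift : ∀ t, γ (t + T) = (M * (γ t).1, (γ t).2)
  injective_mod : ∀ s t, r (γ s) = r (γ t) → ∃ k : ℤ, s = t + k * T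

namespace IsRelativelyPeriodic

variable {X : Type*} {γ : ℝ → DPhase d} {r : DPhase d → X} {T : ℝ} {M : SOn d}

theorem shift_int (h : IsRelativelyPeriodic γ r T M) (k : ℤ) (t : ℝ) :
    γ (t + k * T) = (M ^ k * (γ t).1, (γ t).2) := by
  induction k using Int.induction_on generalizing t with
  | zero => simp
  | succ n ih =>
    rw [show t + ((n + 1 : ℤ) : ℝ) * T = (t + (n : ℤ) * T) + T by push_cast; ring, h.shift, ih,
      add_comm (n : ℤ) 1, zpow_add, zpow_one, mul_assoc]
  | pred n ih =>
    have h1 := h.shift (t + ((-n - 1 : ℤ) : ℝ) * T)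
    rw [show t + ((-n - 1 : ℤ) : ℝ) * T + T = t + (-n : ℤ) * T by push_cast; ring, ih] at h1
    obtain ⟨h2, h3⟩ := Prod.ext_iff.mp h1
    simp only at h2 h3
    refine Prod.ext ?_ h3.symm
    rw [sub_eq_neg_add, zpow_add, zpow_neg_one, mul_assoc, h2]
    group

/-- If `M` has finite order, the curve is closed. -/
theorem conditionallyPeriodic_one (h : IsRelativelyPeriodic γ r T M) (hM : IsOfFinOrder M) :
    IsConditionallyPeriodic 1 γ := by
  have hn : (0 : ℝ) < orderOf M := by exact_mod_cast hM.orderOf_pos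
  set N : ℝ := orderOf M * T with hN
  have hN0 : 0 < N := mul_pos hn h.pos
  have hper : Function.Periodic (fun x => γ (N * x)) 1 := by
    intro x
    have := h.shift_int (orderOf M) (N * x)
    rw [zpow_natCast, pow_orderOf_eq_one, one_mul] at this
    simp only
    rw [mul_add, mul_one, hN]
    rw [hN, Int.cast_natCast] at this
    exact this
  refine ⟨fun y => hper.lift (y 0), fun _ => N⁻¹,
    (continuous_periodicLift (h.continuous.comp (continuous_const.mul continuous_id)) hper).comp
      (continuous_apply 0), ?_, ?_, fun t => ?_⟩
  · intro y y' hy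
    obtain ⟨x, hx⟩ := QuotientAddGroup.mk_surjective (y 0)
    obtain ⟨x', hx'⟩ := QuotientAddGroup.mk_surjective (y' 0)
    have hval : γ (N * x) = γ (N * x') := by
      simp only [← hx, ← hx'] at hy
      exact hy
    obtain ⟨k, hk⟩ := h.injective_mod _ _ (congrArg r hval)
    rw [hk, h.shift_int] at hval
    have hMk : M ^ k = 1 := by
      have := congrArg Prod.fst hval
      simpa using this
    obtain ⟨j, hj⟩ := orderOf_dvd_iff_zpow_eq_one.mpr hMk
    have hxx : x = x' + j := by
      rw [hj] at hk
      push_cast at hk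
      have : N * x = N * (x' + j) := by rw [hk, hN]; ring
      exact mul_left_cancel₀ hN0.ne' this
    have h0 : y 0 = y' 0 := by
      rw [← hx, ← hx']
      exact unitAddCircle_coe_eq_iff.mpr ⟨j, hxx⟩
    funext i
    rw [Subsingleton.elim i 0, h0]
  · refine linearIndependent_unique_iff.mpr (inv_pos.mpr hN0).ne'
  · change γ t = γ (N * (N⁻¹ * t))
    rw [mul_inv_cancel_left₀ hN0.ne']

/-- If `M` generates a dense subgroup of a circle group, the curve winds densely around a torus. -/
theorem conditionallyPeriodic_two (h : IsRelativelyPeriodic γ r T M) {H : UnitAddCircle → SOn d}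
    (hHc : Continuous H) (hHi : Function.Injective H) (hHa : ∀ x y, H (x + y) = H x * H y)
    (hr : ∀ x z, r (H x * z.1, z.2) = r z) {α : ℝ} (hα : Irrational α) (hM : M = H α) :
    IsConditionallyPeriodic 2 γ := by
  have hT := h.pos
  set f : ℝ → DPhase d := fun s =>
    (H ((-(α * s) : ℝ) : UnitAddCircle) * (γ (T * s)).1, (γ (T * s)).2) with hf
  have hfc : Continuous f := by
    have h1 : Continuous fun s : ℝ => γ (T * s) :=
      h.continuous.comp (continuous_const.mul continuous_id)
    have h2 : Continuous fun s : ℝ => H ((-(α * s) : ℝ) : UnitAddCircle) :=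
      hHc.comp (continuous_quotient_mk'.comp (by fun_prop))
    exact (h2.mul (continuous_fst.comp h1)).prodMk (continuous_snd.comp h1)
  have hfp : Function.Periodic f 1 := by
    intro s
    simp only [hf, mul_add, mul_one, h.shift, hM]
    refine Prod.ext ?_ rfl
    simp only [← mul_assoc, ← hHa]
    congr 2
    rw [← AddCircle.coe_add]
    congr 1
    ring
  have hrf : ∀ s, r (f s) = r (γ (T * s)) := fun s => hr _ _
  refine ⟨fun y => (H (y 0) * (hfp.lift (y 1)).1, (hfp.lift (y 1)).2), ![α / T, T⁻¹], ?_, ?_, ?_,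
    fun t => ?_⟩
  · have h1 : Continuous fun y : Fin 2 → UnitAddCircle => hfp.lift (y 1) :=
      (continuous_periodicLift hfc hfp).comp (continuous_apply 1)
    exact ((hHc.comp (continuous_apply 0)).mul (continuous_fst.comp h1)).prodMk
      (continuous_snd.comp h1)
  · intro y y' hy
    have hr1 := congrArg r hy
    simp only [hr] at hr1
    obtain ⟨x, hx⟩ := QuotientAddGroup.mk_surjective (y 1)
    obtain ⟨x', hx'⟩ := QuotientAddGroup.mk_surjective (y' 1)
    have h1 : y 1 = y' 1 := by
      rw [← hx, ← hx'] at hr1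
      have hr2 : r (f x) = r (f x') := hr1
      rw [hrf, hrf] at hr2
      obtain ⟨k, hk⟩ := h.injective_mod _ _ hr2
      rw [← hx, ← hx']
      refine unitAddCircle_coe_eq_iff.mpr ⟨k, ?_⟩
      have : T * x = T * (x' + k) := by rw [hk]; ring
      exact mul_left_cancel₀ hT.ne' this
    have h0 : y 0 = y' 0 := by
      have := congrArg Prod.fst hy
      simp only [h1] at this
      exact hHi (mul_right_cancel this)
    funext i
    fin_cases i
    · exact h0
    · exact h1
  · refine LinearIndependent.pair_iff.mpr fun a b hab => ?_
    have h1 : (a : ℝ) * α + b = 0 := by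
      have : a • (α / T) + b • T⁻¹ = 0 := hab
      rw [Rat.smul_def, Rat.smul_def] at this
      field_simp at this
      linarith
    have ha : a = 0 := by
      by_contra ha
      refine hα ⟨-b / a, ?_⟩
      have ha' : (a : ℝ) ≠ 0 := by exact_mod_cast ha
      push_cast
      field_simp
      linarith
    refine ⟨ha, ?_⟩
    rw [ha] at h1
    simpa using h1
  · change γ t = (H ((α / T * t : ℝ) : UnitAddCircle) * (f (T⁻¹ * t)).1, (f (T⁻¹ * t)).2)
    simp only [hf, mul_inv_cancel_left₀ hT.ne', ← mul_assoc, ← hHa, ← AddCircle.coe_add]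
    have h1 : α / T * t + -(α * T⁻¹ * t) = 0 := by ring
    have h2 : H 0 = 1 := by
      have := hHa 0 0
      rw [add_zero] at this
      exact left_eq_mul.mp this
    rw [h1, AddCircle.coe_zero, h2, one_mul]

end IsRelativelyPeriodic

/-- The circle of rotations in the plane of two orthonormal vectors. -/
def circleRot {v₁ v₂ : Fin (d + 1) → ℝ} (h₁ : v₁ ⬝ᵥ v₁ = 1) (h₂ : v₂ ⬝ᵥ v₂ = 1)
    (h₁₂ : v₁ ⬝ᵥ v₂ = 0) (x : UnitAddCircle) : SOn d :=
  ⟨planeRot v₁ v₂ (AddCircle.toCircle x), planeRot_mem h₁ h₂ h₁₂ (Circle.norm_coe _)⟩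

section circleRot

variable {v₁ v₂ : Fin (d + 1) → ℝ} (h₁ : v₁ ⬝ᵥ v₁ = 1) (h₂ : v₂ ⬝ᵥ v₂ = 1) (h₁₂ : v₁ ⬝ᵥ v₂ = 0)

theorem continuous_circleRot : Continuous (circleRot h₁ h₂ h₁₂) :=
  ((continuous_planeRot v₁ v₂).comp
    (continuous_subtype_val.comp AddCircle.continuous_toCircle)).subtype_mk _

theorem circleRot_injective : Function.Injective (circleRot h₁ h₂ h₁₂) := fun _ _ h =>
  AddCircle.injective_toCircle one_ne_zero
    (Subtype.ext (planeRot_injective h₁ h₂ h₁₂ (congrArg Subtype.val h)))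

theorem circleRot_add (x y : UnitAddCircle) :
    circleRot h₁ h₂ h₁₂ (x + y) = circleRot h₁ h₂ h₁₂ x * circleRot h₁ h₂ h₁₂ y := by
  refine Subtype.ext ?_
  simp only [circleRot, AddCircle.toCircle_add, Circle.coe_mul, Submonoid.coe_mul]
  rw [planeRot_mul h₁ h₂ h₁₂]

theorem exists_circleRot_eq {z : ℂ} (hz : ‖z‖ = 1) {M : SOn d}
    (hM : (M : Mat d) = planeRot v₁ v₂ z) : ∃ α : ℝ, M = circleRot h₁ h₂ h₁₂ α := by
  obtain ⟨x, hx⟩ := (AddCircle.homeomorphCircle (T := 1) one_ne_zero).surjective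
    ⟨z, mem_sphere_zero_iff_norm.mpr hz⟩
  obtain ⟨α, rfl⟩ := QuotientAddGroup.mk_surjective x
  refine ⟨α, Subtype.ext ?_⟩
  rw [hM]
  simp only [circleRot]
  congr 1
  rw [AddCircle.homeomorphCircle_apply] at hx
  exact (congrArg Subtype.val hx).symm

theorem isOfFinOrder_circleRot {α : ℝ} (hα : ¬ Irrational α) :
    IsOfFinOrder (circleRot h₁ h₂ h₁₂ α) := by
  obtain ⟨a, rfl⟩ := not_not.mp hα
  have h0 : circleRot h₁ h₂ h₁₂ 0 = 1 := by
    have := circleRot_add h₁ h₂ h₁₂ 0 0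
    rw [add_zero] at this
    exact left_eq_mul.mp this
  have hpow : ∀ (n : ℕ) (x : UnitAddCircle),
      circleRot h₁ h₂ h₁₂ x ^ n = circleRot h₁ h₂ h₁₂ (n • x) := by
    intro n x
    induction n with
    | zero => simp [h0]
    | succ n ih => rw [pow_succ, ih, succ_nsmul, circleRot_add]
  refine isOfFinOrder_iff_pow_eq_one.mpr ⟨a.den, a.den_pos, ?_⟩
  rw [hpow, ← h0, ← AddCircle.coe_nsmul]
  congr 1
  refine unitAddCircle_coe_eq_iff.mpr ⟨a.num, ?_⟩
  rw [nsmul_eq_mul, zero_add, mul_comm]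
  exact_mod_cast Rat.mul_den_eq_num a

/-- Rotations in a plane orthogonal to `Eₙ` act on `D` along the fibres of the reduction. -/
theorem reduce_circleRot_mul (I : InertiaOperator d) (hv₁ : v₁ (Fin.last d) = 0)
    (hv₂ : v₂ (Fin.last d) = 0) (x : UnitAddCircle) (z : DPhase d) :
    DPhase.reduce I (circleRot h₁ h₂ h₁₂ x * z.1, z.2) = z.reduce I := by
  refine Prod.ext (Subtype.ext ?_) rfl
  ext j
  change ((circleRot h₁ h₂ h₁₂ x : Mat d) * (z.1 : Mat d)) (Fin.last d) j =
    (z.1 : Mat d) (Fin.last d) j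
  rw [Matrix.mul_apply, Finset.sum_eq_single (Fin.last d)]
  · simp [circleRot, planeRot, Matrix.vecMulVec_apply, hv₁, hv₂]
  · intro k _ hk
    simp [circleRot, planeRot, Matrix.vecMulVec_apply, hv₁, hv₂, hk.symm]
  · simp

end circleRot

theorem InertiaOperator.opA_reduce (I : InertiaOperator d) (z : DPhase d) :
    I.opA (z.reduce I).2 = -z.2 := by
  change I.opA (WithLp.toLp 2 (-(I.J *ᵥ z.2))) = -z.2
  rw [WithLp.toLp_neg, map_neg, ← I.opA_symm_apply, LinearEquiv.apply_symm_apply]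

theorem isRelativelyPeriodic_lift (I : InertiaOperator d) (C : Fin d → ℝ) {q p : Flat d}
    (m : PeriodicMotion q (I.opA p) (I.halfDrift C)) (hP : I.opA p ≠ 0) {γ : ℝ → DPhase d}
    {M : SOn d} (hc : Continuous γ) (hred : ∀ t, (γ t).reduce I = m.reducedCurve p C t)
    (hshift : ∀ t, γ (t + m.T) = (M * (γ t).1, (γ t).2)) :
    IsRelativelyPeriodic γ (DPhase.reduce I) m.T M where
  continuous := hc
  pos := m.T_pos
  shift := hshift
  injective_mod s t h := by
    rw [hred, hred] at h
    exact m.reducedCurve_injective_mod I C hP h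

/-- An element of `SO(n)` that does not change the last row of some `g` fixes `Eₙ`. -/
theorem SOn.mulVec_last_of_row {M g : SOn d}
    (h : row ((M * g : SOn d) : Mat d) (Fin.last d) = row (g : Mat d) (Fin.last d)) :
    (M : Mat d) *ᵥ (Pi.single (Fin.last d) 1) = Pi.single (Fin.last d) 1 := by
  have h1 : (M : Mat d) = ((M * g : SOn d) : Mat d) * (g : Mat d)ᵀ := by
    rw [Submonoid.coe_mul, Matrix.mul_assoc, SOn.mul_transpose, Matrix.mul_one]
  have h2 : (M : Mat d)ᵀ *ᵥ (Pi.single (Fin.last d) 1) = Pi.single (Fin.last d) 1 := by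
    ext j
    rw [Matrix.mulVec_single_one, Matrix.col_apply, Matrix.transpose_apply, h1,
      mul_transpose_apply, h, ← mul_transpose_apply, SOn.mul_transpose, Matrix.one_apply,
      Pi.single_apply]
    simp only [eq_comm]
  nth_rewrite 1 [← h2]
  rw [Matrix.mulVec_mulVec, SOn.mul_transpose, Matrix.one_mulVec]

/-- The rotation `M` that a trajectory in `D` undergoes in a period fixes a subspace of codimension
two: the complement of the image of the three-dimensional span of `P`, `c`, `Eₙ`, in which the
motion takes place, and the vector `Eₙ`, which is fixed in the space. -/
theorem exists_fixed_codim_two {M g : SOn d} {P c : Flat d}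
    (hfix : ∀ w : Full d, inner ℝ (trunc w) P = (0 : ℝ) → inner ℝ (trunc w) c = (0 : ℝ) →
      w (Fin.last d) = 0 → (M : Mat d) *ᵥ ((g : Mat d) *ᵥ w) = (g : Mat d) *ᵥ w)
    (hlast : (M : Mat d) *ᵥ (Pi.single (Fin.last d) 1) = Pi.single (Fin.last d) 1)
    (hne : row (g : Mat d) (Fin.last d) (Fin.last d) ≠ 0 ∨
      inner ℝ (trunc (row (g : Mat d) (Fin.last d))) P ≠ (0 : ℝ)) :
    ∃ S : Submodule ℝ (Full d), Module.finrank ℝ S ≤ 2 ∧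
      (∀ w ∈ Sᗮ, (M : Mat d) *ᵥ (w : Full d) = w) ∧ ∀ v ∈ S, v (Fin.last d) = 0 := by
  set F : Submodule ℝ (Full d) :=
    { carrier := {w | (M : Mat d) *ᵥ (w : Full d) = w}
      add_mem' := fun {a b} ha hb => by
        simp only [mem_ofPred_eq] at ha hb ⊢
        rw [WithLp.ofLp_add, Matrix.mulVec_add, ha, hb]
      zero_mem' := by simp
      smul_mem' := fun r a ha => by
        simp only [mem_ofPred_eq] at ha ⊢
        rw [WithLp.ofLp_smul, Matrix.mulVec_smul, ha] } with hF
  have hmemF : ∀ w : Full d, w ∈ F ↔ (M : Mat d) *ᵥ (w : Full d) = w := fun w => Iff.rfl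
  set e : Full d := EuclideanSpace.single (Fin.last d) 1 with he
  have heF : e ∈ F := by
    rw [hmemF]
    exact hlast
  have hperp : ∀ v ∈ Fᗮ, v (Fin.last d) = 0 := by
    intro v hv
    have := Submodule.inner_right_of_mem_orthogonal heF hv
    simpa [he, EuclideanSpace.inner_single_left] using this
  set b : Fin 3 → Full d := ![WithLp.toLp 2 ((g : Mat d) *ᵥ (mkFull P 0 : Full d)),
    WithLp.toLp 2 ((g : Mat d) *ᵥ (mkFull c 0 : Full d)),
    WithLp.toLp 2 ((g : Mat d) *ᵥ (e : Full d))] with hb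
  set W : Submodule ℝ (Full d) := Submodule.span ℝ (range b) with hW
  have hW3 : Module.finrank ℝ W ≤ 3 := by
    have := finrank_range_le_card (R := ℝ) b
    rwa [Fintype.card_fin] at this
  have hinner : ∀ x w : Full d, inner ℝ (WithLp.toLp 2 ((g : Mat d) *ᵥ (x : Full d)) : Full d) w =
      inner ℝ x (WithLp.toLp 2 ((g : Mat d)ᵀ *ᵥ (w : Full d))) := by
    intro x w
    rw [inner_eq_dotProduct, inner_eq_dotProduct, dotProduct_comm, Matrix.dotProduct_mulVec,
      ← Matrix.mulVec_transpose, dotProduct_comm]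
  have hWF : Wᗮ ≤ F := by
    intro w hw
    have hbW : ∀ i, b i ∈ W := fun i => Submodule.subset_span (mem_range_self i)
    have hbw : ∀ i, inner ℝ (b i) w = (0 : ℝ) := fun i =>
      Submodule.inner_right_of_mem_orthogonal (hbW i) hw
    set w' : Full d := WithLp.toLp 2 ((g : Mat d)ᵀ *ᵥ (w : Full d)) with hw'
    have hgw : (g : Mat d) *ᵥ (w' : Full d) = w := by
      rw [hw', Matrix.mulVec_mulVec, SOn.mul_transpose, Matrix.one_mulVec]
    have h0 := hbw 0
    have h1 := hbw 1
    have h2 := hbw 2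
    simp only [hb, Matrix.cons_val_zero, Matrix.cons_val_one, Matrix.cons_val, hinner] at h0 h1 h2
    rw [← hw', inner_full] at h0 h1 h2
    simp only [trunc_mkFull, mkFull_last, zero_mul, add_zero] at h0 h1
    have h3 : w' (Fin.last d) = 0 := by
      rw [← inner_full, he, EuclideanSpace.inner_single_left] at h2
      simpa using h2
    rw [hmemF]
    have := hfix w' (by rw [real_inner_comm]; exact h0) (by rw [real_inner_comm]; exact h1) h3
    rwa [hgw] at this
  have hSW : Fᗮ ≤ W := by
    have := Submodule.orthogonal_le hWF
    rwa [Submodule.orthogonal_orthogonal] at this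
  have hlt : Fᗮ < W := by
    refine lt_of_le_of_ne hSW fun h => ?_
    have hb0 : ∀ i, b i (Fin.last d) = 0 := fun i =>
      hperp _ (by rw [h]; exact Submodule.subset_span ⟨i, rfl⟩)
    rcases hne with h1 | h1
    · apply h1
      have := hb0 2
      simpa [hb, he] using this
    · apply h1
      have h2 : b 0 (Fin.last d) = inner ℝ (row (g : Mat d) (Fin.last d)) (mkFull P 0) := by
        rw [inner_row]
        rfl
      rw [hb0, inner_full] at h2
      simpa using h2.symm
  refine ⟨Fᗮ, ?_, fun w hw => ?_, hperp⟩
  · have := Submodule.finrank_lt_finrank_of_lt hlt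
    omega
  · rw [Submodule.orthogonal_orthogonal] at hw
    exact hw

/-- Over a periodic motion, the trajectory in `D` is either closed, after finitely many periods of
the motion, or a dense winding of a two-dimensional torus. -/
theorem isOfFinOrder_or_conditionallyPeriodic_two (I : InertiaOperator d) (C : Fin d → ℝ)
    {z : DPhase d} {q p P c : Flat d} (m : PeriodicMotion q P c) (hp : I.opA p = P)
    (hc : I.halfDrift C = c) (hP : P ≠ 0) {γ : ℝ → DPhase d} {M : SOn d} (hγ0 : γ 0 = z)
    (hγc : Continuous γ) (hγr : ∀ t, (γ t).reduce I = m.reducedCurve p C t)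
    (hγT : ∀ t, γ (t + m.T) = (M * (γ t).1, (γ t).2))
    (hfix : ∀ w : Full d, inner ℝ (trunc w) P = (0 : ℝ) → inner ℝ (trunc w) c = (0 : ℝ) →
      w (Fin.last d) = 0 → (M : Mat d) *ᵥ ((z.1 : Mat d) *ᵥ w) = (z.1 : Mat d) *ᵥ w)
    (hne : z.e (Fin.last d) ≠ 0 ∨ inner ℝ (trunc z.e) P ≠ (0 : ℝ)) :
    IsOfFinOrder M ∨ IsConditionallyPeriodic 2 γ := by
  subst hp hc
  have hper := isRelativelyPeriodic_lift I C m hP hγc hγr hγT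
  have hlast : (M : Mat d) *ᵥ (Pi.single (Fin.last d) 1) = Pi.single (Fin.last d) 1 := by
    refine SOn.mulVec_last_of_row (g := z.1) ?_
    have h1 := hγr (0 + m.T)
    rw [m.periodic_reducedCurve, ← hγr, hγT, hγ0] at h1
    exact congrArg Subtype.val (congrArg Prod.fst h1)
  obtain ⟨S, hS2, hSfix, hSlast⟩ := exists_fixed_codim_two hfix hlast hne
  rcases SOn.eq_one_or_planeRot M hS2 hSfix with h1 | ⟨v₁, hv₁, v₂, hv₂, w, h11, h22, h12, hw, hMw⟩
  · exact Or.inl (h1 ▸ IsOfFinOrder.one)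
  · obtain ⟨α, hα⟩ := exists_circleRot_eq h11 h22 h12 hw hMw
    by_cases hirr : Irrational α
    · exact Or.inr (hper.conditionallyPeriodic_two (continuous_circleRot h11 h22 h12)
        (circleRot_injective h11 h22 h12) (circleRot_add h11 h22 h12)
        (reduce_circleRot_mul h11 h22 h12 I (hSlast _ hv₁) (hSlast _ hv₂)) hirr hα)
    · exact Or.inl (hα ▸ isOfFinOrder_circleRot h11 h22 h12 hirr)

theorem exists_conditionallyPeriodic_of_isTransverse (hd : 1 ≤ d) (I : InertiaOperator d)
    (C : Fin d → ℝ) (z : DPhase d) (hz : IsTransverse (trunc z.e) (-z.2) (I.halfDrift C)) :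
    ∃ γ : ℝ → DPhase d,
      IsSuslovSolution I (kharlamovaPotential C) γ ∧ γ 0 = z ∧
      IsReducedSolution I (kharlamovaPotential C) (fun t => (γ t).reduce I) ∧
      IsClosedTrajectory (fun t => (γ t).reduce I) ∧
      ∃ m : ℕ, m ≤ (d + 1) / d + 1 ∧ IsConditionallyPeriodic m γ := by
  rw [← I.opA_reduce z] at hz
  obtain ⟨m, hm⟩ := hz.exists_motion (norm_sq_trunc_add ⟨z.e, z.e_mem⟩)
  obtain ⟨γ, M, hγ0, hγc, hγs, hγr, hγT, -, hfix⟩ := exists_lift I C m rfl rfl rfl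
    (I.opA_reduce z) hm
  have hcurve : (fun t => (γ t).reduce I) = m.reducedCurve (z.reduce I).2 C := funext hγr
  have hper := isRelativelyPeriodic_lift I C m hz.1 hγc hγr hγT
  refine ⟨γ, hγs, hγ0, hcurve ▸ m.isReducedSolution I C, hcurve ▸ m.isClosedTrajectory I C hz.1, ?_⟩
  have hd2 : 1 ≤ (d + 1) / d := Nat.div_pos (by omega) (by omega)
  have hne : z.e (Fin.last d) ≠ 0 ∨
      inner ℝ (trunc z.e) (I.opA (z.reduce I).2) ≠ (0 : ℝ) := by
    by_cases h0 : z.e (Fin.last d) = 0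
    · right
      have h1 := norm_sq_trunc_add ⟨z.e, z.e_mem⟩
      simp only [h0] at h1
      have h2 : ‖trunc z.e‖ = 1 :=
        (pow_eq_one_iff_of_nonneg (norm_nonneg _) two_ne_zero).mp (by linarith)
      have h3 := hz.2 0
      simp only [parabola, zero_smul, add_zero, ne_eq, OfNat.ofNat_ne_zero, not_false_eq_true,
        zero_pow, sub_zero, mul_zero] at h3
      exact h3 h2
    · exact Or.inl h0
  rcases isOfFinOrder_or_conditionallyPeriodic_two I C m rfl rfl hz.1 hγ0 hγc hγr hγT hfix hne
    with h1 | h1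
  · exact ⟨1, by omega, hper.conditionallyPeriodic_one h1⟩
  · exact ⟨2, by omega, h1⟩

theorem ae_exists_conditionallyPeriodic (hd : 1 ≤ d) (I : InertiaOperator d) (C : Fin d → ℝ) :
    ∀ᵐ z ∂(DMeasure d), ∃ γ : ℝ → DPhase d,
      IsSuslovSolution I (kharlamovaPotential C) γ ∧ γ 0 = z ∧
      IsReducedSolution I (kharlamovaPotential C) (fun t => (γ t).reduce I) ∧
      IsClosedTrajectory (fun t => (γ t).reduce I) ∧
      ∃ m : ℕ, m ≤ (d + 1) / d + 1 ∧ IsConditionallyPeriodic m γ := by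
  have hmain : ∀ᵐ z ∂(DMeasure d), IsTransverse (trunc z.e) (-z.2) (I.halfDrift C) := by
    have he : Continuous fun g : SOn d => trunc (row (g : Mat d) (Fin.last d)) := by
      refine continuous_trunc.comp ((PiLp.continuous_toLp 2 _).comp ?_)
      exact (continuous_apply (Fin.last d)).comp continuous_subtype_val
    have hmeas : MeasurableSet {z : DPhase d |
        ¬ IsTransverse (trunc z.e) (-z.2) (I.halfDrift C)} := by
      refine MeasurableSet.compl ?_
      have hf : Measurable fun z : DPhase d =>
          (trunc (row (z.1 : Mat d) (Fin.last d)), -z.2) :=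
        (he.measurable.comp measurable_fst).prodMk measurable_snd.neg
      exact hf (measurableSet_isTransverse (I.halfDrift C))
    rw [ae_iff, DMeasure, Measure.measure_prod_null hmeas]
    refine Filter.Eventually.of_forall fun g => ?_
    have h := volume_not_isTransverse hd (norm_trunc_le_one ⟨_, DPhase.e_mem (g, (0 : Flat d))⟩)
      (I.halfDrift C)
    have h2 := Measure.measure_preimage_neg (volume : Measure (Flat d))
      {P | ¬ IsTransverse (trunc (DPhase.e (g, (0 : Flat d)))) P (I.halfDrift C)}
    rw [h] at h2
    exact h2
  filter_upwards [hmain] with z hz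
  exact exists_conditionallyPeriodic_of_isTransverse hd I C z hz

/-! ### A family of symmetric motions with varying rotation number -/

/-- The speed, with respect to the phase `θ` of the motion `τ = -b cos θ`, with which a vector fixed
in space rotates in the tangent plane of the sphere at `(q, qₙ)`, relative to the meridian, when `q`
moves along the symmetric parabola with parameters `s`, `k`. The factors of the denominator are
`|q|²` and the square root from `θ̇`. -/
def rotRate (s k θ : ℝ) : ℝ :=
  s * (k - (1 + Real.cos θ ^ 2) / 4) /
    ((s ^ 2 * Real.cos θ ^ 2 + ((1 - Real.cos θ ^ 2) / 4 - k) ^ 2) *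
      √(s ^ 2 + k / 2 - (1 - Real.cos θ ^ 2) / 16))

theorem rotRate_factors_pos {s k : ℝ} (hk : 3 / 4 ≤ k) (θ : ℝ) :
    0 < k - (1 + Real.cos θ ^ 2) / 4 ∧
      0 < s ^ 2 * Real.cos θ ^ 2 + ((1 - Real.cos θ ^ 2) / 4 - k) ^ 2 ∧
      0 < s ^ 2 + k / 2 - (1 - Real.cos θ ^ 2) / 16 := by
  have h1 := Real.cos_sq_le_one θ
  have h2 := sq_nonneg (Real.cos θ)
  refine ⟨by linarith, ?_, by nlinarith [sq_nonneg s]⟩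
  have h3 : (1 - Real.cos θ ^ 2) / 4 - k < 0 := by linarith
  have h4 := sq_pos_of_neg h3
  nlinarith [mul_nonneg (sq_nonneg s) h2]

theorem continuous_rotRate_comp {X : Type*} [TopologicalSpace X] {s k θ : X → ℝ}
    (hs : Continuous s) (hk : Continuous k) (hθ : Continuous θ) (hk' : ∀ x, 3 / 4 ≤ k x) :
    Continuous fun x => rotRate (s x) (k x) (θ x) := by
  unfold rotRate
  refine Continuous.div (by fun_prop) (by fun_prop) fun x => ?_
  obtain ⟨-, h2, h3⟩ := rotRate_factors_pos (s := s x) (hk' x) (θ x)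
  exact (mul_pos h2 (Real.sqrt_pos.mpr h3)).ne'

theorem parabola_symmetric (û ĉ : Flat d) (s k b τ : ℝ) :
    parabola ((1 / 4 - k) • ĉ) ((s / b) • û) ((1 / (4 * b ^ 2)) • ĉ) τ =
      (s * τ / b) • û + (1 / 4 - k - τ ^ 2 / (4 * b ^ 2)) • ĉ := by
  simp only [parabola, smul_smul]
  module

/-- The motion along the symmetric parabola `q = (s σ, (1 - σ²) / 4 - k)`, `σ = τ / b`, and the
angle `φ` by which a vector fixed in space has rotated. Here
`1 - |q|² = (1 - σ²) (s² + k / 2 - (1 - σ²) / 16)`, so the turning points are `σ = ±1`. -/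
theorem exists_symmetric_motion {û ĉ : Flat d} (hû : inner ℝ û û = (1 : ℝ))
    (hĉ : inner ℝ ĉ ĉ = (1 : ℝ)) (hûĉ : inner ℝ û ĉ = (0 : ℝ)) {s k b : ℝ} (hsk : s ^ 2 + k ^ 2 = 1)
    (hk : 3 / 4 ≤ k) (hb : 0 < b) :
    ∃ (m : PeriodicMotion ((1 / 4 - k) • ĉ) ((s / b) • û) ((1 / (4 * b ^ 2)) • ĉ)) (φ : ℝ → ℝ),
      φ 0 = 0 ∧ φ m.T = ∫ θ in (0 : ℝ)..2 * Real.pi, rotRate s k θ ∧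
      ∀ t, 0 < (s * m.τ t / b) ^ 2 + (1 / 4 - k - m.τ t ^ 2 / (4 * b ^ 2)) ^ 2 ∧
        HasDerivAt φ (s / b * (k - 1 / 4 - m.τ t ^ 2 / (4 * b ^ 2)) /
        ((s * m.τ t / b) ^ 2 + (1 / 4 - k - m.τ t ^ 2 / (4 * b ^ 2)) ^ 2)) t := by
  have hĉû : inner ℝ ĉ û = (0 : ℝ) := by rw [real_inner_comm, hûĉ]
  set K : ℝ → ℝ := fun x => (s ^ 2 + k / 2 - (1 - (x / b) ^ 2) / 16) / b ^ 2 with hK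
  have hK' : ∀ x, HasDerivAt K (x / (8 * b ^ 4)) x := by
    intro x
    have h1 := (((((hasDerivAt_id x).div_const b).pow 2).const_sub 1).div_const 16).const_sub
      (s ^ 2 + k / 2) |>.div_const (b ^ 2)
    refine h1.congr_deriv ?_
    simp
    field_simp
    ring
  have hKpos : ∀ x, 0 < K x := by
    intro x
    have h1 := sq_nonneg (x / b)
    have h2 := sq_nonneg s
    exact div_pos (by linarith) (by positivity)
  have hKc : Continuous K := continuous_iff_continuousAt.mpr fun x => (hK' x).continuousAt
  have hτ0 : ∀ θ : ℝ, 0 - b * Real.cos θ = -(b * Real.cos θ) := fun θ => zero_sub _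
  obtain ⟨θ, T, hT, hθ0, hθ, hθT, hmono⟩ := exists_clock
    (fun φ => √(K (0 - b * Real.cos φ))) (by fun_prop) (fun φ => Real.sqrt_pos.mpr (hKpos _))
    (fun φ => by simp only [Real.cos_add_two_pi]) (Real.pi / 2)
  have hder := hasDerivAt_oscillation hK' (m := 0) (h := b) (fun x _ => hKpos x) hb hθ
  simp only [hτ0] at hθ hder
  have hKcos : ∀ x, K (-(b * Real.cos x)) =
      (s ^ 2 + k / 2 - (1 - Real.cos x ^ 2) / 16) / b ^ 2 := by
    intro x
    simp only [hK]
    congr 4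
    field_simp
  have hinner : ∀ τ : ℝ, inner ℝ (parabola ((1 / 4 - k) • ĉ) ((s / b) • û)
      ((1 / (4 * b ^ 2)) • ĉ) τ) ((s / b) • û - (2 * τ) • (1 / (4 * b ^ 2)) • ĉ) =
      s ^ 2 * τ / b ^ 2 - (1 / 4 - k - τ ^ 2 / (4 * b ^ 2)) * (τ / (2 * b ^ 2)) := by
    intro τ
    rw [parabola_symmetric]
    simp only [inner_add_left, inner_sub_right, real_inner_smul_left, real_inner_smul_right, hû, hĉ,
      hûĉ, hĉû]
    field_simp
    ring
  have hnorm : ∀ τ : ℝ, ‖parabola ((1 / 4 - k) • ĉ) ((s / b) • û) ((1 / (4 * b ^ 2)) • ĉ) τ‖ ^ 2 =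
      (s * τ / b) ^ 2 + (1 / 4 - k - τ ^ 2 / (4 * b ^ 2)) ^ 2 := by
    intro τ
    rw [parabola_symmetric, ← real_inner_self_eq_norm_sq]
    simp only [inner_add_left, inner_add_right, real_inner_smul_left, real_inner_smul_right, hû, hĉ,
      hûĉ, hĉû]
    ring
  refine ⟨⟨fun t => -(b * Real.cos (θ t)),
    fun t => b * Real.sin (θ t) * √(K (-(b * Real.cos (θ t)))), T, hT, by simp [hθ0],
    fun t => (hder t).1, fun t => ?_, fun t => ?_, fun t => ?_, fun t => ?_, fun x y h1 h2 => ?_⟩,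
    fun t => ∫ x in (Real.pi / 2)..θ t, rotRate s k x, ?_, ?_, fun t => ⟨?_, ?_⟩⟩
  · refine (hder t).2.congr_deriv ?_
    rw [hinner, hKcos]
    have h1 := Real.sin_sq (θ t)
    field_simp
    rw [h1]
    ring
  · rw [hnorm, mul_pow, Real.sq_sqrt (hKpos _).le, hKcos, mul_pow]
    have h1 := Real.sin_sq (θ t)
    rw [h1]
    field_simp
    linear_combination 512 * hsk
  · simp only [hθT, Real.cos_add_two_pi]
  · simp only [hθT, Real.cos_add_two_pi, Real.sin_add_two_pi]
  · have hc : Real.cos (θ x) = Real.cos (θ y) := by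
      have := neg_injective h1
      exact mul_left_cancel₀ hb.ne' this
    have hs : Real.sin (θ x) = Real.sin (θ y) := by
      simp only [hc] at h2
      have h3 := mul_right_cancel₀ (Real.sqrt_pos.mpr (hKpos _)).ne' h2
      exact mul_left_cancel₀ hb.ne' h3
    obtain ⟨j, hj⟩ := Real.Angle.angle_eq_iff_two_pi_dvd_sub.mp
      (Real.Angle.cos_sin_inj hc hs)
    refine ⟨j, hmono.injective ?_⟩
    rw [clock_add_int_mul hθT]
    linarith
  · simp [hθ0]
  · have h1 : θ T = Real.pi / 2 + 2 * Real.pi := by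
      have := hθT 0
      rwa [zero_add, hθ0] at this
    simp only [h1]
    have hper : Function.Periodic (rotRate s k) (2 * Real.pi) := fun x => by
      simp only [rotRate, Real.cos_add_two_pi]
    have := hper.intervalIntegral_add_eq (Real.pi / 2) 0
    rwa [zero_add] at this
  · obtain ⟨-, h2, -⟩ := rotRate_factors_pos (s := s) hk (θ t)
    convert h2 using 1
    field_simp
    ring
  · have hc : Continuous (rotRate s k) :=
      continuous_rotRate_comp continuous_const continuous_const continuous_id fun _ => hk
    have h1 := (hc.integral_hasStrictDerivAt (Real.pi / 2) (θ t)).hasDerivAt.comp t (hθ t)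
    refine h1.congr_deriv ?_
    obtain ⟨-, h2, h3⟩ := rotRate_factors_pos (s := s) hk (θ t)
    have h4 := Real.sqrt_pos.mpr h3
    rw [hKcos, Real.sqrt_div' _ (by positivity), Real.sqrt_sq hb.le, rotRate]
    have h5 : (s * -(b * Real.cos (θ t)) / b) ^ 2 +
        (1 / 4 - k - (-(b * Real.cos (θ t))) ^ 2 / (4 * b ^ 2)) ^ 2 =
        s ^ 2 * Real.cos (θ t) ^ 2 + ((1 - Real.cos (θ t) ^ 2) / 4 - k) ^ 2 := by
      field_simp
      ring
    have h6 : s / b * (k - 1 / 4 - (-(b * Real.cos (θ t))) ^ 2 / (4 * b ^ 2)) =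
        s * (k - (1 + Real.cos (θ t) ^ 2) / 4) / b := by
      field_simp
      ring
    rw [h5, h6]
    have h7 := h2.ne'
    have h8 := h4.ne'
    generalize √(s ^ 2 + k / 2 - (1 - Real.cos (θ t) ^ 2) / 16) = r at h8 ⊢
    generalize s ^ 2 * Real.cos (θ t) ^ 2 + ((1 - Real.cos (θ t) ^ 2) / 4 - k) ^ 2 = l at h7 ⊢
    field_simp

/-- The vector at angle `φ` in the tangent plane of the sphere at `(q₁, q₂, u)`, in the
three-dimensional space spanned by `û`, `ĉ` and `Eₙ`. -/
def frameVec (û ĉ : Flat d) (q₁ q₂ u φ : ℝ) : Full d :=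
  ((-(Real.cos φ * q₂) + Real.sin φ * (q₁ * u)) / √(q₁ ^ 2 + q₂ ^ 2)) • mkFull û 0 +
    ((Real.cos φ * q₁ + Real.sin φ * (q₂ * u)) / √(q₁ ^ 2 + q₂ ^ 2)) • mkFull ĉ 0 +
    (-(Real.sin φ * √(q₁ ^ 2 + q₂ ^ 2))) • mkFull 0 1

/-- When the point `(q₁, q₂, u)` moves with `q̇ = u V`, its tangent frame solves the kinematic
equation if it rotates with the speed `(q ∧ V) / |q|²`. -/
theorem hasDerivAt_frameVec {û ĉ : Flat d} (hû : inner ℝ û û = (1 : ℝ))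
    (hĉ : inner ℝ ĉ ĉ = (1 : ℝ)) (hûĉ : inner ℝ û ĉ = (0 : ℝ)) {q₁ q₂ u φ : ℝ → ℝ} {a b t : ℝ}
    (hq₁ : HasDerivAt q₁ (u t * a) t) (hq₂ : HasDerivAt q₂ (u t * b) t)
    (hu : HasDerivAt u (-(q₁ t * a + q₂ t * b)) t) (hpos : 0 < q₁ t ^ 2 + q₂ t ^ 2)
    (hsph : q₁ t ^ 2 + q₂ t ^ 2 + u t ^ 2 = 1)
    (hφ : HasDerivAt φ ((q₁ t * b - q₂ t * a) / (q₁ t ^ 2 + q₂ t ^ 2)) t) :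
    HasDerivAt (fun s => frameVec û ĉ (q₁ s) (q₂ s) (u s) (φ s))
      (rollOp (a • û + b • ĉ) (frameVec û ĉ (q₁ t) (q₂ t) (u t) (φ t))) t := by
  have hĉû : inner ℝ ĉ û = (0 : ℝ) := by rw [real_inner_comm, hûĉ]
  have hl := ((hq₁.fun_pow 2).fun_add (hq₂.fun_pow 2)).sqrt hpos.ne'
  have hlpos := Real.sqrt_pos.mpr hpos
  have hl2 := Real.sq_sqrt hpos.le
  have hx := ((hφ.cos.fun_mul hq₂).fun_neg.fun_add (hφ.sin.fun_mul (hq₁.fun_mul hu))).fun_div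
    hl hlpos.ne'
  have hy := ((hφ.cos.fun_mul hq₁).fun_add (hφ.sin.fun_mul (hq₂.fun_mul hu))).fun_div
    hl hlpos.ne'
  have hz := (hφ.sin.fun_mul hl).fun_neg
  refine (((hx.smul_const (mkFull û 0)).add (hy.smul_const (mkFull ĉ 0))).add
    (hz.smul_const (mkFull 0 1))).congr_deriv ?_
  have hroll : ∀ x y z : ℝ, rollOp (a • û + b • ĉ) (x • mkFull û 0 + y • mkFull ĉ 0 +
      z • mkFull 0 1) = (z * a) • mkFull û 0 + (z * b) • mkFull ĉ 0 +
        (-(x * a + y * b)) • mkFull 0 1 := by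
    intro x y z
    have h1 : trunc (x • mkFull û 0 + y • mkFull ĉ 0 + z • mkFull 0 1) = x • û + y • ĉ := by
      ext i
      simp
    rw [rollOp_apply, h1]
    simp only [inner_add_left, inner_add_right, real_inner_smul_left, real_inner_smul_right, hû, hĉ,
      hûĉ, hĉû]
    refine full_ext ?_ ?_
    · ext i
      simp
      ring
    · simp
      ring
  rw [frameVec, hroll]
  have hW : ((q₁ t * b - q₂ t * a) / (q₁ t ^ 2 + q₂ t ^ 2)) * √(q₁ t ^ 2 + q₂ t ^ 2) ^ 2 =
      q₁ t * b - q₂ t * a := by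
    rw [hl2]
    field_simp
  clear hx hy hz hl hroll hφ hu hq₁ hq₂
  generalize (q₁ t * b - q₂ t * a) / (q₁ t ^ 2 + q₂ t ^ 2) = w at hW ⊢
  generalize √(q₁ t ^ 2 + q₂ t ^ 2) = l at hW hlpos hl2 ⊢
  generalize q₁ t = q at *
  generalize q₂ t = r at *
  generalize u t = v at *
  generalize Real.sin (φ t) = S at *
  generalize Real.cos (φ t) = c at *
  have hl' : (((2 : ℕ) : ℝ) * q ^ (2 - 1) * (v * a) + ((2 : ℕ) : ℝ) * r ^ (2 - 1) * (v * b)) /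
      (2 * l) = v * (q * a + r * b) / l := by
    field_simp
    push_cast
    ring
  rw [hl']
  have hl0 := hlpos.ne'
  congr 1
  · congr 1
    · congr 1
      field_simp
      linear_combination (S * r + c * q * v) * hW + (-v * b * c + a * S) * hl2 +
        (l ^ 2 * a * S - q * (q * a + r * b) * S) * (hl2 + hsph)
    · congr 1
      field_simp
      linear_combination (-S * q + c * r * v) * hW + (c * v * a + b * S) * hl2 +
        (l ^ 2 * b * S - r * (q * a + r * b) * S) * (hl2 + hsph)
  · congr 1
    field_simp
    linear_combination -c * hW

theorem frameVec_start {û ĉ : Flat d} {l : ℝ} (hl : 0 < l) (u φ : ℝ) :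
    frameVec û ĉ 0 (-l) u φ = Real.cos φ • frameVec û ĉ 0 (-l) u 0 +
      Real.sin φ • frameVec û ĉ 0 (-l) u (Real.pi / 2) := by
  have h : √((0 : ℝ) ^ 2 + (-l) ^ 2) = l := by
    rw [zero_pow two_ne_zero, zero_add, neg_sq, Real.sqrt_sq hl.le]
  have hl0 := hl.ne'
  simp only [frameVec, h, Real.cos_zero, Real.sin_zero, Real.cos_pi_div_two, Real.sin_pi_div_two]
  refine full_ext ?_ ?_
  · ext i
    simp
    field_simp
  · simp

theorem inner_self_frameVec_start {û ĉ : Flat d} (hû : inner ℝ û û = (1 : ℝ)) {l : ℝ} (hl : 0 < l)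
    (u : ℝ) : inner ℝ (frameVec û ĉ 0 (-l) u 0) (frameVec û ĉ 0 (-l) u 0) = (1 : ℝ) := by
  have h : √((0 : ℝ) ^ 2 + (-l) ^ 2) = l := by
    rw [zero_pow two_ne_zero, zero_add, neg_sq, Real.sqrt_sq hl.le]
  have h1 : frameVec û ĉ 0 (-l) u 0 = mkFull û 0 := by
    have hl0 := hl.ne'
    refine full_ext ?_ ?_
    · ext i
      simp only [frameVec, h, Real.cos_zero, Real.sin_zero]
      simp [hl0]
    · simp [frameVec]
  rw [h1, inner_full, trunc_mkFull, mkFull_last, hû, mul_zero, add_zero]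

/-- A matrix that rotates an orthonormal pair by an angle that is not a rational multiple of `2π` is
not of finite order. -/
theorem SOn.not_isOfFinOrder {M : SOn d} {w₁ w₂ : Fin (d + 1) → ℝ} {φ : ℝ} (h₁ : w₁ ⬝ᵥ w₁ = 1)
    (h₁₂ : w₁ ⬝ᵥ w₂ = 0)
    (h : ∀ θ : ℝ, (M : Mat d) *ᵥ (Real.cos (θ + φ) • w₁ + Real.sin (θ + φ) • w₂) =
      Real.cos θ • w₁ + Real.sin θ • w₂) (hφ : Irrational (φ / (2 * Real.pi))) :
    ¬ IsOfFinOrder M := by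
  intro hM
  obtain ⟨n, hn, hMn⟩ := isOfFinOrder_iff_pow_eq_one.mp hM
  have hpow : ∀ (k : ℕ) (θ : ℝ), ((M ^ k : SOn d) : Mat d) *ᵥ
      (Real.cos (θ + k * φ) • w₁ + Real.sin (θ + k * φ) • w₂) =
      Real.cos θ • w₁ + Real.sin θ • w₂ := by
    intro k
    induction k with
    | zero => intro θ; simp
    | succ k ih =>
      intro θ
      have h2 : θ + ((k + 1 : ℕ) : ℝ) * φ = (θ + k * φ) + φ := by
        push_cast
        ring
      rw [pow_succ, Submonoid.coe_mul, ← Matrix.mulVec_mulVec, h2, h, ih]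
  have h1 := congrArg (w₁ ⬝ᵥ ·) (hpow n 0)
  rw [hMn] at h1
  simp only [OneMemClass.coe_one, Matrix.one_mulVec, zero_add, Real.cos_zero, Real.sin_zero,
    dotProduct_add, dotProduct_smul, h₁, h₁₂, smul_eq_mul, mul_one, mul_zero, add_zero] at h1
  obtain ⟨k, hk⟩ := (Real.cos_eq_one_iff _).mp h1
  refine hφ ⟨k / n, ?_⟩
  have hn0 : (n : ℝ) ≠ 0 := by positivity
  have hpi := Real.pi_ne_zero
  push_cast
  field_simp
  linarith

/-- The body performs the symmetric motion, which stays in the space of `û`, `ĉ` and `Eₙ`. After a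
period the two vectors tangent to the sphere at the starting point are rotated by the angle
`∫ rotRate`, so the rotation is not of finite order. -/
theorem exists_conditionallyPeriodic_two_of_irrational (I : InertiaOperator d) (C : Fin d → ℝ)
    {û ĉ : Flat d} (hû : inner ℝ û û = (1 : ℝ)) (hĉ : inner ℝ ĉ ĉ = (1 : ℝ))
    (hûĉ : inner ℝ û ĉ = (0 : ℝ)) {s k b : ℝ} (hs : s ≠ 0) (hsk : s ^ 2 + k ^ 2 = 1)
    (hk : 3 / 4 ≤ k) (hb : 0 < b) (hc : I.halfDrift C = (1 / (4 * b ^ 2)) • ĉ)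
    (hirr : Irrational ((∫ θ in (0 : ℝ)..2 * Real.pi, rotRate s k θ) / (2 * Real.pi))) :
    ∃ γ : ℝ → DPhase d, IsSuslovSolution I (kharlamovaPotential C) γ ∧
      IsConditionallyPeriodic 2 γ := by
  obtain ⟨m, φ, hφ0, hφT, hφ⟩ := exists_symmetric_motion hû hĉ hûĉ hsk hk hb
  have hĉû : inner ℝ ĉ û = (0 : ℝ) := by rw [real_inner_comm, hûĉ]
  obtain ⟨l, hl⟩ : ∃ l, l = k - 1 / 4 := ⟨_, rfl⟩
  have hlpos : 0 < l := by linarith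
  set u₀ : ℝ := m.u 0 with hu₀
  have hlu : l ^ 2 + u₀ ^ 2 = 1 := by
    have h1 := m.energy 0
    rw [m.τ_zero, parabola_symmetric, ← real_inner_self_eq_norm_sq] at h1
    simp only [inner_add_left, inner_add_right, real_inner_smul_left, real_inner_smul_right, hû, hĉ,
      hûĉ, hĉû] at h1
    rw [hl, hu₀]
    linear_combination h1
  have hu0 : u₀ ≠ 0 := by
    intro h
    rw [h] at hlu
    nlinarith [sq_nonneg s]
  have hv₁ : (mkFull ĉ 0 : Fin (d + 1) → ℝ) ⬝ᵥ mkFull ĉ 0 = 1 := by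
    rw [← inner_eq_dotProduct, inner_full, trunc_mkFull, mkFull_last, hĉ, mul_zero, add_zero]
  have hv₂ : (mkFull 0 1 : Fin (d + 1) → ℝ) ⬝ᵥ (mkFull (0 : Flat d) 1) = 1 := by
    rw [← inner_eq_dotProduct, inner_full]
    simp
  have hv₁₂ : (mkFull ĉ 0 : Fin (d + 1) → ℝ) ⬝ᵥ (mkFull (0 : Flat d) 1) = 0 := by
    rw [← inner_eq_dotProduct, inner_full]
    simp
  have hζ : ‖(⟨u₀, -l⟩ : ℂ)‖ = 1 := by
    rw [← pow_eq_one_iff_of_nonneg (norm_nonneg _) two_ne_zero, ← Complex.normSq_eq_norm_sq,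
      Complex.normSq_mk]
    linarith
  -- the last row of this rotation is the starting point of the motion
  set z : DPhase d := (⟨planeRot (mkFull ĉ 0) (mkFull 0 1) ⟨u₀, -l⟩,
    planeRot_mem hv₁ hv₂ hv₁₂ hζ⟩, -((s / b) • û)) with hz
  have hze : z.e = mkFull ((-l) • ĉ) u₀ := by
    refine full_ext ?_ ?_
    · ext i
      simp [hz, DPhase.e, planeRot, Matrix.vecMulVec_apply, Matrix.one_apply,
        (Fin.castSucc_lt_last i).ne']
    · simp [hz, DPhase.e, planeRot, Matrix.vecMulVec_apply]
  have hP0 : (s / b) • û ≠ 0 := by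
    refine smul_ne_zero (div_ne_zero hs hb.ne') fun h => ?_
    rw [h, inner_zero_left] at hû
    exact zero_ne_one hû
  obtain ⟨p, hp⟩ := I.opA.surjective ((s / b) • û)
  obtain ⟨γ, M, hγ0, hγc, hγs, hγr, hγT, hrow, hfix⟩ := exists_lift I C (z := z) m hp hc
    (by rw [hze, trunc_mkFull, hl, neg_sub]) (by rw [hz, neg_neg]) (by rw [hze, mkFull_last])
  refine ⟨γ, hγs, (isOfFinOrder_or_conditionallyPeriodic_two I C m hp hc hP0 hγ0 hγc hγr hγT hfix
    (Or.inl (by rwa [hze, mkFull_last]))).resolve_left ?_⟩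
  set F : ℝ → ℝ → Full d := fun α t => frameVec û ĉ (s * m.τ t / b)
    (1 / 4 - k - m.τ t ^ 2 / (4 * b ^ 2)) (m.u t) (φ t + α) with hF
  have hFder : ∀ α t, HasDerivAt (F α) (rollOp ((s / b) • û - (2 * m.τ t) • (1 / (4 * b ^ 2)) • ĉ)
      (F α t)) t := by
    intro α t
    have hq₁ : HasDerivAt (fun t => s * m.τ t / b) (m.u t * (s / b)) t :=
      (((m.hasDerivAt_τ t).const_mul s).div_const b).congr_deriv (by ring)
    have hq₂ : HasDerivAt (fun t => 1 / 4 - k - m.τ t ^ 2 / (4 * b ^ 2))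
        (m.u t * (-(m.τ t / (2 * b ^ 2)))) t := by
      refine ((((m.hasDerivAt_τ t).fun_pow 2).div_const (4 * b ^ 2)).const_sub
        (1 / 4 - k)).congr_deriv ?_
      field_simp
      ring
    have hV : (s / b) • û - (2 * m.τ t) • (1 / (4 * b ^ 2)) • ĉ =
        (s / b) • û + (-(m.τ t / (2 * b ^ 2))) • ĉ := by
      rw [sub_eq_add_neg, smul_smul, ← neg_smul]
      congr 2
      field_simp
      ring
    have hu : HasDerivAt m.u (-(s * m.τ t / b * (s / b) +
        (1 / 4 - k - m.τ t ^ 2 / (4 * b ^ 2)) * (-(m.τ t / (2 * b ^ 2))))) t := by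
      refine (m.hasDerivAt_u t).congr_deriv ?_
      rw [parabola_symmetric, hV]
      simp only [inner_add_left, inner_add_right, real_inner_smul_left, real_inner_smul_right, hû,
        hĉ, hûĉ, hĉû]
      ring
    have hsph : (s * m.τ t / b) ^ 2 + (1 / 4 - k - m.τ t ^ 2 / (4 * b ^ 2)) ^ 2 + m.u t ^ 2 = 1 := by
      have h1 := m.energy t
      rw [parabola_symmetric, ← real_inner_self_eq_norm_sq] at h1
      simp only [inner_add_left, inner_add_right, real_inner_smul_left, real_inner_smul_right, hû,
        hĉ, hûĉ, hĉû] at h1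
      linear_combination h1
    rw [hV]
    refine hasDerivAt_frameVec hû hĉ hûĉ hq₁ hq₂ hu (hφ t).1 hsph ?_
    refine ((hφ t).2.add_const α).congr_deriv ?_
    congr 1
    field_simp
    ring
  have hskew : ∀ t : ℝ, ∀ x y : Full d,
      inner ℝ (rollOp ((s / b) • û - (2 * m.τ t) • (1 / (4 * b ^ 2)) • ĉ) x) y =
      -inner ℝ x (rollOp ((s / b) • û - (2 * m.τ t) • (1 / (4 * b ^ 2)) • ĉ) y) :=
    fun t => inner_rollOp _
  have hτT : m.τ m.T = 0 := by
    have := m.periodic_τ 0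
    rwa [zero_add, m.τ_zero] at this
  have huT : m.u m.T = u₀ := by
    have := m.periodic_u 0
    rwa [zero_add] at this
  have hFval : ∀ α t, m.τ t = 0 → m.u t = u₀ → F α t = frameVec û ĉ 0 (-l) u₀ (φ t + α) := by
    intro α t h1 h2
    simp only [hF, h1, h2]
    congr 1
    · simp
    · rw [hl]
      simp
  have hMF : ∀ α, (M : Mat d) *ᵥ ((z.1 : Mat d) *ᵥ (F α m.T)) = (z.1 : Mat d) *ᵥ (F α 0) := by
    intro α
    have h1 : ((γ m.T).1 : Mat d) *ᵥ (F α m.T) = ((γ 0).1 : Mat d) *ᵥ (F α 0) := by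
      ext i
      rw [← inner_row, ← inner_row]
      exact inner_eq_of_skew hskew (fun t => hrow t i) (hFder α) m.T 0
    have h2 := hγT 0
    rw [zero_add, hγ0] at h2
    rwa [h2, hγ0, Submonoid.coe_mul, ← Matrix.mulVec_mulVec] at h1
  have hMF' : ∀ α, (M : Mat d) *ᵥ ((z.1 : Mat d) *ᵥ (frameVec û ĉ 0 (-l) u₀ (α + φ m.T))) =
      (z.1 : Mat d) *ᵥ (frameVec û ĉ 0 (-l) u₀ α) := by
    intro α
    have := hMF α
    rwa [hFval α m.T hτT huT, hFval α 0 m.τ_zero rfl, hφ0, zero_add, add_comm (φ m.T)] at this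
  have hsplit : ∀ α, (z.1 : Mat d) *ᵥ (frameVec û ĉ 0 (-l) u₀ α) =
      Real.cos α • ((z.1 : Mat d) *ᵥ (frameVec û ĉ 0 (-l) u₀ 0)) +
      Real.sin α • ((z.1 : Mat d) *ᵥ (frameVec û ĉ 0 (-l) u₀ (Real.pi / 2))) := by
    intro α
    rw [frameVec_start hlpos, WithLp.ofLp_add, WithLp.ofLp_smul, WithLp.ofLp_smul,
      Matrix.mulVec_add, Matrix.mulVec_smul, Matrix.mulVec_smul]
  refine SOn.not_isOfFinOrder (φ := φ m.T) (w₁ := (z.1 : Mat d) *ᵥ (frameVec û ĉ 0 (-l) u₀ 0))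
    (w₂ := (z.1 : Mat d) *ᵥ (frameVec û ĉ 0 (-l) u₀ (Real.pi / 2))) ?_ ?_ (fun θ => ?_) ?_
  · rw [SOn.mulVec_dotProduct_mulVec, ← inner_eq_dotProduct, inner_self_frameVec_start hû hlpos]
  · rw [SOn.mulVec_dotProduct_mulVec, ← inner_eq_dotProduct]
    simp only [frameVec, inner_add_left, inner_add_right, real_inner_smul_left,
      real_inner_smul_right, inner_full]
    simp [hûĉ, hĉû]
  · rw [← hsplit, ← hsplit, hMF']
  · rwa [hφT]

/-- The rotation number takes an irrational value: it is continuous in the parameter, zero for the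
motion along a line and positive for the others. -/
theorem exists_irrational_rotRate : ∃ s k : ℝ, s ≠ 0 ∧ s ^ 2 + k ^ 2 = 1 ∧ 3 / 4 ≤ k ∧
    Irrational ((∫ θ in (0 : ℝ)..2 * Real.pi, rotRate s k θ) / (2 * Real.pi)) := by
  set s : ℝ → ℝ := fun η => Real.sin η / 2 with hs
  set k : ℝ → ℝ := fun η => √(1 - s η ^ 2) with hk
  have hs2 : ∀ η, s η ^ 2 ≤ 1 / 4 := by
    intro η
    have := Real.sin_sq_le_one η
    simp only [hs, div_pow]
    linarith
  have hk34 : ∀ η, 3 / 4 ≤ k η := fun η => Real.le_sqrt_of_sq_le (by linarith [hs2 η])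
  have hsk : ∀ η, s η ^ 2 + k η ^ 2 = 1 := by
    intro η
    simp only [hk]
    rw [Real.sq_sqrt (by linarith [hs2 η])]
    ring
  set ρ : ℝ → ℝ := fun η => (∫ θ in (0 : ℝ)..2 * Real.pi, rotRate (s η) (k η) θ) / (2 * Real.pi)
    with hρ
  have hsc : Continuous s := by fun_prop
  have hkc : Continuous k := by fun_prop
  have hρc : Continuous ρ := by
    refine Continuous.div_const ?_ _
    refine intervalIntegral.continuous_parametric_intervalIntegral_of_continuous' ?_ _ _
    exact continuous_rotRate_comp (hsc.comp continuous_fst) (hkc.comp continuous_fst)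
      continuous_snd fun x => hk34 x.1
  have hρ0 : ρ 0 = 0 := by simp [hρ, hs, rotRate]
  have hρ1 : 0 < ρ (Real.pi / 2) := by
    refine div_pos (intervalIntegral.intervalIntegral_pos_of_pos ?_ (fun θ => ?_) (by positivity))
      (by positivity)
    · exact (continuous_rotRate_comp continuous_const continuous_const continuous_id
        fun _ => hk34 _).intervalIntegrable _ _
    · obtain ⟨h1, h2, h3⟩ := rotRate_factors_pos (s := s (Real.pi / 2)) (hk34 (Real.pi / 2)) θ
      refine div_pos (mul_pos ?_ h1) (mul_pos h2 (Real.sqrt_pos.mpr h3))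
      simp [hs]
  obtain ⟨α, hα, hα0, hα1⟩ := exists_irrational_btwn hρ1
  obtain ⟨η, -, hη⟩ := intermediate_value_Icc Real.pi_div_two_pos.le hρc.continuousOn
    ⟨hρ0.le.trans hα0.le, hα1.le⟩
  refine ⟨s η, k η, fun h => ?_, hsk η, hk34 η, by rwa [← hη] at hα⟩
  have : ρ η = 0 := by simp [hρ, h, rotRate]
  linarith

theorem exists_conditionallyPeriodic_max (I : InertiaOperator d) (C : Fin d → ℝ) (hd : 2 ≤ d)
    (hC : C ≠ 0) : ∃ γ : ℝ → DPhase d, IsSuslovSolution I (kharlamovaPotential C) γ ∧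
      IsConditionallyPeriodic ((d + 1) / d + 1) γ := by
  have hd2 : (d + 1) / d + 1 = 2 := by
    rw [Nat.add_div_left _ (by omega), Nat.div_eq_of_lt (by omega)]
  rw [hd2]
  have hc := I.halfDrift_ne_zero hC
  have hκ := norm_pos_iff.mpr hc
  set κ := ‖I.halfDrift C‖ with hκdef
  set ĉ : Flat d := κ⁻¹ • I.halfDrift C with hĉdef
  have hĉn : ‖ĉ‖ = 1 := by
    rw [hĉdef, norm_smul, norm_inv, norm_norm, inv_mul_cancel₀ hκ.ne']
  have hĉ : inner ℝ ĉ ĉ = (1 : ℝ) := by rw [real_inner_self_eq_norm_sq, hĉn, one_pow]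
  have hrank : 0 < Module.finrank ℝ (ℝ ∙ ĉ)ᗮ := by
    have h1 := Submodule.finrank_add_finrank_orthogonal (ℝ ∙ ĉ)
    rw [finrank_euclideanSpace_fin,
      finrank_span_singleton (norm_ne_zero_iff.mp (by rw [hĉn]; exact one_ne_zero))] at h1
    omega
  have := Module.nontrivial_of_finrank_pos hrank
  obtain ⟨⟨û, hûmem⟩, hûn⟩ := exists_norm_eq (ℝ ∙ ĉ)ᗮ zero_le_one
  have hû : inner ℝ û û = (1 : ℝ) := by
    rw [real_inner_self_eq_norm_sq, show ‖û‖ = 1 from hûn, one_pow]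
  have hûĉ : inner ℝ û ĉ = (0 : ℝ) := Submodule.mem_orthogonal_singleton_iff_inner_left.mp hûmem
  obtain ⟨s, k, hs, hsk, hk, hirr⟩ := exists_irrational_rotRate
  have hb : 0 < (2 * √κ)⁻¹ := by positivity
  refine exists_conditionallyPeriodic_two_of_irrational I C hû hĉ hûĉ hs hsk hk hb ?_ hirr
  have h1 : 1 / (4 * (2 * √κ)⁻¹ ^ 2) = κ := by
    rw [inv_pow, mul_pow, Real.sq_sqrt hκ.le]
    field_simp
    norm_num
  rw [h1, hĉdef, smul_smul, mul_inv_cancel₀ hκ.ne', one_smul]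

/-! ### Branched double spheres -/

theorem contDiff_trunc : ContDiff ℝ ∞ (trunc : Full d → Flat d) := by
  refine contDiff_euclidean.mpr fun i => ?_
  simp only [trunc_apply]
  fun_prop

theorem contDiff_mkFull : ContDiff ℝ ∞ fun z : Flat d × ℝ => mkFull z.1 z.2 := by
  refine contDiff_euclidean.mpr fun i => ?_
  refine Fin.lastCases ?_ (fun i => ?_) i
  · simp only [mkFull_last]
    fun_prop
  · simp only [mkFull_castSucc]
    fun_prop

theorem contMDiff_coe_sph : ContMDiff (𝓡 d) 𝓘(ℝ, Full d) ∞ ((↑) : Sph d → Full d) :=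
  have := Fact.mk (finrank_euclideanSpace_fin (𝕜 := ℝ) (n := d + 1))
  contMDiff_coe_sphere

theorem mfderiv_coe_sph_injective (x : Sph d) :
    Function.Injective (mfderiv (𝓡 d) 𝓘(ℝ, Full d) ((↑) : Sph d → Full d) x) := by
  have := Fact.mk (finrank_euclideanSpace_fin (𝕜 := ℝ) (n := d + 1))
  convert! injective_mvfderiv_subtypeVal_sphere x

theorem exists_mfderiv_coe_sph_eq (x : Sph d) {v : Full d} (hv : inner ℝ (x : Full d) v = (0 : ℝ)) :
    ∃ w, mfderiv (𝓡 d) 𝓘(ℝ, Full d) ((↑) : Sph d → Full d) x w = v := by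
  have := Fact.mk (finrank_euclideanSpace_fin (𝕜 := ℝ) (n := d + 1))
  have h : v ∈ (mvfderiv (𝓡 d) ((↑) : Sph d → Full d) x).range := by
    rw [range_mvfderiv_subtypeVal]
    exact Submodule.mem_orthogonal_singleton_iff_inner_right.mpr hv
  obtain ⟨w, hw⟩ := h
  exact ⟨w, hw⟩

theorem contMDiff_toBall : ContMDiff ((𝓡 d).prod 𝓘(ℝ, Flat d)) 𝓘(ℝ, Flat d × Flat d) ∞
    (toBall : ReducedPhase d → Flat d × Flat d) :=
  (contDiff_trunc.contMDiff.comp (contMDiff_coe_sph.comp contMDiff_fst)).prodMk_space contMDiff_snd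

/-- A ball `ψ` in `T*B̄`, along which `1 - |q|²` vanishes on the boundary sphere exactly to first
order, lifts to a branched double sphere in `𝓜`. The left inverse `G` witnesses that `ψ` is
an injective immersion. -/
theorem isBranchedDoubleSphere_preimage {ψ : Flat d → Flat d × Flat d} {κ : Flat d → ℝ}
    {G : Flat d × Flat d → Flat d} (hψ : ∀ y ∈ closedBall (0 : Flat d) 1, ContDiffAt ℝ ∞ ψ y)
    (hκ : ∀ y ∈ closedBall (0 : Flat d) 1, ContDiffAt ℝ ∞ κ y)
    (hκpos : ∀ y ∈ closedBall (0 : Flat d) 1, 0 < κ y)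
    (hG : ∀ y ∈ closedBall (0 : Flat d) 1, ContDiffAt ℝ ∞ G (ψ y))
    (hGψ : ∀ y ∈ closedBall (0 : Flat d) 1, G (ψ y) = y)
    (hball : ∀ y ∈ closedBall (0 : Flat d) 1,
      1 - ‖(ψ y).1‖ ^ 2 = κ y ^ 2 * (1 - ‖y‖ ^ 2)) :
    IsBranchedDoubleSphere (toBall ⁻¹' (ψ '' closedBall 0 1)) ∧
      (1 ≤ d → IsPreconnected (toBall ⁻¹' (ψ '' closedBall (0 : Flat d) 1))) := by
  have hmem : ∀ x : Sph d, trunc (x : Full d) ∈ closedBall (0 : Flat d) 1 := fun x =>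
    mem_closedBall_zero_iff.mpr (norm_trunc_le_one x)
  have hsph : ∀ x : Sph d, mkFull (ψ (trunc (x : Full d))).1
      (κ (trunc (x : Full d)) * (x : Full d) (Fin.last d)) ∈ sphere (0 : Full d) 1 := by
    intro x
    refine mkFull_mem_sphere ?_
    have h1 := hball _ (hmem x)
    have h2 := norm_sq_trunc_add x
    rw [mul_pow]
    linear_combination -h1 + κ (trunc (x : Full d)) ^ 2 * h2
  set φ : Sph d → ReducedPhase d := fun x => (⟨_, hsph x⟩, (ψ (trunc (x : Full d))).2) with hφ
  have htrunc : ContMDiff (𝓡 d) 𝓘(ℝ, Flat d) ∞ fun x : Sph d => trunc (x : Full d) :=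
    contDiff_trunc.contMDiff.comp contMDiff_coe_sph
  have hlast : ContMDiff (𝓡 d) 𝓘(ℝ, ℝ) ∞ fun x : Sph d => (x : Full d) (Fin.last d) := by
    have : ContDiff ℝ ∞ fun x : Full d => x (Fin.last d) := by fun_prop
    exact this.contMDiff.comp contMDiff_coe_sph
  have hψs : ContMDiff (𝓡 d) 𝓘(ℝ, Flat d × Flat d) ∞ fun x : Sph d => ψ (trunc (x : Full d)) :=
    fun x => (hψ _ (hmem x)).contMDiffAt.comp x (htrunc x)
  have hκs : ContMDiff (𝓡 d) 𝓘(ℝ, ℝ) ∞ fun x : Sph d => κ (trunc (x : Full d)) :=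
    fun x => (hκ _ (hmem x)).contMDiffAt.comp x (htrunc x)
  have hφs : ContMDiff (𝓡 d) ((𝓡 d).prod 𝓘(ℝ, Flat d)) ∞ φ := by
    have := Fact.mk (finrank_euclideanSpace_fin (𝕜 := ℝ) (n := d + 1))
    refine ContMDiff.prodMk (ContMDiff.codRestrict_sphere ?_ hsph)
      (contDiff_snd.contMDiff.comp hψs)
    exact contDiff_mkFull.contMDiff.comp
      ((contDiff_fst.contMDiff.comp hψs).prodMk_space (hκs.mul hlast))
  have hcover : ∀ x, toBall (φ x) = ψ (trunc (x : Full d)) := fun x =>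
    Prod.ext (trunc_mkFull _ _) rfl
  -- the embedding of the sphere factors through `φ`
  set Θ : ReducedPhase d → Full d := fun z => mkFull (G (toBall z))
    ((z.1 : Full d) (Fin.last d) / κ (G (toBall z))) with hΘ
  have hΘφ : ∀ x, Θ (φ x) = x := by
    intro x
    simp only [hΘ, hcover, hGψ _ (hmem x)]
    have h1 : ((φ x).1 : Full d) (Fin.last d) =
        κ (trunc (x : Full d)) * (x : Full d) (Fin.last d) := mkFull_last _ _
    rw [h1, mul_div_cancel_left₀ _ (hκpos _ (hmem x)).ne', mkFull_trunc]
  have hΘs : ∀ x, ContMDiffAt ((𝓡 d).prod 𝓘(ℝ, Flat d)) 𝓘(ℝ, Full d) ∞ Θ (φ x) := by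
    intro x
    have h1 : ContMDiffAt ((𝓡 d).prod 𝓘(ℝ, Flat d)) 𝓘(ℝ, Flat d) ∞
        (fun z : ReducedPhase d => G (toBall z)) (φ x) := by
      refine ContMDiffAt.comp (φ x) ?_ (contMDiff_toBall (φ x))
      rw [hcover]
      exact (hG _ (hmem x)).contMDiffAt
    have h2 : ContMDiffAt ((𝓡 d).prod 𝓘(ℝ, Flat d)) 𝓘(ℝ, ℝ) ∞
        (fun z : ReducedPhase d => κ (G (toBall z))) (φ x) := by
      refine ContMDiffAt.comp (φ x) ?_ h1
      rw [hcover, hGψ _ (hmem x)]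
      exact (hκ _ (hmem x)).contMDiffAt
    have h3 : ContMDiffAt ((𝓡 d).prod 𝓘(ℝ, Flat d)) 𝓘(ℝ, ℝ) ∞
        (fun z : ReducedPhase d => (z.1 : Full d) (Fin.last d)) (φ x) :=
      (hlast.comp contMDiff_fst) (φ x)
    have h4 : ContDiffAt ℝ ∞ (fun z : Flat d × ℝ × ℝ => mkFull z.1 (z.2.1 / z.2.2))
        (G (toBall (φ x)), ((φ x).1 : Full d) (Fin.last d), κ (G (toBall (φ x)))) := by
      refine contDiff_mkFull.contDiffAt.comp _ (contDiffAt_fst.prodMk ?_)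
      refine (contDiffAt_fst.comp _ contDiffAt_snd).div (contDiffAt_snd.comp _ contDiffAt_snd) ?_
      simp only [hcover, hGψ _ (hmem x)]
      exact (hκpos _ (hmem x)).ne'
    exact ContMDiffAt.comp (g := fun z : Flat d × ℝ × ℝ => mkFull z.1 (z.2.1 / z.2.2)) (φ x)
      h4.contMDiffAt (h1.prodMk_space (h3.prodMk_space h2))
  have hrange : range φ = toBall ⁻¹' (ψ '' closedBall 0 1) := by
    ext z
    constructor
    · rintro ⟨x, rfl⟩
      exact ⟨_, hmem x, (hcover x).symm⟩
    · rintro ⟨y, hy, hyz⟩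
      have hκy := hκpos y hy
      have h1 : (ψ y).1 = trunc (z.1 : Full d) := congrArg Prod.fst hyz
      have h2 : ‖y‖ ^ 2 + ((z.1 : Full d) (Fin.last d) / κ y) ^ 2 = 1 := by
        have h3 := norm_sq_trunc_add z.1
        have h4 := hball y hy
        rw [h1] at h4
        field_simp
        linear_combination h3 + h4
      refine ⟨⟨mkFull y ((z.1 : Full d) (Fin.last d) / κ y), mkFull_mem_sphere h2⟩, ?_⟩
      refine Prod.ext (Subtype.ext (full_ext ?_ ?_)) ?_
      · simp [hφ, h1]
      · simp only [hφ, trunc_mkFull, mkFull_last]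
        field_simp
      · simp only [hφ, trunc_mkFull]
        exact congrArg Prod.snd hyz
  have hone : (∞ : WithTop ℕ∞) ≠ 0 := by simp
  refine ⟨⟨φ, ψ, hφs, fun x x' h => ?_, fun x => ?_, hrange,
    fun y hy => (hψ y hy).continuousAt.continuousWithinAt, fun y hy y' hy' h => ?_, rfl, hcover,
    fun y hy => ?_⟩, fun hd => ?_⟩
  · exact Subtype.ext ((hΘφ x).symm.trans ((congrArg Θ h).trans (hΘφ x')))
  · have h1 : mfderiv (𝓡 d) 𝓘(ℝ, Full d) (Θ ∘ φ) x =
        (mfderiv ((𝓡 d).prod 𝓘(ℝ, Flat d)) 𝓘(ℝ, Full d) Θ (φ x)).comp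
          (mfderiv (𝓡 d) ((𝓡 d).prod 𝓘(ℝ, Flat d)) φ x) :=
      mfderiv_comp x ((hΘs x).mdifferentiableAt hone) ((hφs x).mdifferentiableAt hone)
    have h2 : Θ ∘ φ = ((↑) : Sph d → Full d) := funext hΘφ
    rw [h2] at h1
    have h3 : Function.Injective (mfderiv (𝓡 d) 𝓘(ℝ, Full d) ((↑) : Sph d → Full d) x) :=
      mfderiv_coe_sph_injective x
    rw [h1] at h3
    exact Function.Injective.of_comp h3
  · rw [← hGψ y hy, h, hGψ y' hy']
  · have h1 := hball y hy
    have h2 := hκpos y hy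
    rw [← pow_eq_one_iff_of_nonneg (norm_nonneg (ψ y).1) two_ne_zero,
      ← pow_eq_one_iff_of_nonneg (norm_nonneg y) two_ne_zero]
    constructor
    · intro h
      rw [h, sub_self, eq_comm, mul_eq_zero] at h1
      rcases h1 with h1 | h1
      · exact absurd h1 (by positivity)
      · linarith
    · intro h
      rw [h, sub_self, mul_zero] at h1
      linarith
  · rw [← hrange]
    have hrank : 1 < Module.rank ℝ (Full d) := by
      rw [← Module.finrank_eq_rank, finrank_euclideanSpace_fin]
      exact_mod_cast (by omega : 1 < d + 1)
    have := isPreconnected_sphere hrank (0 : Full d) 1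
    have := Subtype.preconnectedSpace this
    exact isPreconnected_range hφs.continuous

/-! ### The first integrals -/

theorem IsReducedSolution.hasDerivAt_trunc {I : InertiaOperator d} {v : Full d → ℝ}
    {γ : ℝ → ReducedPhase d} (h : IsReducedSolution I v γ) (t : ℝ) :
    HasDerivAt (fun s => trunc ((γ s).1 : Full d))
      (((γ t).1 : Full d) (Fin.last d) • I.opA (γ t).2) t := by
  refine (PiLp.continuousLinearEquiv 2 ℝ
    (fun _ : Fin d => ℝ)).symm.hasFDerivAt.comp_hasDerivAt t
      (hasDerivAt_pi (φ' := fun i => (((γ t).1 : Full d) (Fin.last d) • I.opA (γ t).2) i).mpr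
        fun i => ?_)
  have := (h t).1 i
  simpa using this

theorem IsReducedSolution.hasDerivAt_snd {I : InertiaOperator d} {C : Fin d → ℝ}
    {γ : ℝ → ReducedPhase d} (h : IsReducedSolution I (kharlamovaPotential C) γ) (t : ℝ) :
    HasDerivAt (fun s => (γ s).2) (-((γ t).1 : Full d) (Fin.last d) • WithLp.toLp 2 C) t := by
  refine (PiLp.continuousLinearEquiv 2 ℝ
    (fun _ : Fin d => ℝ)).symm.hasFDerivAt.comp_hasDerivAt t
      (hasDerivAt_pi (φ' := fun i => (-((γ t).1 : Full d) (Fin.last d) • WithLp.toLp 2 C :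
        Flat d) i).mpr fun i => ?_)
  have := (h t).2.2 i
  rw [grad_kharlamova_castSucc, grad_kharlamova_last] at this
  simpa using this

theorem IsReducedSolution.continuous {I : InertiaOperator d} {C : Fin d → ℝ}
    {γ : ℝ → ReducedPhase d} (h : IsReducedSolution I (kharlamovaPotential C) γ) :
    Continuous γ := by
  have h1 : Continuous fun s => trunc ((γ s).1 : Full d) :=
    continuous_iff_continuousAt.mpr fun t => (h.hasDerivAt_trunc t).continuousAt
  have h2 : Continuous fun s => ((γ s).1 : Full d) (Fin.last d) :=
    continuous_iff_continuousAt.mpr fun t => (h t).2.1.continuousAt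
  have h3 : Continuous fun s => (γ s).2 :=
    continuous_iff_continuousAt.mpr fun t => (h.hasDerivAt_snd t).continuousAt
  have h4 : Continuous fun s => ((γ s).1 : Full d) := by
    have := continuous_mkFull.comp (h1.prodMk h2)
    simpa only [Function.comp_def, mkFull_trunc] using this
  exact (h4.subtype_mk _).prodMk h3

theorem isInvariant_levelComponent {ι : Type*} {I : InertiaOperator d} {C : Fin d → ℝ}
    {f : ι → ReducedPhase d → ℝ} (hf : ∀ i, IsFirstIntegral I (kharlamovaPotential C) (f i))
    (x : ReducedPhase d) : IsInvariant I (kharlamovaPotential C) (levelComponent f x) := by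
  intro γ hγ s t hs
  have hconn : IsPreconnected (range γ) := isPreconnected_range hγ.continuous
  have hsub : range γ ⊆ {y | ∀ i, f i y = f i x} := by
    rintro _ ⟨r, rfl⟩ i
    rw [hf i γ hγ r s]
    exact connectedComponentIn_subset _ _ hs i
  have h1 := hconn.subset_connectedComponentIn (mem_range_self s) hsub (mem_range_self t)
  rwa [← connectedComponentIn_eq hs] at h1

/-- The truncation as a continuous linear map. -/
def truncL (d : ℕ) : Full d →L[ℝ] Flat d :=
  LinearMap.toContinuousLinearMap
    { toFun := trunc
      map_add' := fun _ _ => rfl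
      map_smul' := fun _ _ => rfl }

/-- The derivative of `𝓜 → T*B̄` reaches all vectors that come from vectors tangent to the
sphere. -/
theorem exists_mfderiv_toBall_eq (x : ReducedPhase d) {v : Full d}
    (hv : inner ℝ (x.1 : Full d) v = (0 : ℝ)) (δ : Flat d) :
    ∃ w, mfderiv ((𝓡 d).prod 𝓘(ℝ, Flat d)) 𝓘(ℝ, Flat d × Flat d) toBall x w = (trunc v, δ) := by
  obtain ⟨w, hw⟩ := exists_mfderiv_coe_sph_eq x.1 hv
  have h1 : HasMFDerivAt (𝓡 d) 𝓘(ℝ, Full d) ((↑) : Sph d → Full d) x.1 _ :=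
    ((contMDiff_coe_sph x.1).mdifferentiableAt (by simp)).hasMFDerivAt
  have h2 := (truncL d).hasMFDerivAt (x := (x.1 : Full d))
  have h3 := (h2.comp x.1 h1).comp x (hasMFDerivAt_fst (I := 𝓡 d) (I' := 𝓘(ℝ, Flat d)) (x := x))
  have h4 := ((contMDiff_toBall x).mdifferentiableAt (by simp)).hasMFDerivAt
  have h5 := (ContinuousLinearMap.fst ℝ (Flat d) (Flat d)).hasMFDerivAt.comp x h4
  have h6 := (ContinuousLinearMap.snd ℝ (Flat d) (Flat d)).hasMFDerivAt.comp x h4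
  have h7 := hasMFDerivAt_unique h5 h3
  have h8 := hasMFDerivAt_unique h6
    (hasMFDerivAt_snd (I := 𝓡 d) (I' := 𝓘(ℝ, Flat d)) (x := x))
  refine ⟨(w, δ), Prod.ext ?_ ?_⟩
  · exact (DFunLike.congr_fun h7 (w, δ)).trans (congrArg trunc hw)
  · exact DFunLike.congr_fun h8 (w, δ)

/-- The functions `(q, bᵢ₀) + ℓ(p)² / (2k)` and `(p, bᵢ)`, `i ≠ i₀`, on `T*B̄`. -/
def flatIntegral (b : OrthonormalBasis (Fin d) ℝ (Flat d)) (i₀ : Fin d) (l : Flat d →L[ℝ] ℝ)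
    (k : ℝ) (i : Fin d) (z : Flat d × Flat d) : ℝ :=
  if i = i₀ then inner ℝ (b i₀) z.1 + l z.2 ^ 2 / (2 * k) else inner ℝ (b i) z.2

/-- The derivatives of the functions `flatIntegral`. -/
def flatIntegralDeriv (b : OrthonormalBasis (Fin d) ℝ (Flat d)) (i₀ : Fin d) (l : Flat d →L[ℝ] ℝ)
    (k : ℝ) (i : Fin d) (z : Flat d × Flat d) : Flat d × Flat d →L[ℝ] ℝ :=
  if i = i₀ then (innerSL ℝ (b i₀)).comp (ContinuousLinearMap.fst ℝ _ _) +
    (l z.2 / k) • l.comp (ContinuousLinearMap.snd ℝ _ _)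
  else (innerSL ℝ (b i)).comp (ContinuousLinearMap.snd ℝ _ _)

section

variable (b : OrthonormalBasis (Fin d) ℝ (Flat d)) (i₀ : Fin d) (l : Flat d →L[ℝ] ℝ) (k : ℝ)

theorem contDiff_flatIntegral (i : Fin d) : ContDiff ℝ ∞ (flatIntegral b i₀ l k i) := by
  unfold flatIntegral
  split_ifs
  · exact (contDiff_const.inner ℝ contDiff_fst).add
      (((l.contDiff.comp contDiff_snd).pow 2).div_const _)
  · exact contDiff_const.inner ℝ contDiff_snd

theorem hasFDerivAt_flatIntegral (i : Fin d) (z : Flat d × Flat d) :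
    HasFDerivAt (flatIntegral b i₀ l k i) (flatIntegralDeriv b i₀ l k i z) z := by
  unfold flatIntegral flatIntegralDeriv
  split_ifs
  · have h1 := ((innerSL ℝ (b i₀)).comp (ContinuousLinearMap.fst ℝ (Flat d) (Flat d))).hasFDerivAt
      (x := z)
    have h2 := ((l.comp (ContinuousLinearMap.snd ℝ (Flat d) (Flat d))).hasFDerivAt
      (x := z)).pow 2 |>.mul_const (2 * k)⁻¹
    refine (h1.add h2).congr_fderiv ?_
    ext y
    · simp
    · simp
      ring
  · exact ((innerSL ℝ (b i)).comp (ContinuousLinearMap.snd ℝ (Flat d) (Flat d))).hasFDerivAt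

theorem isFirstIntegral_flatIntegral (I : InertiaOperator d) {C : Fin d → ℝ} {c : ℝ} (hk : k ≠ 0)
    (hC : WithLp.toLp 2 C = c • b i₀) (hl : ∀ p, l p = inner ℝ (b i₀) (I.opA p))
    (hlk : l (WithLp.toLp 2 C) = k) (i : Fin d) :
    IsFirstIntegral I (kharlamovaPotential C) fun x => flatIntegral b i₀ l k i (toBall x) := by
  intro γ hγ s t
  have h : ∀ t, HasDerivAt (fun t => flatIntegral b i₀ l k i (toBall (γ t))) 0 t := by
    intro t
    have h1 := (hγ.hasDerivAt_trunc t).prodMk (hγ.hasDerivAt_snd t)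
    refine ((hasFDerivAt_flatIntegral b i₀ l k i
      (toBall (γ t))).comp_hasDerivAt t h1).congr_deriv ?_
    unfold flatIntegralDeriv
    split_ifs with hi
    · simp only [toBall, add_apply, ContinuousLinearMap.comp_apply,
        ContinuousLinearMap.coe_fst', ContinuousLinearMap.coe_snd', innerSL_apply_apply,
        smul_apply, map_smul, hlk, ← hl, smul_eq_mul]
      field_simp
      ring
    · simp [hC, real_inner_smul_right, b.inner_eq_zero hi]
  exact is_const_of_deriv_eq_zero (fun t => (h t).differentiableAt) (fun t => (h t).deriv) s t

theorem trunc_hemisphere {q : Flat d} (hq : ‖q‖ < 1) {ε : ℝ} (hε : ε = 1 ∨ ε = -1) :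
    trunc (hemisphere ε q : Full d) = q := by
  have hε2 : ε ^ 2 = 1 := by rcases hε with rfl | rfl <;> norm_num
  have h : mkFull q (ε * √(1 - ‖q‖ ^ 2)) ∈ sphere (0 : Full d) 1 := by
    refine mkFull_mem_sphere ?_
    rw [mul_pow, Real.sq_sqrt, hε2]
    · ring
    · nlinarith [norm_nonneg q]
  have h1 : (hemisphere ε q : Full d) = mkFull q (ε * √(1 - ‖q‖ ^ 2)) := by
    unfold hemisphere
    exact congrArg Subtype.val (dif_pos h)
  rw [h1, trunc_mkFull]

/-- For functions of `(q, p)` the substitution `qₙ = ±√(1 - (q,q))` changes nothing. -/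
theorem inInvolution_comp_toBall {ι : Type*} {F : ι → Flat d × Flat d → ℝ}
    (h : ∀ i j, ∀ z, poisson (F i) (F j) z = 0) : InInvolution fun i x => F i (toBall x) := by
  intro i j ε hε z hz
  have heq : ∀ i, onBall (fun x => F i (toBall x)) ε =ᶠ[nhds z] F i := by
    intro i
    have hopen : {y : Flat d × Flat d | ‖y.1‖ < 1} ∈ nhds z :=
      (isOpen_lt (by fun_prop) continuous_const).mem_nhds hz
    filter_upwards [hopen] with y hy
    simp only [onBall, toBall, trunc_hemisphere hy hε]
  rw [← h i j z, poisson, poisson, (heq i).fderiv_eq, (heq j).fderiv_eq]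

theorem poisson_flatIntegral (i j : Fin d) (z : Flat d × Flat d) :
    poisson (flatIntegral b i₀ l k i) (flatIntegral b i₀ l k j) z = 0 := by
  unfold poisson
  rw [(hasFDerivAt_flatIntegral b i₀ l k i z).fderiv,
    (hasFDerivAt_flatIntegral b i₀ l k j z).fderiv]
  have hsum : ∀ i j, ∑ m, b i m * b j m = inner ℝ (b i) (b j) := fun i j => by
    simp [PiLp.inner_apply, mul_comm]
  by_cases hi : i = i₀ <;> by_cases hj : j = i₀
  · subst hi hj
    exact Finset.sum_eq_zero fun m _ => by ring
  · simp [flatIntegralDeriv, hi, hj, hsum, b.inner_eq_zero (Ne.symm hj),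
      EuclideanSpace.inner_single_right]
  · simp [flatIntegralDeriv, hi, hj, hsum, b.inner_eq_zero hi,
      EuclideanSpace.inner_single_right]
  · simp [flatIntegralDeriv, hi, hj]

end

theorem inner_trunc_of_level {b : OrthonormalBasis (Fin d) ℝ (Flat d)} {i₀ : Fin d}
    {l : Flat d →L[ℝ] ℝ} {k μ : ℝ} {z : ReducedPhase d}
    (h : flatIntegral b i₀ l k i₀ (toBall z) = μ) :
    inner ℝ (b i₀) (trunc (z.1 : Full d)) = μ - l z.2 ^ 2 / (2 * k) ∧
      (μ - l z.2 ^ 2 / (2 * k)) ^ 2 ≤ 1 := by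
  have h1 : inner ℝ (b i₀) (trunc (z.1 : Full d)) = μ - l z.2 ^ 2 / (2 * k) := by
    rw [← h, flatIntegral, if_pos rfl]
    simp [toBall]
  refine ⟨h1, ?_⟩
  rw [← h1, sq_le_one_iff_abs_le_one]
  refine (abs_real_inner_le_norm _ _).trans ?_
  rw [b.norm_eq_one, one_mul]
  exact norm_trunc_le_one z.1

section

variable (b : OrthonormalBasis (Fin d) ℝ (Flat d)) (i₀ : Fin d) (l : Flat d →L[ℝ] ℝ) {k : ℝ}

/-- If `ℓ(p) ≠ 0`, the integrals are independent as functions of `p`; if `ℓ(p) = 0`, then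
`(q, bᵢ₀) ≠ ±1`, so the height `(q, bᵢ₀)` is not critical on the sphere. -/
theorem surjective_mfderiv_flatIntegral (hk : k ≠ 0) (hl : l (b i₀) ≠ 0) {x : ReducedPhase d}
    (h1 : flatIntegral b i₀ l k i₀ (toBall x) ≠ 1) (h2 : flatIntegral b i₀ l k i₀ (toBall x) ≠ -1) :
    Function.Surjective (mfderiv ((𝓡 d).prod 𝓘(ℝ, Flat d)) 𝓘(ℝ, Fin d → ℝ)
      (fun y i => flatIntegral b i₀ l k i (toBall y)) x) := by
  have hF : HasFDerivAt (fun z i => flatIntegral b i₀ l k i z)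
      (ContinuousLinearMap.pi fun i => flatIntegralDeriv b i₀ l k i (toBall x)) (toBall x) :=
    hasFDerivAt_pi.mpr fun i => hasFDerivAt_flatIntegral b i₀ l k i (toBall x)
  have hB := ((contMDiff_toBall x).mdifferentiableAt (by simp)).hasMFDerivAt
  have hcomp : HasMFDerivAt ((𝓡 d).prod 𝓘(ℝ, Flat d)) 𝓘(ℝ, Fin d → ℝ)
      (fun y i => flatIntegral b i₀ l k i (toBall y)) x _ := hF.hasMFDerivAt.comp x hB
  rw [hcomp.mfderiv]
  intro w
  set w' : Fin d → ℝ := w with hw'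
  set δ₀ : Flat d := b.repr.symm (WithLp.toLp 2 (Function.update w' i₀ 0)) with hδ₀
  have hδ : ∀ t : ℝ, ∀ i, i ≠ i₀ → inner ℝ (b i) (δ₀ + t • b i₀) = w' i := by
    intro t i hi
    rw [inner_add_right, real_inner_smul_right, b.inner_eq_zero hi, ← b.repr_apply_apply, hδ₀,
      LinearIsometryEquiv.apply_symm_apply]
    simp [hi]
  obtain ⟨v, t, hv, hvt⟩ : ∃ (v : Full d) (t : ℝ), inner ℝ (x.1 : Full d) v = (0 : ℝ) ∧
      inner ℝ (b i₀) (trunc v) + l x.2 / k * l (δ₀ + t • b i₀) = w' i₀ := by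
    by_cases hr : l x.2 = 0
    · have hs : flatIntegral b i₀ l k i₀ (toBall x) = inner ℝ (b i₀) (trunc (x.1 : Full d)) := by
        simp [flatIntegral, toBall, hr]
      rw [hs] at h1 h2
      set s : ℝ := inner ℝ (b i₀) (trunc (x.1 : Full d)) with hsdef
      have hs1 : 1 - s ^ 2 ≠ 0 := by
        intro h
        rcases mul_self_eq_one_iff.mp (by linarith : s * s = 1) with h | h
        · exact h1 h
        · exact h2 h
      refine ⟨(w' i₀ / (1 - s ^ 2)) • (mkFull (b i₀) 0 - s • (x.1 : Full d)), 0, ?_, ?_⟩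
      · rw [real_inner_smul_right, inner_sub_right, real_inner_smul_right,
          real_inner_self_eq_norm_sq, mem_sphere_zero_iff_norm.mp x.1.2, inner_full, trunc_mkFull,
          real_inner_comm, ← hsdef]
        simp
      · have h3 : trunc ((w' i₀ / (1 - s ^ 2)) • (mkFull (b i₀) 0 - s • (x.1 : Full d))) =
            (w' i₀ / (1 - s ^ 2)) • (b i₀ - s • trunc (x.1 : Full d)) := by
          ext i
          simp
        rw [h3, hr, real_inner_smul_right, inner_sub_right, real_inner_smul_right, ← hsdef,
          real_inner_self_eq_norm_sq, b.norm_eq_one]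
        field_simp
        ring
    · refine ⟨0, (k * w' i₀ / l x.2 - l δ₀) / l (b i₀), inner_zero_right _, ?_⟩
      have h3 : trunc (0 : Full d) = 0 := rfl
      rw [h3, inner_zero_right, map_add, map_smul, smul_eq_mul]
      field_simp
      ring
  obtain ⟨ξ, hξ⟩ := exists_mfderiv_toBall_eq x hv (δ₀ + t • b i₀)
  refine ⟨ξ, funext fun i => ?_⟩
  have h3 : flatIntegralDeriv b i₀ l k i (toBall x) (trunc v, δ₀ + t • b i₀) = w' i := by
    unfold flatIntegralDeriv
    split_ifs with hi
    · subst hi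
      simpa [toBall] using hvt
    · exact hδ t i hi
  rw [← h3, ← hξ]
  rfl

theorem volume_level_eq_zero (hl : l (b i₀) ≠ 0) (s : ℝ) : volume {p : Flat d | l p = s} = 0 := by
  set S : AffineSubspace ℝ (Flat d) := AffineSubspace.mk' ((s / l (b i₀)) • b i₀) l.ker with hS
  have h1 : {p : Flat d | l p = s} = S := by
    ext p
    simp only [hS, mem_ofPred_eq, SetLike.mem_coe, AffineSubspace.mem_mk', vsub_eq_sub,
      LinearMap.mem_ker, ContinuousLinearMap.coe_coe, map_sub, map_smul, smul_eq_mul]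
    rw [div_mul_cancel₀ _ hl, sub_eq_zero]
  rw [h1]
  refine Measure.addHaar_affineSubspace _ _ fun h => hl ?_
  have h2 : S.direction = ⊤ := by rw [h, AffineSubspace.direction_top]
  rw [hS, AffineSubspace.direction_mk'] at h2
  have h3 : b i₀ ∈ l.ker := h2 ▸ Submodule.mem_top
  exact h3

theorem reducedMeasure_level_eq_zero (hk : k ≠ 0) (hl : l (b i₀) ≠ 0) (c : ℝ) :
    reducedMeasure d {x | flatIntegral b i₀ l k i₀ (toBall x) = c} = 0 := by
  have hcont : Continuous fun x : ReducedPhase d => flatIntegral b i₀ l k i₀ (toBall x) :=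
    (contDiff_flatIntegral b i₀ l k i₀).continuous.comp contMDiff_toBall.continuous
  have hmeas : MeasurableSet {x : ReducedPhase d | flatIntegral b i₀ l k i₀ (toBall x) = c} :=
    (isClosed_eq hcont continuous_const).measurableSet
  rw [reducedMeasure, Measure.measure_prod_null hmeas]
  refine Filter.Eventually.of_forall fun q => ?_
  set e : ℝ := 2 * k * (c - inner ℝ (b i₀) (trunc (q : Full d)))
  refine measure_mono_null (t := {p | l p = √e} ∪ {p | l p = -√e}) (fun p hp => ?_)
    (measure_union_null (volume_level_eq_zero b i₀ l hl _) (volume_level_eq_zero b i₀ l hl _))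
  have h1 : inner ℝ (b i₀) (trunc (q : Full d)) + l p ^ 2 / (2 * k) = c := by
    have h2 : flatIntegral b i₀ l k i₀ (toBall (q, p)) = c := hp
    simpa [flatIntegral, toBall] using h2
  have h2 : l p ^ 2 = e := by
    simp only [e, ← h1]
    field_simp
    ring
  rw [mem_union, mem_ofPred_eq, mem_ofPred_eq, ← h2, Real.sqrt_sq_eq_abs]
  exact (abs_choice (l p)).elim (fun h => Or.inl h.symm) fun h => Or.inr (by rw [h, neg_neg])

end

open Polynomial in
/-- The region `(μ - r² / 2k)² ≤ 1`, for `μ ≠ ±1`: each of its components is an interval, and the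
defining function has simple zeros at its ends. -/
theorem exists_energy_well {k μ r₀ : ℝ} (hk : 0 < k) (h1 : μ ≠ 1) (h2 : μ ≠ -1)
    (h0 : (μ - r₀ ^ 2 / (2 * k)) ^ 2 ≤ 1) :
    ∃ (α β : ℝ) (K : ℝ[X]), α < β ∧
      (∀ r, 1 - (μ - r ^ 2 / (2 * k)) ^ 2 = (r - α) * (β - r) * K.eval r) ∧
      (∀ r ∈ Icc α β, 0 < K.eval r) ∧
      ∀ S : Set ℝ, IsPreconnected S → r₀ ∈ S → (∀ r ∈ S, (μ - r ^ 2 / (2 * k)) ^ 2 ≤ 1) →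
        S ⊆ Icc α β := by
  set F : ℝ[X] := 1 - (C μ - C (2 * k)⁻¹ * X ^ 2) ^ 2 with hF
  have hFe : ∀ r, F.eval r = 1 - (μ - r ^ 2 / (2 * k)) ^ 2 := by
    intro r
    simp [hF]
    ring
  have hFd : ∀ r, F.derivative.eval r = 2 * (μ - r ^ 2 / (2 * k)) * (r / k) := by
    intro r
    simp [hF, derivative_pow]
    field_simp
  have hsimple : ∀ r, F.eval r = 0 → F.derivative.eval r ≠ 0 := by
    intro r hr
    rw [hFe, sub_eq_zero, eq_comm, sq, mul_self_eq_one_iff] at hr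
    rw [hFd]
    refine mul_ne_zero (mul_ne_zero two_ne_zero ?_) (div_ne_zero ?_ hk.ne')
    · rcases hr with hr | hr <;> rw [hr] <;> norm_num
    · rintro rfl
      simp only [ne_eq, OfNat.ofNat_ne_zero, not_false_eq_true, zero_pow, zero_div, sub_zero] at hr
      exact hr.elim h1 h2
  set N : ℝ := |r₀| + 1 + 2 * k * (|μ| + 2) with hN
  have hN1 : 1 ≤ N := by
    have := abs_nonneg r₀
    have : 0 ≤ 2 * k * (|μ| + 2) := by positivity
    linarith
  have hneg : ∀ r, r ^ 2 = N ^ 2 → F.eval r < 0 := by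
    intro r hr
    have h3 : |μ| + 2 ≤ r ^ 2 / (2 * k) := by
      rw [le_div_iff₀ (by positivity), hr]
      nlinarith [abs_nonneg r₀]
    rw [hFe]
    nlinarith [le_abs_self μ]
  have hrN : |r₀| < N := by
    have : 0 ≤ 2 * k * (|μ| + 2) := by positivity
    linarith
  obtain ⟨α, β, hαβ, hα, hβ, hFα, hFβ, hpos⟩ := exists_well (x₀ := r₀) F.hasDerivAt hsimple
    (by rw [hFe]; linarith) ⟨-N, (abs_lt.mp hrN).1, hneg _ (neg_sq N)⟩
    ⟨N, (abs_lt.mp hrN).2, hneg _ rfl⟩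
  obtain ⟨K, hK, hKpos⟩ := exists_factor hsimple hαβ hFα hFβ hpos
  have hFK : ∀ r, F.eval r = (r - α) * (β - r) * K.eval r := by
    intro r
    rw [hK]
    simp
  refine ⟨α, β, K, hαβ, fun r => by rw [← hFe, hFK], hKpos, fun S hS h0S hSF r hr => ?_⟩
  by_contra hout
  -- beyond the ends of the interval the function is negative
  have hKβ : ∀ᶠ s in nhds β, 0 < K.eval s :=
    K.continuous.continuousAt.eventually (lt_mem_nhds (hKpos β ⟨hαβ.le, le_rfl⟩))
  have hKα : ∀ᶠ s in nhds α, 0 < K.eval s :=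
    K.continuous.continuousAt.eventually (lt_mem_nhds (hKpos α ⟨le_rfl, hαβ.le⟩))
  rw [mem_Icc, not_and_or, not_le, not_le] at hout
  rcases hout with h | h
  · obtain ⟨s, hs, hsr, hsα⟩ := ((hKα.filter_mono nhdsWithin_le_nhds).and
      (Ioo_mem_nhdsLT h)).exists
    have h3 := hSF s (hS.Icc_subset hr h0S ⟨hsr.le, hsα.le.trans hα⟩)
    have h4 := hFK s
    rw [hFe] at h4
    have : (s - α) * (β - s) < 0 := mul_neg_of_neg_of_pos (by linarith) (by linarith)
    nlinarith
  · obtain ⟨s, hs, hsβ, hsr⟩ := ((hKβ.filter_mono nhdsWithin_le_nhds).and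
      (Ioo_mem_nhdsGT h)).exists
    have h3 := hSF s (hS.Icc_subset h0S hr ⟨hβ.trans hsβ.le, hsr.le⟩)
    have h4 := hFK s
    rw [hFe] at h4
    have : (s - α) * (β - s) < 0 := mul_neg_of_pos_of_neg (by linarith) (by linarith)
    nlinarith

/-! ### The invariant spheres -/

theorem norm_sq_axis_add {e : Flat d} (he : ‖e‖ = 1) (s c : ℝ) (y : Flat d) :
    ‖s • e + c • (y - (inner ℝ e y : ℝ) • e)‖ ^ 2 =
      s ^ 2 + c ^ 2 * (‖y‖ ^ 2 - (inner ℝ e y : ℝ) ^ 2) := by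
  have hee : inner ℝ e e = (1 : ℝ) := by rw [real_inner_self_eq_norm_sq, he, one_pow]
  rw [← real_inner_self_eq_norm_sq, ← real_inner_self_eq_norm_sq]
  simp only [inner_add_left, inner_add_right, inner_sub_left, inner_sub_right, real_inner_smul_left,
    real_inner_smul_right, hee, real_inner_comm e y]
  ring

theorem inner_axis_add {e : Flat d} (he : ‖e‖ = 1) (s c : ℝ) (y : Flat d) :
    inner ℝ e (s • e + c • (y - (inner ℝ e y : ℝ) • e)) = s := by
  have hee : inner ℝ e e = (1 : ℝ) := by rw [real_inner_self_eq_norm_sq, he, one_pow]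
  simp only [inner_add_right, inner_sub_right, real_inner_smul_right, hee]
  ring

/-- On a component of a level set, `r = ℓ(p)` ranges over an interval `[α, β]`, and
`1 - (q, e)² = (r - α) (β - r) K(r)`. The ball is parametrised by the position of `r` in the
interval and by the part of `q` orthogonal to `e`, divided by `√K(r)`. -/
theorem isBranchedDoubleSphere_levelComponent (hd : 1 ≤ d)
    (b : OrthonormalBasis (Fin d) ℝ (Flat d)) (i₀ : Fin d) (l : Flat d →L[ℝ] ℝ) {k : ℝ}
    (hk : 0 < k) (hl : l (b i₀) ≠ 0) {x : ReducedPhase d}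
    (h1 : flatIntegral b i₀ l k i₀ (toBall x) ≠ 1) (h2 : flatIntegral b i₀ l k i₀ (toBall x) ≠ -1) :
    IsBranchedDoubleSphere
      (levelComponent (fun i y => flatIntegral b i₀ l k i (toBall y)) x) := by
  obtain ⟨μ, hμ⟩ : ∃ μ, flatIntegral b i₀ l k i₀ (toBall x) = μ := ⟨_, rfl⟩
  rw [hμ] at h1 h2
  obtain ⟨α, β, K, hαβ, hfac, hKpos, hwell⟩ := exists_energy_well hk h1 h2
    (inner_trunc_of_level hμ).2
  set e := b i₀ with he
  have hen : ‖e‖ = 1 := b.norm_eq_one i₀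
  -- the interval `[α, β]` is parametrised by `[-1, 1]`
  set m := (α + β) / 2 with hm
  set h := (β - α) / 2 with hh
  have hhpos : 0 < h := by linarith
  set r : Flat d → ℝ := fun y => m + h * inner ℝ e y with hr
  set κ : Flat d → ℝ := fun y => h * √(K.eval (r y)) with hκ
  set ψ : Flat d → Flat d × Flat d := fun y =>
    ((μ - r y ^ 2 / (2 * k)) • e + κ y • (y - (inner ℝ e y : ℝ) • e),
      x.2 + ((r y - l x.2) / l e) • e) with hψ
  set G : Flat d × Flat d → Flat d := fun z =>
    ((l z.2 - m) / h) • e + (h * √(K.eval (l z.2)))⁻¹ • (z.1 - (inner ℝ e z.1 : ℝ) • e) with hG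
  have hrmem : ∀ y ∈ closedBall (0 : Flat d) 1, r y ∈ Icc α β := by
    intro y hy
    have h3 := abs_real_inner_le_norm e y
    rw [hen, one_mul] at h3
    have h4 := abs_le.mp (h3.trans (mem_closedBall_zero_iff.mp hy))
    constructor <;> simp only [hr, hm, hh] <;> nlinarith
  have hκpos : ∀ y, r y ∈ Icc α β → 0 < κ y := fun y hy =>
    mul_pos hhpos (Real.sqrt_pos.mpr (hKpos _ hy))
  have hlψ : ∀ y, l (ψ y).2 = r y := by
    intro y
    simp only [hψ, map_add, map_smul, smul_eq_mul]
    rw [div_mul_cancel₀ _ hl]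
    ring
  have hball : ∀ y, r y ∈ Icc α β → 1 - ‖(ψ y).1‖ ^ 2 = κ y ^ 2 * (1 - ‖y‖ ^ 2) := by
    intro y hy
    have h3 := hfac (r y)
    have h4 : (r y - α) * (β - r y) = h ^ 2 * (1 - (inner ℝ e y : ℝ) ^ 2) := by
      simp only [hr, hm, hh]
      ring
    rw [h4] at h3
    simp only [hψ]
    rw [norm_sq_axis_add hen]
    have h5 : κ y ^ 2 = h ^ 2 * K.eval (r y) := by
      simp only [hκ]
      rw [mul_pow, Real.sq_sqrt (hKpos _ hy).le]
    rw [h5]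
    linear_combination h3
  have hGψ : ∀ y ∈ closedBall (0 : Flat d) 1, G (ψ y) = y := by
    intro y hy
    have hκy := hκpos y (hrmem y hy)
    have h3 : (h * √(K.eval (r y)))⁻¹ = (κ y)⁻¹ := rfl
    have h4 : inner ℝ e (ψ y).1 = μ - r y ^ 2 / (2 * k) := inner_axis_add hen _ _ _
    simp only [hG, hlψ, h3, h4]
    have h5 : (r y - m) / h = inner ℝ e y := by
      simp only [hr]
      field_simp
      ring
    simp only [hψ]
    rw [h5, add_sub_cancel_left, smul_smul, inv_mul_cancel₀ hκy.ne', one_smul,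
      add_sub_cancel]
  have hrs : ContDiff ℝ ∞ r := contDiff_const.add (contDiff_const.mul
    (contDiff_const.inner ℝ contDiff_id))
  have hKs : ContDiff ℝ ∞ fun s => K.eval s := by
    simpa using K.contDiff_aeval (𝕜 := ℝ) ∞
  have hsqrt : ∀ s ∈ Icc α β, ContDiffAt ℝ ∞ (fun s => h * √(K.eval s)) s := fun s hs =>
    contDiffAt_const.mul (hKs.contDiffAt.sqrt (hKpos s hs).ne')
  have hκs : ∀ y ∈ closedBall (0 : Flat d) 1, ContDiffAt ℝ ∞ κ y := fun y hy =>
    (hsqrt _ (hrmem y hy)).comp y hrs.contDiffAt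
  have hproj : ContDiff ℝ ∞ fun y : Flat d => y - (inner ℝ e y : ℝ) • e :=
    contDiff_id.sub ((contDiff_const.inner ℝ contDiff_id).smul contDiff_const)
  have hψs : ∀ y ∈ closedBall (0 : Flat d) 1, ContDiffAt ℝ ∞ ψ y := by
    intro y hy
    have hr' := hrs.contDiffAt (x := y)
    refine ContDiffAt.prodMk (((contDiffAt_const.sub ((hr'.pow 2).div_const _)).smul
      contDiffAt_const).add ((hκs y hy).smul hproj.contDiffAt)) ?_
    exact contDiffAt_const.add (((hr'.sub contDiffAt_const).div_const _).smul contDiffAt_const)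
  have hGs : ∀ y ∈ closedBall (0 : Flat d) 1, ContDiffAt ℝ ∞ G (ψ y) := by
    intro y hy
    have hls : ContDiffAt ℝ ∞ (fun z : Flat d × Flat d => l z.2) (ψ y) :=
      (l.contDiff.comp contDiff_snd).contDiffAt
    have h3 : ContDiffAt ℝ ∞ (fun z : Flat d × Flat d => h * √(K.eval (l z.2))) (ψ y) := by
      refine ContDiffAt.comp (ψ y) (g := fun s => h * √(K.eval s)) ?_ hls
      rw [hlψ]
      exact hsqrt _ (hrmem y hy)
    have h4 := (h3.inv (by rw [hlψ]; exact (hκpos y (hrmem y hy)).ne')).smul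
      (hproj.comp contDiff_fst).contDiffAt
    exact (((hls.sub contDiffAt_const).div_const _).smul contDiffAt_const).add h4
  obtain ⟨hsphere, hconn⟩ := isBranchedDoubleSphere_preimage hψs hκs
    (fun y hy => hκpos y (hrmem y hy)) hGs hGψ fun y hy => hball y (hrmem y hy)
  set f : Fin d → ReducedPhase d → ℝ := fun i y => flatIntegral b i₀ l k i (toBall y) with hf
  have hlevel : toBall ⁻¹' (ψ '' closedBall 0 1) ⊆ {y | ∀ i, f i y = f i x} := by
    rintro z ⟨y, hy, hz⟩ i
    simp only [hf]
    by_cases hi : i = i₀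
    · subst hi
      rw [hμ, ← hz, flatIntegral, if_pos rfl, hlψ, ← he]
      rw [show inner ℝ e (ψ y).1 = μ - r y ^ 2 / (2 * k) from inner_axis_add hen _ _ _]
      ring
    · rw [flatIntegral, if_neg hi, flatIntegral, if_neg hi, ← hz]
      simp only [hψ, toBall]
      rw [inner_add_right, real_inner_smul_right, he, b.inner_eq_zero hi, mul_zero, add_zero]
  have hmax : ∀ S : Set (ReducedPhase d), IsPreconnected S → x ∈ S →
      S ⊆ {y | ∀ i, f i y = f i x} → S ⊆ toBall ⁻¹' (ψ '' closedBall 0 1) := by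
    intro S hS hx hSf z hz
    have hlev : ∀ z ∈ S, flatIntegral b i₀ l k i₀ (toBall z) = μ := fun z hz =>
      (hSf hz i₀).trans hμ
    have hlz : l z.2 ∈ Icc α β := by
      refine hwell ((fun z : ReducedPhase d => l z.2) '' S)
        (hS.image _ (l.continuous.comp continuous_snd).continuousOn) ⟨x, hx, rfl⟩ ?_ ⟨z, hz, rfl⟩
      rintro _ ⟨w, hw, rfl⟩
      exact (inner_trunc_of_level (hlev w hw)).2
    set y := G (toBall z) with hy
    have hey : inner ℝ e y = (l z.2 - m) / h := inner_axis_add hen _ _ _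
    have hry : r y = l z.2 := by
      simp only [hr, hey]
      field_simp
      ring
    have hκy := hκpos y (hry ▸ hlz)
    have hψy : ψ y = toBall z := by
      refine Prod.ext ?_ ?_
      · have h3 : y - (inner ℝ e y : ℝ) • e =
            (κ y)⁻¹ • (trunc (z.1 : Full d) - (inner ℝ e (trunc (z.1 : Full d)) : ℝ) • e) := by
          rw [hey, show κ y = h * √(K.eval (l z.2)) by simp only [hκ, hry], hy]
          simp only [hG, toBall, add_sub_cancel_left]
        simp only [hψ]
        rw [h3, hry, ← (inner_trunc_of_level (hlev z hz)).1, smul_smul, mul_inv_cancel₀ hκy.ne',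
          one_smul, ← he, add_sub_cancel]
        rfl
      · have h3 : z.2 - x.2 = (inner ℝ e (z.2 - x.2) : ℝ) • e := by
          conv_lhs => rw [← b.sum_repr' (z.2 - x.2)]
          refine Finset.sum_eq_single i₀ (fun i _ hi => ?_) (by simp)
          have h4 := hSf hz i
          simp only [hf, flatIntegral, if_neg hi, toBall] at h4
          rw [inner_sub_right, h4, sub_self, zero_smul]
        have h4 : l z.2 - l x.2 = inner ℝ e (z.2 - x.2) * l e := by
          rw [← map_sub]
          conv_lhs => rw [h3]
          rw [map_smul, smul_eq_mul]
        simp only [hψ]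
        rw [hry, h4, mul_div_cancel_right₀ _ hl, ← h3, add_sub_cancel]
        rfl
    refine ⟨y, mem_closedBall_zero_iff.mpr ?_, hψy⟩
    have h3 := hball y (hry ▸ hlz)
    rw [hψy] at h3
    have h4 : ‖(toBall z).1‖ ≤ 1 := norm_trunc_le_one z.1
    have h5 : 0 ≤ κ y ^ 2 * (1 - ‖y‖ ^ 2) := by
      rw [← h3, sub_nonneg]
      exact pow_le_one₀ (norm_nonneg _) h4
    have h6 : 0 ≤ 1 - ‖y‖ ^ 2 := nonneg_of_mul_nonneg_right h5 (by positivity)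
    exact (sq_le_one_iff₀ (norm_nonneg _)).mp (by linarith)
  have hxmem : x ∈ {y | ∀ i, f i y = f i x} := fun i => rfl
  have hcomp : levelComponent f x ⊆ toBall ⁻¹' (ψ '' closedBall 0 1) :=
    hmax _ isPreconnected_connectedComponentIn (mem_connectedComponentIn hxmem)
      (connectedComponentIn_subset _ _)
  have heq : levelComponent f x = toBall ⁻¹' (ψ '' closedBall 0 1) := hcomp.antisymm
    ((hconn hd).subset_connectedComponentIn (hcomp (mem_connectedComponentIn hxmem)) hlevel)
  rw [heq]
  exact hsphere

/-! ### The foliation of the reduced phase space -/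

/-- The complete integrability of the reduced problem, with invariant spheres as level sets. -/
def IsFoliatedBySpheres (I : InertiaOperator d) (v : Full d → ℝ) (f : Fin d → ReducedPhase d → ℝ)
    (U : Set (ReducedPhase d)) : Prop :=
  (∀ i, ContMDiff ((𝓡 d).prod 𝓘(ℝ, Flat d)) 𝓘(ℝ, ℝ) ∞ (f i)) ∧
  (∀ i, IsFirstIntegral I v (f i)) ∧ InInvolution f ∧ IsOpen U ∧ reducedMeasure d Uᶜ = 0 ∧
  ∀ x ∈ U,
    Function.Surjective
      (mfderiv ((𝓡 d).prod 𝓘(ℝ, Flat d)) 𝓘(ℝ, Fin d → ℝ) (fun y i => f i y) x) ∧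
    levelComponent f x ⊆ U ∧ IsInvariant I v (levelComponent f x) ∧
    IsBranchedDoubleSphere (levelComponent f x)

/-- Without a potential the momentum is constant, and the leaves are the spheres `Sⁿ⁻¹ × {p}`. -/
theorem isFoliatedBySpheres_zero (hd : 1 ≤ d) (I : InertiaOperator d) :
    IsFoliatedBySpheres I (kharlamovaPotential (0 : Fin d → ℝ)) (fun i y => y.2 i) univ := by
  have hcoord : ∀ i : Fin d, ContDiff ℝ ∞ fun z : Flat d × Flat d => z.2 i := fun i => by fun_prop
  have hfirst : ∀ i, IsFirstIntegral I (kharlamovaPotential (0 : Fin d → ℝ))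
      (fun y : ReducedPhase d => y.2 i) := by
    intro i γ hγ s t
    have h : ∀ t, HasDerivAt (fun s => (γ s).2) 0 t := fun t =>
      (hγ.hasDerivAt_snd t).congr_deriv (by simp)
    exact congrArg (fun p : Flat d => p i)
      (is_const_of_deriv_eq_zero (fun t => (h t).differentiableAt) (fun t => (h t).deriv) s t)
  refine ⟨fun i => (hcoord i).contMDiff.comp contMDiff_toBall, hfirst,
    inInvolution_comp_toBall (F := fun i z => z.2 i) fun i j z => ?_, isOpen_univ, by simp, fun x _ =>
      ⟨fun w => ?_, subset_univ _, isInvariant_levelComponent hfirst x, ?_⟩⟩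
  · have hder : ∀ i, fderiv ℝ (fun z : Flat d × Flat d => z.2 i) z =
        (EuclideanSpace.proj i).comp (ContinuousLinearMap.snd ℝ (Flat d) (Flat d)) := fun i =>
      ((EuclideanSpace.proj (𝕜 := ℝ) i).comp
        (ContinuousLinearMap.snd ℝ (Flat d) (Flat d))).hasFDerivAt.fderiv
    simp [poisson, hder]
  · set w' : Fin d → ℝ := w with hw'
    obtain ⟨ξ, hξ⟩ := exists_mfderiv_toBall_eq x (inner_zero_right (x.1 : Full d))
      (WithLp.toLp 2 w')
    have hF := (PiLp.continuousLinearEquiv 2 ℝ (fun _ : Fin d => ℝ)).hasFDerivAt.comp (toBall x)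
      (ContinuousLinearMap.snd ℝ (Flat d) (Flat d)).hasFDerivAt
    have hB := ((contMDiff_toBall x).mdifferentiableAt (by simp)).hasMFDerivAt
    have hcomp : HasMFDerivAt ((𝓡 d).prod 𝓘(ℝ, Flat d)) 𝓘(ℝ, Fin d → ℝ)
        (fun (y : ReducedPhase d) i => y.2 i) x _ := hF.hasMFDerivAt.comp x hB
    rw [hcomp.mfderiv]
    refine ⟨ξ, ?_⟩
    exact congrArg (fun z : Flat d × Flat d => (z.2 : Fin d → ℝ)) hξ
  · obtain ⟨hsphere, hconn⟩ := isBranchedDoubleSphere_preimage (ψ := fun y : Flat d => (y, x.2))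
      (κ := fun _ => 1) (G := Prod.fst) (fun _ _ => contDiffAt_id.prodMk contDiffAt_const)
      (fun _ _ => contDiffAt_const) (fun _ _ => one_pos) (fun _ _ => contDiffAt_fst)
      (fun _ _ => rfl) (fun _ _ => by ring)
    have hlevel : toBall ⁻¹' ((fun y : Flat d => (y, x.2)) '' closedBall 0 1) =
        {y : ReducedPhase d | ∀ i, y.2 i = x.2 i} := by
      ext z
      constructor
      · rintro ⟨y, -, hy⟩ i
        exact congrArg (fun p : Flat d => p i) (congrArg Prod.snd hy).symm
      · intro hz
        exact ⟨trunc (z.1 : Full d), mem_closedBall_zero_iff.mpr (norm_trunc_le_one z.1),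
          Prod.ext rfl (PiLp.ext fun i => (hz i).symm)⟩
    have hx : x ∈ {y : ReducedPhase d | ∀ i, y.2 i = x.2 i} := fun i => rfl
    have hcomp : levelComponent (fun i y => y.2 i) x =
        toBall ⁻¹' ((fun y : Flat d => (y, x.2)) '' closedBall 0 1) := by
      rw [hlevel]
      exact (hlevel ▸ hconn hd).connectedComponentIn hx
    rw [hcomp]
    exact hsphere

theorem isFoliatedBySpheres_flatIntegral (hd : 1 ≤ d) (I : InertiaOperator d) {C : Fin d → ℝ}
    {b : OrthonormalBasis (Fin d) ℝ (Flat d)} {i₀ : Fin d} {l : Flat d →L[ℝ] ℝ} {k c : ℝ}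
    (hk : 0 < k) (hC : WithLp.toLp 2 C = c • b i₀) (hl : ∀ p, l p = inner ℝ (b i₀) (I.opA p))
    (hlk : l (WithLp.toLp 2 C) = k) :
    IsFoliatedBySpheres I (kharlamovaPotential C) (fun i x => flatIntegral b i₀ l k i (toBall x))
      {x | flatIntegral b i₀ l k i₀ (toBall x) ≠ 1 ∧ flatIntegral b i₀ l k i₀ (toBall x) ≠ -1} := by
  have hl0 : l (b i₀) ≠ 0 := by
    intro h
    rw [hC, map_smul, h, smul_zero] at hlk
    exact hk.ne hlk
  have hcont : Continuous fun x : ReducedPhase d => flatIntegral b i₀ l k i₀ (toBall x) :=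
    (contDiff_flatIntegral b i₀ l k i₀).continuous.comp contMDiff_toBall.continuous
  have hfirst := isFirstIntegral_flatIntegral b i₀ l k I hk.ne' hC hl hlk
  refine ⟨fun i => (contDiff_flatIntegral b i₀ l k i).contMDiff.comp contMDiff_toBall, hfirst,
    inInvolution_comp_toBall (poisson_flatIntegral b i₀ l k), ?_, ?_, fun x hx =>
      ⟨surjective_mfderiv_flatIntegral b i₀ l hk.ne' hl0 hx.1 hx.2, fun y hy => ?_,
        isInvariant_levelComponent hfirst x,
        isBranchedDoubleSphere_levelComponent hd b i₀ l hk hl0 hx.1 hx.2⟩⟩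
  · exact (isOpen_ne_fun hcont continuous_const).inter (isOpen_ne_fun hcont continuous_const)
  · refine measure_mono_null (fun x hx => ?_) (measure_union_null
      (reducedMeasure_level_eq_zero b i₀ l hk.ne' hl0 1)
      (reducedMeasure_level_eq_zero b i₀ l hk.ne' hl0 (-1)))
    rwa [mem_compl_iff, mem_ofPred_eq, not_and_or, not_not, not_not] at hx
  · have : flatIntegral b i₀ l k i₀ (toBall y) = flatIntegral b i₀ l k i₀ (toBall x) :=
      connectedComponentIn_subset _ _ hy i₀
    rw [mem_ofPred_eq, this]
    exact hx

theorem exists_isFoliatedBySpheres (hd : 1 ≤ d) (I : InertiaOperator d) (C : Fin d → ℝ) :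
    ∃ f U, IsFoliatedBySpheres I (kharlamovaPotential C) f U := by
  by_cases hC : C = 0
  · subst hC
    exact ⟨_, _, isFoliatedBySpheres_zero hd I⟩
  have hC' : (WithLp.toLp 2 C : Flat d) ≠ 0 := fun h => hC (congrArg WithLp.ofLp h)
  set c := ‖(WithLp.toLp 2 C : Flat d)‖ with hc
  have hcpos : 0 < c := norm_pos_iff.mpr hC'
  set i₀ : Fin d := ⟨0, hd⟩ with hi₀
  have horth : Orthonormal ℝ (({i₀} : Set (Fin d)).domRestrict
      fun _ => c⁻¹ • (WithLp.toLp 2 C : Flat d)) := by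
    refine ⟨fun i => ?_, fun i j hij => absurd (Subsingleton.elim i j) hij⟩
    rw [domRestrict_apply, norm_smul, norm_inv, hc, norm_norm, inv_mul_cancel₀ hcpos.ne']
  obtain ⟨b, hb⟩ := horth.exists_orthonormalBasis_extension_of_card_eq
    (by rw [finrank_euclideanSpace])
  have hb0 : b i₀ = c⁻¹ • WithLp.toLp 2 C := hb i₀ rfl
  refine ⟨_, _, isFoliatedBySpheres_flatIntegral hd I (b := b) (i₀ := i₀) (c := c)
    (l := (innerSL ℝ (b i₀)).comp (LinearMap.toContinuousLinearMap I.opA.toLinearMap))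
    ?_ ?_ (fun p => rfl) rfl⟩
  · change 0 < inner ℝ (b i₀) (I.opA (WithLp.toLp 2 C))
    rw [hb0, real_inner_smul_left, real_inner_comm]
    exact mul_pos (inv_pos.mpr hcpos) (I.inner_opA_pos hC')
  · rw [hb0, smul_smul, mul_inv_cancel₀ hcpos.ne', one_smul]

end Suslov

open Suslov in
theorem mainTheorem3 (d : ℕ) (hd : 1 ≤ d) (I : InertiaOperator d) (C : Fin d → ℝ) :
    -- almost everywhere, the reduced phase space is foliated by invariant spheres
    (∃ (f : Fin d → ReducedPhase d → ℝ) (U : Set (ReducedPhase d)),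
      (∀ i, ContMDiff ((𝓡 d).prod 𝓘(ℝ, Flat d)) 𝓘(ℝ, ℝ) ∞ (f i)) ∧
      (∀ i, IsFirstIntegral I (kharlamovaPotential C) (f i)) ∧
      InInvolution f ∧
      IsOpen U ∧ reducedMeasure d Uᶜ = 0 ∧
      ∀ x ∈ U,
        Function.Surjective
          (mfderiv ((𝓡 d).prod 𝓘(ℝ, Flat d)) 𝓘(ℝ, Fin d → ℝ) (fun y i => f i y) x) ∧
        levelComponent f x ⊆ U ∧
        IsInvariant I (kharlamovaPotential C) (levelComponent f x) ∧
        IsBranchedDoubleSphere (levelComponent f x)) ∧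
    -- almost all trajectories of the reduced problem are closed
    (∀ᵐ x ∂(reducedMeasure d), ∃ γ : ℝ → ReducedPhase d,
      IsReducedSolution I (kharlamovaPotential C) γ ∧ γ 0 = x ∧ IsClosedTrajectory γ) ∧
    -- almost all of `D` is filled with conditionally periodic trajectories of dimension at most
    -- `[n/(n-1)] + 1`, where `n = d + 1`; they lie over closed trajectories of the reduced problem
    (∀ᵐ z ∂(DMeasure d), ∃ γ : ℝ → DPhase d,
      IsSuslovSolution I (kharlamovaPotential C) γ ∧ γ 0 = z ∧
      IsReducedSolution I (kharlamovaPotential C) (fun t => (γ t).reduce I) ∧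
      IsClosedTrajectory (fun t => (γ t).reduce I) ∧
      ∃ m : ℕ, m ≤ (d + 1) / d + 1 ∧ IsConditionallyPeriodic m γ) ∧
    -- and `[n/(n-1)] + 1` is the maximal dimension, if `n ≥ 3` and the potential is not zero
    (2 ≤ d → C ≠ 0 → ∃ γ : ℝ → DPhase d,
      IsSuslovSolution I (kharlamovaPotential C) γ ∧
      IsConditionallyPeriodic ((d + 1) / d + 1) γ) := by
  refine ⟨exists_isFoliatedBySpheres hd I C, ae_exists_closedTrajectory hd I C,
    ae_exists_conditionallyPeriodic hd I C,
    fun hd2 hC => exists_conditionallyPeriodic_max I C hd2 hC⟩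

end
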